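/- Let $\mathbb K=\mathbb R$ or $\mathbb C$, and put $$\varphi_1(t)=\frac{t}{e^t-1},\quad \psi=-\tfrac12(\varphi_1-1),\quad \beta_{\alpha}(t)=\varphi_1(-t)\Big(\frac{\varphi_1(t)-1}{t}+\alpha\Big),\quad R(t)=\frac{e^t-e^{-t}-2t}{t^2},\quad g=\tfrac12R .$$ **Universal solutions.** A solution of the Kashiwara–Vergne conjecture on a finite-dimensional Lie algebra $\mathfrak g$ over $\mathbb K$ is a pair of $\mathfrak g$-valued functions $A,B$, analytic near $(0,0)\in\mathfrak g\times\mathfrak g$ and vanishing at $(0,0)$, such that near $(0,0)$ $$\ln(e^Ye^X)-X-Y=(1-e^{-\operatorname{ad}X})A(X,Y)+(e^{\operatorname{ad}Y}-1)B(X,Y),$$ $$\operatorname{tr}\big(\operatorname{ad}X\circ\delta_1A+\operatorname{ad}Y\circ\delta_2B\big)=\operatorname{tr}\big(\psi(\operatorname{ad}X)+\psi(\operatorname{ad}Y)-\psi(\operatorname{ad}\ln(e^Xe^Y))\big),$$ where $\delta_1A$, $\delta_2B$ are the partial derivatives of $A$ in $X$ and of $B$ in $Y$. A universal solution is a pair of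 series of Lie polynomials in two variables which, on every finite-dimensional Lie algebra over $\mathbb K$, converge near $(0,0)$ to a solution. **The two solutions.** Let $\mathfrak g$ be a quadratic Lie algebra over $\mathbb K$, i.e. finite-dimensional with an invariant nondegenerate symmetric bilinear form $(\cdot,\cdot)$, used to identify $\mathfrak g^*$ with $\mathfrak g$. On $\mathfrak g$ let $\varpi_X(u,v)=(g(\operatorname{ad}X)u,v)$, and near $(0,0)\in\mathfrak g\times\mathfrak g$ let $$\sigma=Z^*\varpi-\varpi_X-\varpi_Y+\tfrac12(\theta^L_X,\theta^R_Y),\qquad Z(X,Y)=\ln(e^Xe^Y),$$ with $\theta^L_X=\frac{1-e^{-\operatorname{ad}X}}{\operatorname{ad}X}dX$, $\theta^R_Y=\frac{e^{\operatorname{ad}Y}-1}{\operatorname{ad}Y}dY$ and $(\theta^L_X,\theta^R_Y)(u,v)=(\theta^L_Xu,\theta^R_Yv)-(\theta^L_Xv,\theta^R_Yu)$. Let $a_p=\int_0^1 s\,\sigma_{sp}(p,\cdot)\,ds$ be its radial primitive at $p=(X,Y)$. The Alekseev–Meinrenken solution $(A_{AM},B_{AM})$ is the solution, near $(0,0)$,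 of $$(A,B)-\sigma_p\big(([X,A],[Y,B]),\cdot\big)=\sigma_p(p,\cdot)-a_p .$$ Vergne's solution is $A_V(X,Y)=\varphi_1(-\operatorname{ad}X)a$, $B_V(X,Y)=\varphi_1(\operatorname{ad}Y)b$, where $(b,a)=-a_{(Y,X)}$. **Claim.** There are power series $\beta_{AM},\gamma_{AM},\gamma_V,\Pi\in\mathbb K[[t]]$ such that, on every quadratic Lie algebra over $\mathbb K$, for $X$ near $0$ (where these series converge at $\operatorname{ad} X$), $$A_{AM}(X,Y)=\beta_{AM}(\operatorname{ad}X)(Y)+o(Y),\quad B_{AM}(X,Y)=\tfrac14X+\gamma_{AM}(\operatorname{ad}X)(Y)+o(Y),\quad B_V(X,Y)=\tfrac14X+\gamma_V(\operatorname{ad}X)(Y)+o(Y)$$ (so $\rho_{AM}=0$ and $\alpha_{AM}=\frac14$). They satisfy $$t\gamma_V'+2\gamma_V=\tfrac18t-\tfrac12t\,\varphi_1(-t)R(t)\varphi_1'(t),\qquad t\Pi'+2\Pi=\tfrac12\varphi_1(t)^{-1}-g(t)\varphi_1(-t)(1-\varphi_1(t)),$$ $$\beta_{AM}(t)=\Pi(t)-\tfrac14\big(g(t)\varphi_1(-t)-\tfrac12\varphi_1(t)^{-1}\big)t-\tfrac12\varphi_1(t)^{-1}+g(t)\varphi_1(-t)(1-\varphi_1(t)),$$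 $$\gamma_{AM}(-t)+\gamma_V(t)=\varphi_1(-t)g(t)t\big(\beta_{AM}(-t)-\tfrac14\varphi_1(t)-\varphi_1'(t)\big)-\tfrac12\varphi_1(t)^{-1}t\,\beta_{AM}(-t)-\tfrac18t,$$ and moreover $\beta_{AM}=\beta_{1/4}$, the odd parts of $\gamma_{AM}$ and $\gamma_V$ coincide, and $$t\gamma_{AM}'(t)+2\gamma_{AM}(t)=\tfrac18t+\tfrac1{12}t^2+\tfrac1{72}t^3-\tfrac1{720}t^4+o(t^4).$$ The Alekseev–Meinrenken solution is not universal and differs from Vergne's: there is a quadratic Lie algebra over $\mathbb K$ on which no universal solution coincides with $(A_{AM},B_{AM})$ near $(0,0)$, and on which $B_{AM}$ and $B_V$ do not coincide near $(0,0)$. -/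

import Mathlib

open scoped Topology PowerSeries

noncomputable section

/-- A Lie ring whose additive group carries a norm. No compatibility between the norm and the
bracket is required: in finite dimension the bracket is automatically continuous. -/
class NormedLieRing (L : Type*) extends NormedAddCommGroup L, LieRing L

/-- A Lie algebra over `𝕜` whose underlying vector space is a normed space. Every
finite-dimensional Lie algebra over `ℝ` or `ℂ` has such a structure, and the choice of the norm is
immaterial because all norms are equivalent. -/
class NormedLieAlgebra (𝕜 : Type*) (L : Type*) [NormedField 𝕜] [NormedLieRing L] extends
  NormedSpace 𝕜 L, LieAlgebra 𝕜 L

namespace KashiwaraVergne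

/-! ### Formal power series in one variable -/

section Series

variable (𝕜 : Type*) [RCLike 𝕜]

/-- `φ₁(t) = t / (e ^ t - 1)`, the generating series of the Bernoulli numbers (`B₁ = -1/2`). -/
def phi : 𝕜⟦X⟧ := bernoulliPowerSeries 𝕜

/-- `ψ(t) = -(φ₁(t) - 1) / 2`. -/
def psi : 𝕜⟦X⟧ := -((1 / 2 : 𝕜) • (phi 𝕜 - 1))

/-- `β_α(t) = φ₁(-t) ((φ₁(t) - 1) / t + α)`. -/
def betaSeries (α : 𝕜) : 𝕜⟦X⟧ :=
  PowerSeries.evalNegHom (phi 𝕜) *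
    (PowerSeries.mk (fun n => PowerSeries.coeff (n + 1) (phi 𝕜 - 1)) + PowerSeries.C α)

/-- `R(t) = (e ^ t - e ^ (-t) - 2 t) / t ^ 2`. -/
def rSeries : 𝕜⟦X⟧ :=
  PowerSeries.mk fun n => PowerSeries.coeff (n + 2)
    (PowerSeries.exp 𝕜 - PowerSeries.evalNegHom (PowerSeries.exp 𝕜) - 2 * PowerSeries.X)

/-- `g(t) = R(t) / 2 = (sinh t - t) / t ^ 2`. -/
def gSeries : 𝕜⟦X⟧ := (1 / 2 : 𝕜) • rSeries 𝕜

/-- `(e ^ t - 1) / t`. -/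
def expQuot : 𝕜⟦X⟧ := PowerSeries.mk fun n => PowerSeries.coeff (n + 1) (PowerSeries.exp 𝕜)

/-- `log (1 + w) / w = ∑ (-1) ^ n w ^ n / (n + 1)`. -/
def logQuot : 𝕜⟦X⟧ := PowerSeries.mk fun n => (-1) ^ n / ((n : 𝕜) + 1)

variable {𝕜}

/-- The operator `f(t) ↦ t f'(t) + 2 f(t)` on power series. -/
def eulerTwo (f : 𝕜⟦X⟧) : 𝕜⟦X⟧ := PowerSeries.X * PowerSeries.derivative 𝕜 f + 2 * f

end Series

/-! ### Lie algebras: functions of `ad X`, the Campbell-Hausdorff series, the conjecture -/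

section LieAlgebra

variable {𝕜 : Type*} [RCLike 𝕜] {L : Type*} [NormedLieRing L] [NormedLieAlgebra 𝕜 L]

/-- The value `f(T) = ∑ fₙ Tⁿ` of a power series at an operator. -/
def opEval (f : 𝕜⟦X⟧) (T : L →L[𝕜] L) : L →L[𝕜] L :=
  ∑' n : ℕ, PowerSeries.coeff n f • T ^ n

variable [FiniteDimensional 𝕜 L]

variable (𝕜) in
/-- `ad X` as a continuous operator. -/
def adL (x : L) : L →L[𝕜] L := LinearMap.toContinuousLinearMap (LieAlgebra.ad 𝕜 L x)

variable (𝕜) in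
/-- The Campbell-Hausdorff series `log (exp x exp y)` near `(0, 0)`, in Poincaré's closed form
`y + ∫₀¹ φ₁(ad Z_s) x ds` where `Z_s = log (exp (s x) exp y)`. Here
`e ^ (ad Z_s) = e ^ (s ad x) e ^ (ad y)`, and `φ₁(ad Z_s) = log W / (W - 1)` for this operator `W`.
It is the integral from `s = 0` to `s = 1` of
`d/ds log (exp (s x) exp y) = φ₁(ad Z_s) x`. -/
def bch (x y : L) : L :=
  letI : NormedSpace ℝ L := NormedSpace.restrictScalars ℝ 𝕜 L
  y + ∫ s in (0 : ℝ)..1,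
    opEval (logQuot 𝕜)
      (NormedSpace.exp ((s : 𝕜) • adL 𝕜 x) * NormedSpace.exp (adL 𝕜 y) - 1) x

variable (𝕜) in
/-- `(A, B)` is a solution of the Kashiwara-Vergne conjecture on `L`: `A` and `B` are analytic near
`(0, 0)`, vanish at `(0, 0)`, and near `(0, 0)` they satisfy
`log (exp Y exp X) - X - Y = (1 - e ^ (- ad X)) A(X, Y) + (e ^ (ad Y) - 1) B(X, Y)` and
`tr (ad X ∘ δ₁A(X, Y) + ad Y ∘ δ₂B(X, Y)) = tr (ψ(ad X) + ψ(ad Y) - ψ(ad log (exp X exp Y)))`,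
where `δ₁A` is the derivative of `A` in `X` and `δ₂B` is the derivative of `B` in `Y`. -/
structure IsKVSolution (A B : L × L → L) : Prop where
  analytic_A : AnalyticAt 𝕜 A (0, 0)
  analytic_B : AnalyticAt 𝕜 B (0, 0)
  zero_A : A (0, 0) = 0
  zero_B : B (0, 0) = 0
  log_eq : ∀ᶠ p : L × L in 𝓝 (0, 0),
    bch 𝕜 p.2 p.1 - p.1 - p.2 =
      (1 - NormedSpace.exp (-adL 𝕜 p.1)) (A p) + (NormedSpace.exp (adL 𝕜 p.2) - 1) (B p)
  trace_eq : ∀ᶠ p : L × L in 𝓝 (0, 0),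
    LinearMap.trace 𝕜 L
        (adL 𝕜 p.1 * fderiv 𝕜 (fun x => A (x, p.2)) p.1 +
          adL 𝕜 p.2 * fderiv 𝕜 (fun y => B (p.1, y)) p.2 : L →L[𝕜] L).toLinearMap =
      LinearMap.trace 𝕜 L
        (opEval (psi 𝕜) (adL 𝕜 p.1) + opEval (psi 𝕜) (adL 𝕜 p.2) -
          opEval (psi 𝕜) (adL 𝕜 (bch 𝕜 p.1 p.2)) : L →L[𝕜] L).toLinearMap

/-- `F(X, Y) = c X + f(ad X)(Y) + o(Y)`: for all `X` near `0`, the series `f(ad X)` converges,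
`F(X, 0) = c X`, and `f(ad X)` is the derivative of `F(X, ·)` at `Y = 0`. -/
def HasFirstOrder (F : L × L → L) (c : 𝕜) (f : 𝕜⟦X⟧) : Prop :=
  ∀ᶠ x : L in 𝓝 0, F (x, 0) = c • x ∧
    ∃ T : L →L[𝕜] L, HasSum (fun n : ℕ => PowerSeries.coeff n f • adL 𝕜 x ^ n) T ∧
      HasFDerivAt (fun y => F (x, y)) T 0

end LieAlgebra

/-! ### Universal solutions -/

section Universal

variable (𝕜 : Type*) [RCLike 𝕜]

/-- Lie words of degree `n` in the two generators `0` and `1` of the free Lie algebra. -/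
inductive IsLieWord : ℕ → FreeLieAlgebra 𝕜 (Fin 2) → Prop
  | of (i : Fin 2) : IsLieWord 1 (FreeLieAlgebra.of 𝕜 i)
  | lie {m n : ℕ} {u v : FreeLieAlgebra 𝕜 (Fin 2)} :
      IsLieWord m u → IsLieWord n v → IsLieWord (m + n) ⁅u, v⁆

/-- A series in Lie polynomials of two variables, given by its homogeneous components. -/
structure LieSeries where
  comp : ℕ → FreeLieAlgebra 𝕜 (Fin 2)
  homogeneous : ∀ n, comp n ∈ Submodule.span 𝕜 {w | IsLieWord 𝕜 n w}

variable {𝕜}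

/-- The value at `(X, Y)` of the degree `n` component of a Lie series. -/
def LieSeries.term (a : LieSeries 𝕜) {L : Type*} [LieRing L] [LieAlgebra 𝕜 L] (n : ℕ)
    (p : L × L) : L :=
  FreeLieAlgebra.lift 𝕜 ![p.1, p.2] (a.comp n)

/-- The sum at `(X, Y)` of a Lie series in a normed Lie algebra. -/
def LieSeries.eval (a : LieSeries 𝕜) {L : Type*} [NormedLieRing L] [NormedLieAlgebra 𝕜 L]
    (p : L × L) : L :=
  ∑' n : ℕ, a.term n p

/-- The Lie series `a`, `b` form a universal solution of the Kashiwara-Vergne conjecture over `𝕜`: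
in every finite-dimensional Lie algebra over `𝕜` they converge near `(0, 0)`, and their sums solve
the conjecture. -/
def IsUniversalSolution {𝕜 : Type} [RCLike 𝕜] (a b : LieSeries 𝕜) : Prop :=
  ∀ (L : Type) [NormedLieRing L] [NormedLieAlgebra 𝕜 L] [FiniteDimensional 𝕜 L],
    (∀ᶠ p : L × L in 𝓝 (0, 0),
      (Summable fun n => a.term n p) ∧ (Summable fun n => b.term n p)) ∧
    IsKVSolution 𝕜 (a.eval (L := L)) (b.eval (L := L))

end Universal

/-! ### Quadratic Lie algebras -/

/-- An invariant nondegenerate symmetric bilinear form on a Lie algebra; a Lie algebra with such a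
form is called quadratic. -/
structure QuadraticStructure (𝕜 : Type*) (L : Type*) [RCLike 𝕜] [LieRing L] [LieAlgebra 𝕜 L] where
  form : LinearMap.BilinForm 𝕜 L
  symm : form.IsSymm
  nondeg : form.Nondegenerate
  invariant : ∀ x y z : L, form ⁅x, y⁆ z = form x ⁅y, z⁆

section Quadratic

variable {𝕜 : Type*} [RCLike 𝕜] {L : Type*} [NormedLieRing L] [NormedLieAlgebra 𝕜 L]
  [FiniteDimensional 𝕜 L]

/-- The identification `L* × L* = L × L` by the invariant form: the pair of vectors `(u, v)` with
`ℓ(x, y) = (u, x) + (v, y)`. -/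
def QuadraticStructure.sharp (κ : QuadraticStructure 𝕜 L) : Module.Dual 𝕜 (L × L) →ₗ[𝕜] L × L :=
  ((κ.form.toDual κ.nondeg).symm.toLinearMap ∘ₗ (LinearMap.inl 𝕜 L L).dualMap).prod
    ((κ.form.toDual κ.nondeg).symm.toLinearMap ∘ₗ (LinearMap.inr 𝕜 L L).dualMap)

/-- The 2-form `ϖ = (1/2) (g(ad X) dX, dX)` on `L`, that is `ϖ_X(u, v) = (g(ad X) u, v)`. It is the
primitive of the pull-back under `exp` of the Cartan 3-form given by the radial homotopy. -/
def varpi (κ : QuadraticStructure 𝕜 L) (x : L) : LinearMap.BilinForm 𝕜 L :=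
  κ.form.compLeft (opEval (gSeries 𝕜) (adL 𝕜 x)).toLinearMap

/-- The left Maurer-Cartan form in exponential coordinates, `(1 - e ^ (- ad X)) / ad X`. -/
def thetaL (𝕜 : Type*) [RCLike 𝕜] {L : Type*} [NormedLieRing L] [NormedLieAlgebra 𝕜 L]
    [FiniteDimensional 𝕜 L] (x : L) : L →ₗ[𝕜] L :=
  (opEval (expQuot 𝕜) (-adL 𝕜 x)).toLinearMap

/-- The right Maurer-Cartan form in exponential coordinates, `(e ^ (ad X) - 1) / ad X`. -/
def thetaR (𝕜 : Type*) [RCLike 𝕜] {L : Type*} [NormedLieRing L] [NormedLieAlgebra 𝕜 L]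
    [FiniteDimensional 𝕜 L] (x : L) : L →ₗ[𝕜] L :=
  (opEval (expQuot 𝕜) (adL 𝕜 x)).toLinearMap

/-- The closed 2-form `σ = Z^* ϖ - ϖ_X - ϖ_Y + (1/2) (θ^L_X, θ^R_Y)` near `(0, 0)` in `L × L`, where
`Z(X, Y) = log (exp X exp Y)`. It changes the moment map `X + Y` of the linear Poisson structure
of `L × L` into `Z(X, Y)`. -/
def sigma (κ : QuadraticStructure 𝕜 L) (p : L × L) : LinearMap.BilinForm 𝕜 (L × L) :=
  let dZ : L × L →ₗ[𝕜] L := (fderiv 𝕜 (fun q : L × L => bch 𝕜 q.1 q.2) p).toLinearMap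
  let θX : L × L →ₗ[𝕜] L := thetaL 𝕜 p.1 ∘ₗ LinearMap.fst 𝕜 L L
  let θY : L × L →ₗ[𝕜] L := thetaR 𝕜 p.2 ∘ₗ LinearMap.snd 𝕜 L L
  (varpi κ (bch 𝕜 p.1 p.2)).comp dZ dZ
    - (varpi κ p.1).comp (LinearMap.fst 𝕜 L L) (LinearMap.fst 𝕜 L L)
    - (varpi κ p.2).comp (LinearMap.snd 𝕜 L L) (LinearMap.snd 𝕜 L L)
    + (1 / 2 : 𝕜) • (κ.form.comp θX θY - κ.form.comp θY θX)

/-- The map `u ↦ σ_p(u, ·)`, with covectors identified with vectors. -/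
def sigmaMap (κ : QuadraticStructure 𝕜 L) (p : L × L) : Module.End 𝕜 (L × L) :=
  κ.sharp ∘ₗ sigma κ p

/-- The primitive `a_p = ∫₀¹ s σ_{s p}(p, ·) ds` of `σ` given by the radial homotopy, with
covectors identified with vectors. -/
def primitive (κ : QuadraticStructure 𝕜 L) (p : L × L) : L × L :=
  letI : NormedSpace ℝ (L × L) := NormedSpace.restrictScalars ℝ 𝕜 (L × L)
  ∫ s in (0 : ℝ)..1, (s : 𝕜) • sigmaMap κ ((s : 𝕜) • p) p

/-- The operator `(u, v) ↦ ([X, u], [Y, v])`: the linear Poisson structure of `L × L` at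
`p = (X, Y)`. -/
def adPair (𝕜 : Type*) [RCLike 𝕜] {L : Type*} [NormedLieRing L] [NormedLieAlgebra 𝕜 L]
    (p : L × L) : Module.End 𝕜 (L × L) :=
  (LieAlgebra.ad 𝕜 L p.1).prodMap (LieAlgebra.ad 𝕜 L p.2)

/-- The symmetric solution `(A, B)` of Alekseev and Meinrenken on a quadratic Lie algebra, obtained
from the equivariant Moser trick. Let `a` be the radial primitive of `σ`. The rescaled forms
`σ_t(X, Y) = t⁻¹ σ(t X, t Y)` have the primitives `a_t` whose coefficients are those of `a` at
`(t X, t Y)`, and `σ_p(p, ·) - a_p` is the derivative of `a_t` at `t = 1`. The Moser vector field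
at `t = 1` is `([X, A], [Y, B])`, where `(A, B)` is the solution of the linear equation
`(A, B) - σ(([X, A], [Y, B]), ·) = σ_p(p, ·) - a_p`. -/
def solutionAM (κ : QuadraticStructure 𝕜 L) (p : L × L) : L × L :=
  Ring.inverse (1 - sigmaMap κ p * adPair 𝕜 p) (sigmaMap κ p p - primitive κ p)

/-- The symmetric solution `(A, B)` of Vergne on a quadratic Lie algebra. Let `(b, a)` be minus the
radial primitive of `σ` at `(Y, X)`; then `[X, a] + [Y, b] = log (exp Y exp X) - X - Y`, and the
solution is `A = φ₁(- ad X) a`, `B = φ₁(ad Y) b`. -/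
def solutionV (κ : QuadraticStructure 𝕜 L) (p : L × L) : L × L :=
  (opEval (phi 𝕜) (-adL 𝕜 p.1) (-(primitive κ (p.2, p.1)).2),
    opEval (phi 𝕜) (adL 𝕜 p.2) (-(primitive κ (p.2, p.1)).1))

end Quadratic

end KashiwaraVergne

end

/-!
Near an axis everything in sight can be computed with power series in one operator `ad X`, so that
the theorem becomes a comparison of explicit power series.

*Calculus of `f(ad X)`.* If `[Z, X] = 0`, only the factor `(f(t) - f(0)) / t` contributes to the
derivative of `f(ad Z) X` (`Convergent.hasFDerivAt_opEval_apply`). With the closed form of the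
Campbell-Hausdorff series this gives the differential of `Z = log (exp X exp Y)` at `(X, 0)` and
`(0, Y)` (`fderiv_bch_inl`, `fderiv_bch_inr`); its derivatives in the radial directions follow
from Poincaré's differential equation and from the symmetry of second derivatives
(`fderiv_bch_self`, `fderiv_fderiv_bch_inr`).

*Expansion of the solutions.* Invariance of the form means that the adjoint of `f(ad X)` is
`f(- ad X)`. So `σ` at `(X, 0)`, and to first order the vector `σ_p(p, ·)`, are given by power series
in `ad X` (`sigmaC_inl`, `hasFDerivAt_sigmaSelf_inl`). The radial homotopy replaces a series `m(t)` by
`∫₀¹ s m(s t) ds`, which is the inverse of the operator `f ↦ t f' + 2 f` (`eulerTwo_avg`): this is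
where the differential equations of `Π` and `γ_V` come from. The Alekseev-Meinrenken equation at
`(X, 0)` is triangular, and its solution to first order has the coefficients `betaAM`, `gammaAM`
(`hasFDerivAt_solutionAM`); the same computation at `(0, Y)` yields `gammaV`.

*Identities of series.* `β_AM = β_{1/4}` holds because both sides lead to the same solution of the
differential equation of `Π` (`betaAM_eq`). The formula for `γ_AM(-t) + γ_V(t)` is then seen to be
even in `t` (`evalNeg_gammaSum`), which is the equality of the odd parts.

*Non-universality.* A Lie series has the same first-order coefficients on all Lie algebras
(`LieSeries.exists_hasFirstOrder`), and on `sl₂` these coefficients are determined by the function,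
since `ad H` has a nonzero eigenvalue (`HasFirstOrder.unique`). So a universal solution that agrees
with `(A_AM, B_AM)` on `sl₂` has the coefficients `β_AM`, `γ_AM` on the affine Lie algebra
`[x, f] = f` too. There the trace equation, differentiated along the pairs `(X, ε X)`, is nontrivial
and forces `γ = β - β(0) + ψ'(0) - ψ'` (`IsKVSolution.series_eq`). The coefficients of `t⁴` on the
two sides are `-1/4320` and `-1/2880`, a contradiction. That of `γ_V` is `-1/2160`, so `B_AM` and
`B_V` differ on `sl₂`.
-/

noncomputable section

namespace KashiwaraVergne

/-! ### Convergent power series -/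

section Convergent

variable {𝕜 : Type*} [RCLike 𝕜]

/-- Absolute convergence of a power series on the closed disc of radius `r`. -/
def SummableAt (f : 𝕜⟦X⟧) (r : ℝ) : Prop := Summable fun n => ‖PowerSeries.coeff n f‖ * r ^ n

/-- The weighted `ℓ¹` norm `∑ ‖fₙ‖ rⁿ`. -/
def wnorm (f : 𝕜⟦X⟧) (r : ℝ) : ℝ := ∑' n, ‖PowerSeries.coeff n f‖ * r ^ n

/-- A power series with positive radius of convergence. -/
def Convergent (f : 𝕜⟦X⟧) : Prop := ∃ r > 0, SummableAt f r

theorem SummableAt.mono {f : 𝕜⟦X⟧} {r s : ℝ} (h : SummableAt f s) (hr : 0 ≤ r) (hrs : r ≤ s) :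
    SummableAt f r :=
  Summable.of_nonneg_of_le (fun n => by positivity) (fun n => by gcongr) h

theorem SummableAt.of_norm_le {f g : 𝕜⟦X⟧} {r : ℝ} (h : SummableAt g r) (hr : 0 ≤ r)
    (hfg : ∀ n, ‖PowerSeries.coeff n f‖ ≤ ‖PowerSeries.coeff n g‖) : SummableAt f r :=
  Summable.of_nonneg_of_le (fun n => by positivity)
    (fun n => mul_le_mul_of_nonneg_right (hfg n) (by positivity)) h

theorem SummableAt.of_norm_le_one {f : 𝕜⟦X⟧} (hf : ∀ n, ‖PowerSeries.coeff n f‖ ≤ 1) {r : ℝ}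
    (hr : 0 ≤ r) (hr1 : r < 1) : SummableAt f r :=
  Summable.of_nonneg_of_le (fun n => by positivity)
    (fun n => mul_le_of_le_one_left (by positivity) (hf n)) (summable_geometric_of_lt_one hr hr1)

theorem convergent_of_norm_le_one {f : 𝕜⟦X⟧} (hf : ∀ n, ‖PowerSeries.coeff n f‖ ≤ 1) :
    Convergent f :=
  ⟨1 / 2, by norm_num, .of_norm_le_one hf (by norm_num) (by norm_num)⟩

theorem Convergent.of_norm_le {f g : 𝕜⟦X⟧} (h : Convergent g)
    (hfg : ∀ n, ‖PowerSeries.coeff n f‖ ≤ ‖PowerSeries.coeff n g‖) : Convergent f :=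
  let ⟨r, hr, hg⟩ := h
  ⟨r, hr, hg.of_norm_le hr.le hfg⟩

theorem SummableAt.add {f g : 𝕜⟦X⟧} {r : ℝ} (hf : SummableAt f r) (hg : SummableAt g r)
    (hr : 0 ≤ r) : SummableAt (f + g) r := by
  refine Summable.of_nonneg_of_le (fun n => by positivity) (fun n => ?_) (Summable.add hf hg)
  rw [map_add, ← add_mul]
  gcongr
  exact norm_add_le _ _

theorem Convergent.inter {f g : 𝕜⟦X⟧} (hf : Convergent f) (hg : Convergent g) :
    ∃ r > 0, SummableAt f r ∧ SummableAt g r := by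
  obtain ⟨r, hr, hf⟩ := hf
  obtain ⟨s, hs, hg⟩ := hg
  exact ⟨min r s, lt_min hr hs, hf.mono (le_min hr.le hs.le) (min_le_left _ _),
    hg.mono (le_min hr.le hs.le) (min_le_right _ _)⟩

theorem Convergent.add {f g : 𝕜⟦X⟧} (hf : Convergent f) (hg : Convergent g) :
    Convergent (f + g) :=
  let ⟨r, hr, h1, h2⟩ := hf.inter hg
  ⟨r, hr, h1.add h2 hr.le⟩

theorem Convergent.smul {f : 𝕜⟦X⟧} (hf : Convergent f) (c : 𝕜) : Convergent (c • f) := by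
  obtain ⟨r, hr, hf⟩ := hf
  refine ⟨r, hr, (Summable.mul_left ‖c‖ hf).congr fun n => ?_⟩
  rw [PowerSeries.coeff_smul, norm_smul, mul_assoc]

theorem Convergent.neg {f : 𝕜⟦X⟧} (hf : Convergent f) : Convergent (-f) :=
  hf.of_norm_le fun n => by simp

theorem Convergent.sub {f g : 𝕜⟦X⟧} (hf : Convergent f) (hg : Convergent g) :
    Convergent (f - g) := by
  rw [sub_eq_add_neg]
  exact hf.add hg.neg

theorem Convergent.evalNeg {f : 𝕜⟦X⟧} (hf : Convergent f) :
    Convergent (PowerSeries.evalNegHom f) :=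
  hf.of_norm_le fun n => by simp [PowerSeries.evalNegHom, PowerSeries.coeff_rescale]

theorem convergent_X : Convergent (PowerSeries.X : 𝕜⟦X⟧) :=
  convergent_of_norm_le_one fun n => by
    rw [PowerSeries.coeff_X]; split_ifs <;> simp

theorem convergent_one : Convergent (1 : 𝕜⟦X⟧) :=
  convergent_of_norm_le_one fun n => by
    rw [PowerSeries.coeff_one]; split_ifs <;> simp

theorem convergent_C (c : 𝕜) : Convergent (PowerSeries.C c : 𝕜⟦X⟧) := by
  have := (convergent_one (𝕜 := 𝕜)).smul c
  rwa [PowerSeries.smul_eq_C_mul, mul_one] at this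

theorem norm_coeff_mul_mul_pow_le (f g : 𝕜⟦X⟧) {r : ℝ} (hr : 0 ≤ r) (n : ℕ) :
    ‖PowerSeries.coeff n (f * g)‖ * r ^ n ≤ ∑ kl ∈ Finset.HasAntidiagonal.antidiagonal n,
      (‖PowerSeries.coeff kl.1 f‖ * r ^ kl.1) * (‖PowerSeries.coeff kl.2 g‖ * r ^ kl.2) := by
  rw [PowerSeries.coeff_mul]
  refine (mul_le_mul_of_nonneg_right (norm_sum_le _ _) (by positivity)).trans ?_
  rw [Finset.sum_mul]
  refine Finset.sum_le_sum fun kl hkl => le_of_eq ?_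
  rw [← Finset.HasAntidiagonal.mem_antidiagonal.1 hkl, norm_mul, pow_add]
  ring

theorem SummableAt.norm {f : 𝕜⟦X⟧} {r : ℝ} (h : SummableAt f r) :
    Summable fun n => ‖‖PowerSeries.coeff n f‖ * r ^ n‖ :=
  Summable.norm h

theorem SummableAt.mul {f g : 𝕜⟦X⟧} {r : ℝ} (hf : SummableAt f r) (hg : SummableAt g r)
    (hr : 0 ≤ r) : SummableAt (f * g) r :=
  Summable.of_nonneg_of_le (fun n => by positivity) (norm_coeff_mul_mul_pow_le f g hr)
    (summable_norm_sum_mul_antidiagonal_of_summable_norm hf.norm hg.norm).of_norm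

theorem Convergent.mul {f g : 𝕜⟦X⟧} (hf : Convergent f) (hg : Convergent g) :
    Convergent (f * g) :=
  let ⟨r, hr, h1, h2⟩ := hf.inter hg
  ⟨r, hr, h1.mul h2 hr.le⟩

theorem wnorm_nonneg (f : 𝕜⟦X⟧) {r : ℝ} (hr : 0 ≤ r) : 0 ≤ wnorm f r :=
  tsum_nonneg fun n => by positivity

theorem wnorm_mul_le {f g : 𝕜⟦X⟧} {r : ℝ} (hf : SummableAt f r) (hg : SummableAt g r)
    (hr : 0 ≤ r) : wnorm (f * g) r ≤ wnorm f r * wnorm g r := by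
  unfold wnorm
  rw [tsum_mul_tsum_eq_tsum_sum_antidiagonal_of_summable_norm hf.norm hg.norm]
  exact (hf.mul hg hr).tsum_le_tsum (norm_coeff_mul_mul_pow_le f g hr)
    (summable_norm_sum_mul_antidiagonal_of_summable_norm hf.norm hg.norm).of_norm

theorem summableAt_one {r : ℝ} : SummableAt (1 : 𝕜⟦X⟧) r :=
  summable_of_ne_finset_zero (s := {0}) fun n hn => by
    rw [PowerSeries.coeff_one, if_neg (by simpa using hn)]; simp

theorem wnorm_one (r : ℝ) : wnorm (1 : 𝕜⟦X⟧) r = 1 := by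
  unfold wnorm
  rw [tsum_eq_single 0 fun n hn => by rw [PowerSeries.coeff_one, if_neg hn]; simp]
  simp

theorem SummableAt.pow {f : 𝕜⟦X⟧} {r : ℝ} (hf : SummableAt f r) (hr : 0 ≤ r) (n : ℕ) :
    SummableAt (f ^ n) r ∧ wnorm (f ^ n) r ≤ wnorm f r ^ n := by
  induction n with
  | zero => simpa using ⟨summableAt_one, (wnorm_one r).le⟩
  | succ n ih =>
    rw [pow_succ, pow_succ]
    refine ⟨ih.1.mul hf hr, (wnorm_mul_le ih.1 hf hr).trans ?_⟩
    exact mul_le_mul_of_nonneg_right ih.2 (wnorm_nonneg f hr)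

/-- The weighted norm of a series without constant term tends to `0` with the radius. -/
theorem wnorm_mul_le_mul {f : 𝕜⟦X⟧} {r c : ℝ} (hf : SummableAt f r) (hr : 0 ≤ r)
    (h0 : PowerSeries.constantCoeff f = 0) (hc : 0 ≤ c) (hc1 : c ≤ 1) :
    wnorm f (c * r) ≤ c * wnorm f r := by
  unfold wnorm
  rw [← tsum_mul_left]
  refine (hf.mono (by positivity) (mul_le_of_le_one_left hr hc1)).tsum_le_tsum (fun n => ?_)
    (Summable.mul_left c hf)
  rcases n with _ | n
  · simp [h0]
  · have : c ^ (n + 1) ≤ c := pow_le_of_le_one hc hc1 (by simp)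
    rw [mul_pow]
    calc _ = c ^ (n + 1) * (‖PowerSeries.coeff (n + 1) f‖ * r ^ (n + 1)) := by ring
      _ ≤ _ := by gcongr

/-- The series `∑ fₙ tⁿ / (n + k + 1)`, that is `t ↦ ∫₀¹ sᵏ f(s t) ds`. -/
def avg (k : ℕ) (f : 𝕜⟦X⟧) : 𝕜⟦X⟧ :=
  PowerSeries.mk fun n => PowerSeries.coeff n f / ((n : 𝕜) + k + 1)

theorem Convergent.avg {f : 𝕜⟦X⟧} (hf : Convergent f) (k : ℕ) : Convergent (avg k f) :=
  hf.of_norm_le fun n => by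
    have h : ‖((n : 𝕜) + k + 1)‖ = n + k + 1 := by
      have := RCLike.norm_natCast (K := 𝕜) (n + k + 1)
      push_cast at this
      exact this
    rw [KashiwaraVergne.avg, PowerSeries.coeff_mk, norm_div, h]
    exact div_le_self (norm_nonneg _) (by linarith [n.cast_nonneg (α := ℝ), k.cast_nonneg (α := ℝ)])

/-- The series `(f(t) - f(0)) / t`. -/
def shift (f : 𝕜⟦X⟧) : 𝕜⟦X⟧ := PowerSeries.mk fun n => PowerSeries.coeff (n + 1) f

theorem eq_C_add_X_mul_shift (f : 𝕜⟦X⟧) :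
    f = PowerSeries.C (PowerSeries.coeff 0 f) + PowerSeries.X * shift f := by
  ext n
  rcases n with _ | n
  · simp
  · simp [shift, PowerSeries.coeff_succ_X_mul]

theorem X_mul_shift (f : 𝕜⟦X⟧) (h : PowerSeries.coeff 0 f = 0) :
    PowerSeries.X * shift f = f := by
  conv_rhs => rw [eq_C_add_X_mul_shift f, h]
  simp

theorem Convergent.shift {f : 𝕜⟦X⟧} (hf : Convergent f) : Convergent (shift f) := by
  obtain ⟨r, hr, hf⟩ := hf
  refine ⟨r, hr, ?_⟩
  refine (Summable.mul_left r⁻¹ ((summable_nat_add_iff 1).2 hf)).congr fun n => ?_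
  rw [KashiwaraVergne.shift, PowerSeries.coeff_mk, pow_succ]
  field_simp

theorem Convergent.derivative {f : 𝕜⟦X⟧} (hf : Convergent f) :
    Convergent (PowerSeries.derivative 𝕜 f) := by
  obtain ⟨r, hr, hf⟩ := hf.shift
  refine ⟨r / 2, by positivity, Summable.of_nonneg_of_le (fun n => by positivity) (fun n => ?_) hf⟩
  have h : ‖((n : 𝕜) + 1)‖ = n + 1 := by
    have := RCLike.norm_natCast (K := 𝕜) (n + 1)
    push_cast at this
    exact this
  have h2 : ((n : ℝ) + 1) ≤ 2 ^ n := by exact_mod_cast Nat.lt_two_pow_self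
  rw [PowerSeries.coeff_derivative, norm_mul, h, KashiwaraVergne.shift, PowerSeries.coeff_mk,
    div_pow, mul_assoc]
  gcongr
  rw [mul_div_assoc', div_le_iff₀ (by positivity), mul_comm]
  gcongr

end Convergent

/-! ### Power series in an operator -/

section OpEval

variable {𝕜 : Type*} [RCLike 𝕜] {L : Type*} [NormedLieRing L] [NormedLieAlgebra 𝕜 L]

instance completeSpace_end [FiniteDimensional 𝕜 L] : CompleteSpace (L →L[𝕜] L) :=
  haveI := FiniteDimensional.complete 𝕜 L
  inferInstance

theorem norm_pow_le_pow (T : L →L[𝕜] L) (n : ℕ) : ‖T ^ n‖ ≤ ‖T‖ ^ n := by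
  induction n with
  | zero => rw [pow_zero, pow_zero]; exact ContinuousLinearMap.norm_id_le
  | succ n ih =>
    rw [pow_succ, pow_succ]
    exact (norm_mul_le _ _).trans (by gcongr)

theorem norm_coeff_smul_pow_le (f : 𝕜⟦X⟧) {T : L →L[𝕜] L} {r : ℝ} (hT : ‖T‖ ≤ r) (n : ℕ) :
    ‖PowerSeries.coeff n f • T ^ n‖ ≤ ‖PowerSeries.coeff n f‖ * r ^ n := by
  rw [norm_smul]
  gcongr
  exact (norm_pow_le_pow T n).trans (by gcongr)

theorem summable_norm_opEval {f : 𝕜⟦X⟧} {r : ℝ} (hf : SummableAt f r) {T : L →L[𝕜] L}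
    (hT : ‖T‖ ≤ r) : Summable fun n => ‖PowerSeries.coeff n f • T ^ n‖ :=
  Summable.of_nonneg_of_le (fun _ => norm_nonneg _) (norm_coeff_smul_pow_le f hT) hf

theorem eventually_norm_le {r : ℝ} (hr : 0 < r) : ∀ᶠ T : L →L[𝕜] L in 𝓝 0, ‖T‖ ≤ r := by
  filter_upwards [Metric.closedBall_mem_nhds (0 : L →L[𝕜] L) hr] with T hT
  simpa using hT

theorem opEval_C (c : 𝕜) (T : L →L[𝕜] L) : opEval (PowerSeries.C c) T = c • 1 := by
  unfold opEval
  rw [tsum_eq_single 0 fun n hn => by rw [PowerSeries.coeff_C, if_neg hn, zero_smul]]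
  simp

theorem opEval_one (T : L →L[𝕜] L) : opEval (1 : 𝕜⟦X⟧) T = 1 := by
  simpa using opEval_C (1 : 𝕜) T

theorem opEval_X (T : L →L[𝕜] L) : opEval (PowerSeries.X : 𝕜⟦X⟧) T = T := by
  unfold opEval
  rw [tsum_eq_single 1 fun n hn => by rw [PowerSeries.coeff_X, if_neg hn, zero_smul]]
  simp

theorem opEval_smul (c : 𝕜) (f : 𝕜⟦X⟧) (T : L →L[𝕜] L) : opEval (c • f) T = c • opEval f T := by
  unfold opEval
  rw [← tsum_const_smul'']
  simp [mul_smul]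

theorem opEval_evalNeg (f : 𝕜⟦X⟧) (T : L →L[𝕜] L) :
    opEval (PowerSeries.evalNegHom f) T = opEval f (-T) := by
  unfold opEval
  refine tsum_congr fun n => ?_
  rw [PowerSeries.evalNegHom, PowerSeries.coeff_rescale, neg_pow T, mul_smul, smul_comm]
  rcases n.even_or_odd with h | h <;> simp [h.neg_one_pow]

theorem opEval_zero_right (f : 𝕜⟦X⟧) : opEval f (0 : L →L[𝕜] L) = PowerSeries.coeff 0 f • 1 := by
  unfold opEval
  rw [tsum_eq_single 0 fun n hn => by rw [zero_pow hn, smul_zero]]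
  simp

theorem exp_eq_opEval (T : L →L[𝕜] L) :
    NormedSpace.exp T = opEval (PowerSeries.exp 𝕜) T := by
  rw [NormedSpace.exp_eq_tsum 𝕜]
  refine tsum_congr fun n => ?_
  simp [PowerSeries.coeff_exp]

variable [FiniteDimensional 𝕜 L]

theorem hasSum_opEval {f : 𝕜⟦X⟧} {r : ℝ} (hf : SummableAt f r) {T : L →L[𝕜] L}
    (hT : ‖T‖ ≤ r) : HasSum (fun n => PowerSeries.coeff n f • T ^ n) (opEval f T) :=
  (summable_norm_opEval hf hT).of_norm.hasSum

theorem Convergent.hasSum {f : 𝕜⟦X⟧} (hf : Convergent f) : ∀ᶠ T : L →L[𝕜] L in 𝓝 0,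
    HasSum (fun n => PowerSeries.coeff n f • T ^ n) (opEval f T) := by
  obtain ⟨r, hr, hf⟩ := hf
  filter_upwards [eventually_norm_le hr] with T hT using hasSum_opEval hf hT

theorem Convergent.opEval_add {f g : 𝕜⟦X⟧} (hf : Convergent f) (hg : Convergent g) :
    ∀ᶠ T : L →L[𝕜] L in 𝓝 0, opEval (f + g) T = opEval f T + opEval g T := by
  filter_upwards [hf.hasSum (L := L), hg.hasSum (L := L)] with T h1 h2
  exact ((h1.add h2).congr_fun fun n => by simp [add_smul]).tsum_eq

theorem Convergent.opEval_sub {f g : 𝕜⟦X⟧} (hf : Convergent f) (hg : Convergent g) :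
    ∀ᶠ T : L →L[𝕜] L in 𝓝 0, opEval (f - g) T = opEval f T - opEval g T := by
  filter_upwards [hf.hasSum (L := L), hg.hasSum (L := L)] with T h1 h2
  exact ((h1.sub h2).congr_fun fun n => by simp [sub_smul]).tsum_eq

theorem opEval_mul {f g : 𝕜⟦X⟧} {r : ℝ} (hf : SummableAt f r) (hg : SummableAt g r)
    {T : L →L[𝕜] L} (hT : ‖T‖ ≤ r) : opEval (f * g) T = opEval f T * opEval g T := by
  unfold opEval
  rw [tsum_mul_tsum_eq_tsum_sum_antidiagonal_of_summable_norm (summable_norm_opEval hf hT)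
    (summable_norm_opEval hg hT)]
  refine tsum_congr fun n => ?_
  rw [PowerSeries.coeff_mul, Finset.sum_smul]
  refine Finset.sum_congr rfl fun kl hkl => ?_
  rw [smul_mul_smul_comm, ← pow_add, Finset.HasAntidiagonal.mem_antidiagonal.1 hkl]

theorem Convergent.opEval_mul {f g : 𝕜⟦X⟧} (hf : Convergent f) (hg : Convergent g) :
    ∀ᶠ T : L →L[𝕜] L in 𝓝 0, opEval (f * g) T = opEval f T * opEval g T := by
  obtain ⟨r, hr, h1, h2⟩ := hf.inter hg
  filter_upwards [eventually_norm_le hr] with T hT using KashiwaraVergne.opEval_mul h1 h2 hT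

theorem opEval_pow {f : 𝕜⟦X⟧} {r : ℝ} (hf : SummableAt f r)
    {T : L →L[𝕜] L} (hT : ‖T‖ ≤ r) (n : ℕ) : opEval (f ^ n) T = opEval f T ^ n := by
  have hr : 0 ≤ r := (norm_nonneg _).trans hT
  induction n with
  | zero => simpa using opEval_one T
  | succ n ih => rw [pow_succ, pow_succ, opEval_mul (hf.pow hr n).1 hf hT, ih]

/-- The first two terms of the Taylor expansion of `f(T)`. -/
theorem Convergent.opEval_eq_shift (f : 𝕜⟦X⟧) (hf : Convergent f) :
    ∀ᶠ T : L →L[𝕜] L in 𝓝 0,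
      opEval f T = PowerSeries.coeff 0 f • 1 + opEval (KashiwaraVergne.shift f) T * T := by
  filter_upwards [(convergent_C (PowerSeries.coeff 0 f)).opEval_add
    (hf.shift.mul convergent_X) (L := L), hf.shift.opEval_mul convergent_X (L := L)] with T h1 h2
  conv_lhs => rw [eq_C_add_X_mul_shift f, mul_comm PowerSeries.X, h1, h2, opEval_C, opEval_X]

theorem Convergent.analyticAt {f : 𝕜⟦X⟧} (hf : Convergent f) :
    ∀ᶠ T : L →L[𝕜] L in 𝓝 0, AnalyticAt 𝕜 (opEval f) T := by
  obtain ⟨r, hr, hf⟩ := hf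
  let p := FormalMultilinearSeries.ofScalars (L →L[𝕜] L) (fun n => PowerSeries.coeff n f)
  have hrad : ENNReal.ofReal r ≤ p.radius := by
    refine p.le_radius_of_summable (r := r.toNNReal) ?_
    refine (summable_nat_add_iff 1).1 (Summable.of_nonneg_of_le (fun n => by positivity)
      (fun n => ?_) ((summable_nat_add_iff 1).2 hf))
    rw [Real.coe_toNNReal _ hr.le]
    gcongr
    exact FormalMultilinearSeries.ofScalars_norm_le _ _ _ (by simp)
  have h0 : 0 < p.radius := lt_of_lt_of_le (by simpa using hr) hrad
  have hp := p.hasFPowerSeriesOnBall h0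
  have : p.sum = opEval f := by
    ext1 T
    exact FormalMultilinearSeries.ofScalars_sum_eq _ _
  rw [this] at hp
  exact hp.analyticAt.eventually_analyticAt

theorem hasSum_coeff_subst (f : 𝕜⟦X⟧) {g : 𝕜⟦X⟧} (hg : PowerSeries.HasSubst g) (m : ℕ) :
    HasSum (fun n => PowerSeries.coeff n f * PowerSeries.coeff m (g ^ n))
      (PowerSeries.coeff m (f.subst g)) := by
  rw [PowerSeries.coeff_subst' hg]
  have := PowerSeries.coeff_subst_finite hg f (Finsupp.single () m)
  simp_rw [← PowerSeries.coeff_def (s := Finsupp.single () m) (n := m) (by simp)] at this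
  rw [finsum_eq_sum _ this]
  refine hasSum_sum_of_ne_finset_zero fun n hn => ?_
  simpa [or_iff_not_imp_left] using hn

/-- Absolute convergence of the double series `∑ fₙ [tᵐ](gⁿ) rᵐ` for the composition `f(g(t))`. -/
theorem Convergent.exists_summable_subst {f g : 𝕜⟦X⟧} (hf : Convergent f) (hg : Convergent g)
    (h0 : PowerSeries.constantCoeff g = 0) : ∃ r > 0, SummableAt g r ∧
      Summable fun nm : ℕ × ℕ => ‖PowerSeries.coeff nm.1 f‖ *
        (‖PowerSeries.coeff nm.2 (g ^ nm.1)‖ * r ^ nm.2) := by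
  obtain ⟨ρ, hρ, hf⟩ := hf
  obtain ⟨r, hr, hg, hgr⟩ : ∃ r > 0, SummableAt g r ∧ wnorm g r ≤ ρ := by
    obtain ⟨r, hr, hg⟩ := hg
    have hw := wnorm_nonneg g hr.le
    set c := min 1 (ρ / (wnorm g r + 1))
    have hc : 0 < c := lt_min one_pos (by positivity)
    refine ⟨c * r, by positivity, hg.mono (by positivity)
      (mul_le_of_le_one_left hr.le (min_le_left _ _)),
      (wnorm_mul_le_mul hg hr.le h0 hc.le (min_le_left _ _)).trans ?_⟩
    calc c * wnorm g r ≤ ρ / (wnorm g r + 1) * (wnorm g r + 1) := by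
          gcongr
          · exact min_le_right _ _
          · linarith
      _ = ρ := by field_simp
  refine ⟨r, hr, hg, ?_⟩
  have hrow (n : ℕ) : Summable fun m => ‖PowerSeries.coeff m (g ^ n)‖ * r ^ m :=
    (hg.pow hr.le n).1
  refine (summable_prod_of_nonneg fun nm => mul_nonneg (norm_nonneg _)
    (mul_nonneg (norm_nonneg _) (pow_nonneg hr.le _))).2
    ⟨fun n => (hrow n).mul_left ‖PowerSeries.coeff n f‖, ?_⟩
  simp only [tsum_mul_left]
  refine Summable.of_nonneg_of_le
    (fun n => mul_nonneg (norm_nonneg _) (wnorm_nonneg _ hr.le)) (fun n => ?_) hf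
  refine mul_le_mul_of_nonneg_left ((hg.pow hr.le n).2.trans ?_) (norm_nonneg _)
  exact pow_le_pow_left₀ (wnorm_nonneg g hr.le) hgr n

theorem Convergent.subst {f g : 𝕜⟦X⟧} (hf : Convergent f) (hg : Convergent g)
    (h0 : PowerSeries.constantCoeff g = 0) : Convergent (f.subst g) := by
  obtain ⟨r, hr, hg, hdouble⟩ := hf.exists_summable_subst hg h0
  have hs := PowerSeries.HasSubst.of_constantCoeff_zero' h0
  refine ⟨r, hr, ?_⟩
  have h2 := ((Equiv.prodComm ℕ ℕ).summable_iff.2 hdouble).prod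
  refine Summable.of_nonneg_of_le (fun n => by positivity) (fun m => ?_) h2
  have h3 : Summable fun n => ‖PowerSeries.coeff n f * PowerSeries.coeff m (g ^ n)‖ := by
    refine ((((Equiv.prodComm ℕ ℕ).summable_iff.2 hdouble).prod_factor m).mul_left
      (r ^ m)⁻¹).congr fun n => ?_
    simp only [Function.comp_apply, Equiv.prodComm_apply, Prod.swap_prod_mk, norm_mul]
    field_simp
  rw [← (hasSum_coeff_subst f hs m).tsum_eq]
  refine (mul_le_mul_of_nonneg_right (norm_tsum_le_tsum_norm h3) (by positivity)).trans ?_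
  rw [← tsum_mul_right]
  refine le_of_eq (tsum_congr fun n => ?_)
  simp only [Function.comp_apply, Equiv.prodComm_apply, Prod.swap_prod_mk, norm_mul]
  ring

/-- The value of a composite series at an operator. -/
theorem Convergent.opEval_subst {f g : 𝕜⟦X⟧} (hf : Convergent f) (hg : Convergent g)
    (h0 : PowerSeries.constantCoeff g = 0) : ∀ᶠ T : L →L[𝕜] L in 𝓝 0,
      opEval (f.subst g) T = opEval f (opEval g T) := by
  obtain ⟨r, hr, hg, hdouble⟩ := hf.exists_summable_subst hg h0
  have hs := PowerSeries.HasSubst.of_constantCoeff_zero' h0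
  filter_upwards [eventually_norm_le hr] with T hT
  have hF : Summable fun nm : ℕ × ℕ =>
      (PowerSeries.coeff nm.1 f * PowerSeries.coeff nm.2 (g ^ nm.1)) • T ^ nm.2 := by
    refine Summable.of_norm_bounded hdouble fun nm => ?_
    rw [mul_smul, norm_smul]
    gcongr
    exact norm_coeff_smul_pow_le _ hT _
  have h1 : ∀ n, HasSum (fun m => (PowerSeries.coeff n f * PowerSeries.coeff m (g ^ n)) • T ^ m)
      (PowerSeries.coeff n f • opEval g T ^ n) := fun n => by
    rw [← opEval_pow hg hT]
    exact ((hasSum_opEval (hg.pow hr.le n).1 hT).const_smul (PowerSeries.coeff n f)).congr_fun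
      fun m => mul_smul _ _ _
  have h2 : ∀ m, HasSum (fun n => (PowerSeries.coeff n f * PowerSeries.coeff m (g ^ n)) • T ^ m)
      (PowerSeries.coeff m (f.subst g) • T ^ m) := fun m =>
    (hasSum_coeff_subst f hs m).smul_const (T ^ m)
  have e1 : ∑' nm : ℕ × ℕ, (PowerSeries.coeff nm.1 f * PowerSeries.coeff nm.2 (g ^ nm.1)) •
      T ^ nm.2 = opEval f (opEval g T) :=
    (hF.hasSum.prod_fiberwise h1).tsum_eq.symm
  rw [← e1]
  have hF' := (Equiv.prodComm ℕ ℕ).hasSum_iff.2 hF.hasSum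
  exact (hF'.prod_fiberwise h2).tsum_eq

end OpEval

/-! ### Identities between the special series -/

section Formal

variable (𝕜 : Type*) [RCLike 𝕜]

open PowerSeries in
/-- The series `φ₁(-t)`. -/
abbrev phiNeg : 𝕜⟦X⟧ := evalNegHom (phi 𝕜)

theorem phi_mul_exp_sub_one : phi 𝕜 * (PowerSeries.exp 𝕜 - 1) = PowerSeries.X :=
  bernoulliPowerSeries_mul_exp_sub_one 𝕜

theorem exp_sub_one_ne_zero : PowerSeries.exp 𝕜 - 1 ≠ 0 := by
  intro h
  have := phi_mul_exp_sub_one 𝕜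
  rw [h, mul_zero] at this
  exact PowerSeries.X_ne_zero this.symm

theorem X_mul_expQuot : PowerSeries.X * expQuot 𝕜 = PowerSeries.exp 𝕜 - 1 := by
  have h := X_mul_shift (PowerSeries.exp 𝕜 - 1) (by simp)
  rw [← h]
  congr 1
  ext n
  simp [expQuot, shift, PowerSeries.coeff_one]

theorem phi_mul_expQuot : phi 𝕜 * expQuot 𝕜 = 1 := by
  apply mul_left_cancel₀ (PowerSeries.X_ne_zero (R := 𝕜))
  rw [mul_left_comm, X_mul_expQuot, phi_mul_exp_sub_one, mul_one]

theorem coeff_zero_phi : PowerSeries.coeff 0 (phi 𝕜) = 1 := by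
  simp [phi, bernoulliPowerSeries]

theorem coeff_one_phi : PowerSeries.coeff 1 (phi 𝕜) = -1 / 2 := by
  simp [phi, bernoulliPowerSeries]

theorem inv_phi : (phi 𝕜)⁻¹ = expQuot 𝕜 := by
  rw [PowerSeries.inv_eq_iff_mul_eq_one (by
    rw [← PowerSeries.coeff_zero_eq_constantCoeff_apply, coeff_zero_phi]; exact one_ne_zero),
    mul_comm, phi_mul_expQuot]

theorem exp_mul_expNeg : PowerSeries.exp 𝕜 * PowerSeries.evalNegHom (PowerSeries.exp 𝕜) = 1 :=
  PowerSeries.exp_mul_exp_neg_eq_one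

theorem phiNeg_eq : phiNeg 𝕜 = phi 𝕜 * PowerSeries.exp 𝕜 := by
  have h := congrArg PowerSeries.evalNegHom (phi_mul_exp_sub_one 𝕜)
  rw [map_mul, map_sub, map_one, PowerSeries.evalNegHom_X] at h
  apply mul_right_cancel₀ (exp_sub_one_ne_zero 𝕜)
  linear_combination (-PowerSeries.exp 𝕜) * h + (-phiNeg 𝕜) * exp_mul_expNeg 𝕜 * (-1)
    - PowerSeries.exp 𝕜 * phi_mul_exp_sub_one 𝕜

theorem derivative_phi :
    PowerSeries.derivative 𝕜 (phi 𝕜) * (PowerSeries.exp 𝕜 - 1) + phi 𝕜 * PowerSeries.exp 𝕜 = 1 := by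
  have h := congrArg (PowerSeries.derivative 𝕜) (phi_mul_exp_sub_one 𝕜)
  rw [Derivation.leibniz, map_sub, PowerSeries.derivative_exp, PowerSeries.derivative_X,
    PowerSeries.derivative_one] at h
  simp only [smul_eq_mul] at h
  linear_combination h

/-- The differential equation of the Bernoulli generating series. -/
theorem X_mul_derivative_phi :
    PowerSeries.X * PowerSeries.derivative 𝕜 (phi 𝕜) = phi 𝕜 - phi 𝕜 * phiNeg 𝕜 := by
  apply mul_right_cancel₀ (exp_sub_one_ne_zero 𝕜)
  rw [phiNeg_eq]
  linear_combination PowerSeries.X * derivative_phi 𝕜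
    - (1 - phi 𝕜 * PowerSeries.exp 𝕜) * phi_mul_exp_sub_one 𝕜

theorem evalNeg_evalNeg (f : 𝕜⟦X⟧) :
    PowerSeries.evalNegHom (PowerSeries.evalNegHom f) = f := by
  ext n
  simp [PowerSeries.evalNegHom, PowerSeries.coeff_rescale, ← mul_assoc, ← mul_pow]

theorem coeff_evalNeg (f : 𝕜⟦X⟧) (n : ℕ) : PowerSeries.coeff n (PowerSeries.evalNegHom f) =
    (-1) ^ n * PowerSeries.coeff n f := by
  simp [PowerSeries.evalNegHom, PowerSeries.coeff_rescale]

theorem constantCoeff_evalNeg (f : 𝕜⟦X⟧) :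
    PowerSeries.constantCoeff (PowerSeries.evalNegHom f) = PowerSeries.constantCoeff f := by
  simpa using coeff_evalNeg 𝕜 f 0

theorem X_mul_evalNeg_derivative_phi :
    PowerSeries.X * PowerSeries.evalNegHom (PowerSeries.derivative 𝕜 (phi 𝕜)) =
      phiNeg 𝕜 * (phi 𝕜 - 1) := by
  have h := congrArg PowerSeries.evalNegHom (X_mul_derivative_phi 𝕜)
  simp only [map_mul, map_sub, PowerSeries.evalNegHom_X, evalNeg_evalNeg] at h
  linear_combination -h

theorem X_mul_avg_evalNeg_derivative_phi :
    PowerSeries.X * avg 0 (PowerSeries.evalNegHom (PowerSeries.derivative 𝕜 (phi 𝕜))) =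
      1 - phiNeg 𝕜 := by
  ext n
  rcases n with _ | n
  · have := coeff_zero_phi 𝕜
    rw [PowerSeries.coeff_zero_eq_constantCoeff_apply] at this
    simp [constantCoeff_evalNeg, this]
  · have : (n : 𝕜) + 1 ≠ 0 := by exact_mod_cast n.succ_ne_zero
    simp only [PowerSeries.coeff_succ_X_mul, avg, PowerSeries.coeff_mk, coeff_evalNeg,
      PowerSeries.coeff_derivative, map_sub, PowerSeries.coeff_one]
    simp
    field_simp
    ring

theorem X_sq_mul_rSeries : PowerSeries.X ^ 2 * rSeries 𝕜 = PowerSeries.exp 𝕜 -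
    PowerSeries.evalNegHom (PowerSeries.exp 𝕜) - 2 * PowerSeries.X := by
  set f := PowerSeries.exp 𝕜 - PowerSeries.evalNegHom (PowerSeries.exp 𝕜) - 2 * PowerSeries.X
    with hf
  have h0 : PowerSeries.coeff 0 f = 0 := by simp [hf, constantCoeff_evalNeg]
  have h1 : PowerSeries.coeff 1 f = 0 := by
    rw [hf, ← map_ofNat (PowerSeries.C (R := 𝕜)) 2, map_sub, map_sub, PowerSeries.coeff_C_mul,
      PowerSeries.coeff_one_X, coeff_evalNeg, PowerSeries.coeff_exp]
    norm_num
  conv_rhs => rw [← X_mul_shift f h0, ← X_mul_shift (shift f) (by simpa [shift] using h1)]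
  rw [pow_two, mul_assoc]
  congr 2
  ext n
  simp [rSeries, shift, hf]

theorem two_smul_gSeries : rSeries 𝕜 = 2 * gSeries 𝕜 := by
  rw [gSeries, ← map_ofNat (PowerSeries.C (R := 𝕜)) 2, ← PowerSeries.smul_eq_C_mul, smul_smul]
  norm_num

theorem X_sq_mul_gSeries : 2 * (PowerSeries.X ^ 2 * gSeries 𝕜) = PowerSeries.exp 𝕜 -
    PowerSeries.evalNegHom (PowerSeries.exp 𝕜) - 2 * PowerSeries.X := by
  rw [← X_sq_mul_rSeries, two_smul_gSeries]
  ring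

theorem evalNeg_gSeries : PowerSeries.evalNegHom (gSeries 𝕜) = -gSeries 𝕜 := by
  have h := congrArg PowerSeries.evalNegHom (X_sq_mul_gSeries 𝕜)
  simp only [map_mul, map_sub, map_pow, map_ofNat, PowerSeries.evalNegHom_X, evalNeg_evalNeg] at h
  have hX : (2 : 𝕜⟦X⟧) * PowerSeries.X ^ 2 ≠ 0 :=
    mul_ne_zero (by
      rw [← map_ofNat (PowerSeries.C (R := 𝕜)) 2]
      exact (map_ne_zero_iff _ PowerSeries.C_injective).2 two_ne_zero) (pow_ne_zero 2 PowerSeries.X_ne_zero)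
  apply mul_left_cancel₀ hX
  linear_combination h + X_sq_mul_gSeries 𝕜

theorem coeff_zero_gSeries : PowerSeries.coeff 0 (gSeries 𝕜) = 0 := by
  have h := congrArg (PowerSeries.coeff 0) (evalNeg_gSeries 𝕜)
  rw [coeff_evalNeg, map_neg, pow_zero, one_mul] at h
  exact self_eq_neg.1 h

/-- `log (1 + w) / w` at `w = e ^ t - 1` is `t / (e ^ t - 1)`. -/
theorem logQuot_subst : (logQuot 𝕜).subst (PowerSeries.exp 𝕜 - 1) = phi 𝕜 := by
  have hs : PowerSeries.HasSubst (PowerSeries.exp 𝕜 - 1) := PowerSeries.HasSubst.exp_sub_one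
  have hsX : (PowerSeries.X : 𝕜⟦X⟧).subst (PowerSeries.exp 𝕜 - 1) = PowerSeries.exp 𝕜 - 1 :=
    PowerSeries.subst_X hs
  -- `log (e ^ t) = t`, by comparing derivatives
  have hlog : (PowerSeries.X * logQuot 𝕜).subst (PowerSeries.exp 𝕜 - 1) = PowerSeries.X := by
    have hD : (1 + PowerSeries.X) * PowerSeries.derivative 𝕜 (PowerSeries.X * logQuot 𝕜) = 1 := by
      have : PowerSeries.derivative 𝕜 (PowerSeries.X * logQuot 𝕜) =
          PowerSeries.mk fun n => (-1) ^ n := by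
        ext n
        have : (n : 𝕜) + 1 ≠ 0 := by exact_mod_cast n.succ_ne_zero
        rw [PowerSeries.coeff_derivative, PowerSeries.coeff_succ_X_mul, logQuot,
          PowerSeries.coeff_mk, PowerSeries.coeff_mk]
        field_simp
      rw [this]
      ext n
      rcases n with _ | n
      · simp [add_mul]
      · simp [add_mul, PowerSeries.coeff_succ_X_mul, PowerSeries.coeff_one, pow_succ]
    apply PowerSeries.derivative.ext
    · rw [PowerSeries.derivative_subst hs, PowerSeries.derivative_X, map_sub,
        PowerSeries.derivative_exp, PowerSeries.derivative_one, sub_zero]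
      have h := congrArg (PowerSeries.subst (PowerSeries.exp 𝕜 - 1)) hD
      rw [PowerSeries.subst_mul hs, PowerSeries.subst_add hs, hsX] at h
      have h1 : (1 : 𝕜⟦X⟧).subst (PowerSeries.exp 𝕜 - 1) = (1 : 𝕜⟦X⟧) := by
        rw [← PowerSeries.coe_substAlgHom hs, map_one]
      rw [h1] at h
      linear_combination h
    · rw [PowerSeries.subst_mul hs, hsX]
      simp
  rw [PowerSeries.subst_mul hs, hsX] at hlog
  apply mul_left_cancel₀ (exp_sub_one_ne_zero 𝕜)
  rw [hlog, mul_comm, phi_mul_exp_sub_one]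

/-! #### Convergence -/

theorem convergent_exp : Convergent (PowerSeries.exp 𝕜) :=
  convergent_of_norm_le_one fun n => by
    rw [PowerSeries.coeff_exp]
    simp only [one_div, map_inv₀, map_natCast, norm_inv, RCLike.norm_natCast]
    exact inv_le_one_of_one_le₀ (by exact_mod_cast n.factorial_pos)

theorem convergent_expQuot : Convergent (expQuot 𝕜) := (convergent_exp 𝕜).shift

theorem convergent_logQuot : Convergent (logQuot 𝕜) :=
  convergent_of_norm_le_one fun n => by
    rw [logQuot, PowerSeries.coeff_mk, norm_div, norm_pow, norm_neg, norm_one, one_pow]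
    have : ‖((n : 𝕜) + 1)‖ = n + 1 := by
      have := RCLike.norm_natCast (K := 𝕜) (n + 1)
      push_cast at this
      exact this
    rw [this, div_le_one (by positivity)]
    linarith [n.cast_nonneg (α := ℝ)]

theorem convergent_phi : Convergent (phi 𝕜) := by
  rw [← logQuot_subst]
  exact (convergent_logQuot 𝕜).subst ((convergent_exp 𝕜).sub convergent_one) (by simp)

theorem convergent_gSeries : Convergent (gSeries 𝕜) := by
  have : Convergent (PowerSeries.exp 𝕜 - PowerSeries.evalNegHom (PowerSeries.exp 𝕜)
      - 2 * PowerSeries.X) :=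
    ((convergent_exp 𝕜).sub (convergent_exp 𝕜).evalNeg).sub (by
      rw [← map_ofNat (PowerSeries.C (R := 𝕜)) 2]
      exact (convergent_C 2).mul convergent_X)
  refine (Convergent.smul ?_ _)
  have h : rSeries 𝕜 = shift (shift (PowerSeries.exp 𝕜 -
      PowerSeries.evalNegHom (PowerSeries.exp 𝕜) - 2 * PowerSeries.X)) := by
    ext n
    simp [rSeries, shift]
  rw [h]
  exact this.shift.shift

theorem convergent_psi : Convergent (psi 𝕜) :=
  (((convergent_phi 𝕜).sub convergent_one).smul _).neg

/-! #### The operator `t f' + 2 f` -/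

theorem eulerTwo_avg (f : 𝕜⟦X⟧) : eulerTwo (avg 1 f) = f := by
  ext n
  have : (n : 𝕜) + 1 + 1 ≠ 0 := by exact_mod_cast (n + 1).succ_ne_zero
  rw [eulerTwo, map_add, ← map_ofNat (PowerSeries.C (R := 𝕜)) 2, PowerSeries.coeff_C_mul]
  rcases n with _ | n
  · simp [avg]
    norm_num
    field_simp
  · simp only [PowerSeries.coeff_succ_X_mul, PowerSeries.coeff_derivative, avg,
      PowerSeries.coeff_mk]
    push_cast at this ⊢
    field_simp
    ring

theorem avg_eulerTwo (f : 𝕜⟦X⟧) : avg 1 (eulerTwo f) = f := by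
  ext n
  have : (n : 𝕜) + 1 + 1 ≠ 0 := by exact_mod_cast (n + 1).succ_ne_zero
  rw [avg, PowerSeries.coeff_mk, eulerTwo, map_add, ← map_ofNat (PowerSeries.C (R := 𝕜)) 2,
    PowerSeries.coeff_C_mul]
  rcases n with _ | n
  · simp
    norm_num
  · simp only [PowerSeries.coeff_succ_X_mul, PowerSeries.coeff_derivative]
    push_cast at this ⊢
    field_simp
    ring

end Formal

/-! ### The series of the first order expansions -/

section FirstOrderSeries

variable (𝕜 : Type*) [RCLike 𝕜]

local notation "φ" => phi 𝕜
local notation "φ'" => PowerSeries.derivative 𝕜 (phi 𝕜)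
local notation "ψ" => phiNeg 𝕜
local notation "g" => gSeries 𝕜
local notation "t" => (PowerSeries.X : PowerSeries 𝕜)

/-- The derivative in `Y` of the first component of `σ_p(p, ·)` at `(X, 0)`. -/
def mFst : 𝕜⟦X⟧ := g * ψ * (1 - φ) - (1 / 2 : 𝕜) • expQuot 𝕜

/-- The derivative in `Y` of the second component of `σ_p(p, ·)` at `(X, 0)`. -/
def mSnd : 𝕜⟦X⟧ := g * φ * ψ * (1 - φ) + (1 / 4 : 𝕜) • t

/-- The derivative in `X` of the first component of `σ_p(p, ·)` at `(0, Y)`. -/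
def mV : 𝕜⟦X⟧ := (1 / 4 : 𝕜) • t + ψ * g * (t * φ')

/-- The series `γ` of Vergne's solution. -/
def gammaV : 𝕜⟦X⟧ := (1 / 8 : 𝕜) • t - avg 1 (mV 𝕜)

/-- The series `β` of the Alekseev-Meinrenken solution. -/
def betaAM : 𝕜⟦X⟧ := mFst 𝕜 - avg 1 (mFst 𝕜) -
  (1 / 4 : 𝕜) • ((g * ψ - (1 / 2 : 𝕜) • expQuot 𝕜) * t)

/-- The series `γ` of the Alekseev-Meinrenken solution. -/
def gammaAM : 𝕜⟦X⟧ := mSnd 𝕜 - avg 1 (mSnd 𝕜) +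
  (φ * g + (1 / 2 : 𝕜) • PowerSeries.evalNegHom (expQuot 𝕜)) * (t * betaAM 𝕜) -
    (1 / 4 : 𝕜) • (g * φ * ψ * t)

theorem convergent_mFst : Convergent (mFst 𝕜) :=
  (((convergent_gSeries 𝕜).mul (convergent_phi 𝕜).evalNeg).mul
    (convergent_one.sub (convergent_phi 𝕜))).sub ((convergent_expQuot 𝕜).smul _)

theorem convergent_mSnd : Convergent (mSnd 𝕜) :=
  ((((convergent_gSeries 𝕜).mul (convergent_phi 𝕜)).mul (convergent_phi 𝕜).evalNeg).mul
    (convergent_one.sub (convergent_phi 𝕜))).add (convergent_X.smul _)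

theorem convergent_mV : Convergent (mV 𝕜) :=
  (convergent_X.smul _).add (((convergent_phi 𝕜).evalNeg.mul (convergent_gSeries 𝕜)).mul
    (convergent_X.mul (convergent_phi 𝕜).derivative))

theorem convergent_betaAM : Convergent (betaAM 𝕜) :=
  ((convergent_mFst 𝕜).sub ((convergent_mFst 𝕜).avg 1)).sub
    (((((convergent_gSeries 𝕜).mul (convergent_phi 𝕜).evalNeg).sub
      ((convergent_expQuot 𝕜).smul _)).mul convergent_X).smul _)

theorem smul_eq_C_mul' (c : 𝕜) (f : 𝕜⟦X⟧) : c • f = PowerSeries.C c * f :=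
  PowerSeries.smul_eq_C_mul f c

theorem C_half : (2 : 𝕜⟦X⟧) * PowerSeries.C (1 / 2 : 𝕜) = 1 := by
  rw [← map_ofNat (PowerSeries.C (R := 𝕜)) 2, ← map_mul]
  norm_num

theorem C_quarter : PowerSeries.C (1 / 4 : 𝕜) = PowerSeries.C (1 / 2) * PowerSeries.C (1 / 2) := by
  rw [← map_mul]
  norm_num

theorem C_eighth : PowerSeries.C (1 / 8 : 𝕜) =
    PowerSeries.C (1 / 2) * PowerSeries.C (1 / 2) * PowerSeries.C (1 / 2) := by
  rw [← map_mul, ← map_mul]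
  norm_num

theorem eulerTwo_gammaV : eulerTwo (gammaV 𝕜) = (1 / 8 : 𝕜) • t
    - (1 / 2 : 𝕜) • (t * ψ * rSeries 𝕜 * φ') := by
  have h (a b : 𝕜⟦X⟧) : eulerTwo (a - b) = eulerTwo a - eulerTwo b := by
    simp only [eulerTwo, map_sub]; ring
  rw [gammaV, h, eulerTwo_avg, two_smul_gSeries, mV]
  simp only [eulerTwo, Derivation.map_smul, PowerSeries.derivative_X]
  simp only [smul_eq_C_mul', C_quarter, C_eighth]
  linear_combination (PowerSeries.C (1 / 2 : 𝕜) ^ 2 * t + t * ψ * g * φ') * C_half 𝕜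

/-- The differential equation of `Π`, for the series `Π` that the formula for `β_AM` attaches to
`β_{1/4}`. The identity takes place in a field that contains `x = t` and `e = e ^ t`; here `f`, `p`,
`n`, `G`, `q`, `s` are `e ^ (-t)`, `φ₁(t)`, `φ₁(-t)`, `g`, `1 / φ₁`, `(φ₁ - 1) / t`, and a prime
denotes the derivative. -/
theorem betaAM_field_identity {K : Type*} [Field K] [CharZero K]
    {x e f p n p' n' G G' q q' s s' : K} (hx : x ≠ 0) (he1 : e - 1 ≠ 0)
    (hf : e * f = 1) (hp : p * (e - 1) = x) (hn : n = p * e) (hp' : p' * (e - 1) + p * e = 1)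
    (hn' : n' = p' * e + p * e) (hG : 2 * (x ^ 2 * G) = e - f - 2 * x)
    (hG' : 2 * (2 * x * G + x ^ 2 * G') = e + f - 2) (hq : x * q = e - 1) (hq' : q + x * q' = e)
    (hs : x * s = p - 1) (hs' : s + x * s' = p') :
    x * (n' * (s + 1 / 4) + n * s' + 1 / 4 * (((G' * n + G * n') - 1 / 2 * q') * x +
      (G * n - 1 / 2 * q)) + 1 / 2 * q' - ((G' * n + G * n') * (1 - p) - G * n * p'))
      + 2 * (n * (s + 1 / 4) + 1 / 4 * ((G * n - 1 / 2 * q) * x) + 1 / 2 * q - G * n * (1 - p)) =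
      1 / 2 * q - G * n * (1 - p) := by
  have he : e ≠ 0 := left_ne_zero_of_mul_eq_one hf
  obtain rfl : f = 1 / e := by field_simp; linear_combination hf
  obtain rfl : p = x / (e - 1) := by field_simp; linear_combination hp
  subst hn
  obtain rfl : p' = (1 - x / (e - 1) * e) / (e - 1) := by
    field_simp; field_simp at hp'; linear_combination hp'
  subst hn'
  obtain rfl : G = (e - 1 / e - 2 * x) / (2 * x ^ 2) := by
    rw [eq_div_iff (mul_ne_zero two_ne_zero (pow_ne_zero 2 hx))]; linear_combination hG
  obtain rfl : G' =
      ((e + 1 / e - 2) / 2 - 2 * x * ((e - 1 / e - 2 * x) / (2 * x ^ 2))) / x ^ 2 := by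
    rw [eq_div_iff (pow_ne_zero 2 hx)]; linear_combination hG' / 2
  obtain rfl : q = (e - 1) / x := by rw [eq_div_iff hx]; linear_combination hq
  obtain rfl : q' = (e - (e - 1) / x) / x := by rw [eq_div_iff hx]; linear_combination hq'
  obtain rfl : s = (x / (e - 1) - 1) / x := by rw [eq_div_iff hx]; linear_combination hs
  obtain rfl : s' = ((1 - x / (e - 1) * e) / (e - 1) - (x / (e - 1) - 1) / x) / x := by
    rw [eq_div_iff hx]; linear_combination hs'
  clear hq hq' hs hs' hG hG' hp hp' hf
  field_simp
  ring

/-- The right side of the formula for `γ_AM(-t) + γ_V(t)` is even. The identity takes place in a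
field that contains `x = t` and `e = e ^ t`; here `p'` and `r'` are the values of `φ₁'` at `t` and
`-t`, and `s`, `s₂` those of `(φ₁ - 1) / t`. -/
theorem gammaSum_field_identity {K : Type*} [Field K] [CharZero K]
    {x e f p n p' r' G q r s s₂ : K} (hx : x ≠ 0) (he1 : e - 1 ≠ 0)
    (hf : e * f = 1) (hp : p * (e - 1) = x) (hn : n = p * e) (hp' : x * p' = p - p * n)
    (hr' : x * r' = n * (p - 1)) (hG : 2 * (x ^ 2 * G) = e - f - 2 * x)
    (hq : p * q = 1) (hr : n * r = 1) (hs : x * s = p - 1) (hs₂ : x * s₂ = 1 - n) :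
    n * G * x * (p * (s₂ + 1 / 4) - 1 / 4 * p - p') - 1 / 2 * (q * x * (p * (s₂ + 1 / 4)))
      - 1 / 8 * x =
    p * G * x * (n * (s + 1 / 4) - 1 / 4 * n - r') + 1 / 2 * (r * x * (n * (s + 1 / 4)))
      + 1 / 8 * x := by
  have he : e ≠ 0 := left_ne_zero_of_mul_eq_one hf
  obtain rfl : f = 1 / e := by field_simp; linear_combination hf
  obtain rfl : p = x / (e - 1) := by field_simp; linear_combination hp
  subst hn
  obtain rfl : p' = (x / (e - 1) - x / (e - 1) * (x / (e - 1) * e)) / x := by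
    rw [eq_div_iff hx]; linear_combination hp'
  obtain rfl : r' = (x / (e - 1) * e * (x / (e - 1) - 1)) / x := by
    rw [eq_div_iff hx]; linear_combination hr'
  obtain rfl : G = (e - 1 / e - 2 * x) / (2 * x ^ 2) := by
    rw [eq_div_iff (mul_ne_zero two_ne_zero (pow_ne_zero 2 hx))]; linear_combination hG
  obtain rfl : q = (e - 1) / x := by field_simp; field_simp at hq; linear_combination hq
  obtain rfl : r = (e - 1) / (x * e) := by
    field_simp; field_simp at hr; linear_combination hr
  obtain rfl : s = (x / (e - 1) - 1) / x := by rw [eq_div_iff hx]; linear_combination hs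
  obtain rfl : s₂ = (1 - x / (e - 1) * e) / x := by rw [eq_div_iff hx]; linear_combination hs₂
  clear hq hr hs hs₂ hG hr' hp hp' hf
  field_simp
  ring

/-- Both sides lead, by the formula for `β_AM`, to the power series solution `Π` of its differential
equation, and this solution is unique. -/
theorem betaAM_eq : betaAM 𝕜 = betaSeries 𝕜 (1 / 4) := by
  set s := PowerSeries.mk (fun n => PowerSeries.coeff (n + 1) (phi 𝕜 - 1)) with hs_def
  have hs : t * s = φ - 1 := X_mul_shift (φ - 1) (by
    rw [map_sub, coeff_zero_phi]; simp)
  have hsD := congrArg (PowerSeries.derivative 𝕜) hs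
  have hnD := congrArg (PowerSeries.derivative 𝕜) (phiNeg_eq 𝕜)
  have hGD := X_sq_mul_gSeries 𝕜
  rw [pow_two] at hGD
  replace hGD := congrArg (PowerSeries.derivative 𝕜) hGD
  have hqD := congrArg (PowerSeries.derivative 𝕜) (X_mul_expQuot 𝕜)
  have hfD : PowerSeries.derivative 𝕜 (PowerSeries.evalNegHom (PowerSeries.exp 𝕜)) =
      - PowerSeries.evalNegHom (PowerSeries.exp 𝕜) := by
    have h := congrArg (PowerSeries.derivative 𝕜) (exp_mul_expNeg 𝕜)
    rw [Derivation.leibniz, PowerSeries.derivative_exp, PowerSeries.derivative_one] at h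
    apply mul_left_cancel₀ (left_ne_zero_of_mul_eq_one (exp_mul_expNeg 𝕜))
    simp only [smul_eq_mul] at h
    linear_combination h
  have h2 : PowerSeries.derivative 𝕜 (2 : 𝕜⟦X⟧) = 0 := by
    rw [← map_ofNat (PowerSeries.C (R := 𝕜)) 2, PowerSeries.derivative_C]
  simp only [Derivation.leibniz, map_sub, PowerSeries.derivative_X, PowerSeries.derivative_one,
    PowerSeries.derivative_exp, hfD, smul_eq_mul, h2]
    at hsD hnD hGD hqD
  -- `Π` is determined by its differential equation
  have key : eulerTwo (betaSeries 𝕜 (1 / 4) + (1 / 4 : 𝕜) • ((g * ψ -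
      (1 / 2 : 𝕜) • expQuot 𝕜) * t) - mFst 𝕜) = - mFst 𝕜 := by
    rw [betaSeries, ← hs_def, mFst]
    simp only [eulerTwo, smul_eq_C_mul', map_sub, map_add, Derivation.leibniz,
      PowerSeries.derivative_C, PowerSeries.derivative_X, PowerSeries.derivative_one, smul_eq_mul]
    apply IsFractionRing.injective 𝕜⟦X⟧ (FractionRing 𝕜⟦X⟧)
    let ι := algebraMap 𝕜⟦X⟧ (FractionRing 𝕜⟦X⟧)
    have hι : Function.Injective ι := IsFractionRing.injective 𝕜⟦X⟧ (FractionRing 𝕜⟦X⟧)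
    have : CharZero (FractionRing 𝕜⟦X⟧) := charZero_of_injective_algebraMap (R := 𝕜) (by
      exact hι.comp PowerSeries.C_injective)
    have hhalf : ι (PowerSeries.C (1 / 2 : 𝕜)) = 1 / 2 := by
      have := congrArg ι (C_half 𝕜)
      rw [map_mul, map_one, map_ofNat] at this
      linear_combination this / 2
    have hquarter : ι (PowerSeries.C (1 / 4 : 𝕜)) = 1 / 4 := by
      rw [C_quarter, map_mul, hhalf]; norm_num
    have hx : ι t ≠ 0 := (map_ne_zero_iff ι hι).2 PowerSeries.X_ne_zero
    have he1 : ι (PowerSeries.exp 𝕜) - 1 ≠ 0 := by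
      rw [← map_one ι, ← map_sub]
      exact (map_ne_zero_iff ι hι).2 (exp_sub_one_ne_zero 𝕜)
    have hf := congrArg ι (exp_mul_expNeg 𝕜)
    have hp := congrArg ι (phi_mul_exp_sub_one 𝕜)
    have hn := congrArg ι (phiNeg_eq 𝕜)
    have hp' := congrArg ι (derivative_phi 𝕜)
    have hG := congrArg ι (X_sq_mul_gSeries 𝕜)
    have hq := congrArg ι (X_mul_expQuot 𝕜)
    replace hs := congrArg ι hs
    replace hsD := congrArg ι hsD
    replace hnD := congrArg ι hnD
    replace hGD := congrArg ι hGD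
    replace hqD := congrArg ι hqD
    simp only [map_mul, map_add, map_sub, map_pow, map_one, map_ofNat, map_neg, map_zero]
      at hf hp hn hp' hG hq hs hsD hnD hGD hqD
    have := betaAM_field_identity (n' := ι (PowerSeries.derivative 𝕜 (phiNeg 𝕜)))
      (G' := ι (PowerSeries.derivative 𝕜 (gSeries 𝕜)))
      (q' := ι (PowerSeries.derivative 𝕜 (expQuot 𝕜))) (s' := ι (PowerSeries.derivative 𝕜 s))
      hx he1 hf hp hn hp' (by linear_combination hnD) hG
      (by simp at hGD; linear_combination hGD) hq (by linear_combination hqD) hs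
      (by linear_combination hsD)
    simp only [map_mul, map_add, map_sub, map_neg, map_one, map_ofNat, map_zero]
    simp only [show algebraMap 𝕜⟦X⟧ (FractionRing 𝕜⟦X⟧) = ι from rfl, hhalf, hquarter]
    linear_combination this
  have h := congrArg (avg 1) key
  rw [avg_eulerTwo] at h
  have h3 : avg 1 (- mFst 𝕜) = - avg 1 (mFst 𝕜) := by
    ext n; simp [avg, neg_div]
  rw [h3] at h
  rw [betaAM]
  linear_combination -h

theorem evalNeg_smul (c : 𝕜) (f : 𝕜⟦X⟧) :
    PowerSeries.evalNegHom (c • f) = c • PowerSeries.evalNegHom f := by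
  ext n; simp [coeff_evalNeg, mul_left_comm]

theorem evalNeg_avg (f : 𝕜⟦X⟧) (k : ℕ) :
    PowerSeries.evalNegHom (avg k f) = avg k (PowerSeries.evalNegHom f) := by
  ext n; simp [coeff_evalNeg, avg, mul_div_assoc]

/-- The reflection `t ↦ -t` interchanges the data at `(X, 0)` and at `(0, Y)`. -/
theorem evalNeg_mSnd : PowerSeries.evalNegHom (mSnd 𝕜) = - mV 𝕜 := by
  rw [mSnd, mV]
  simp only [map_mul, map_add, map_sub, map_one, evalNeg_smul, evalNeg_gSeries, evalNeg_evalNeg,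
    PowerSeries.evalNegHom_X, X_mul_derivative_phi, smul_neg]
  ring

/-- The right side of the formula for `γ_AM(-t) + γ_V(t)`. -/
def gammaSum : 𝕜⟦X⟧ :=
  ψ * g * t * (PowerSeries.evalNegHom (betaAM 𝕜) - (1 / 4 : 𝕜) • φ - φ')
    - (1 / 2 : 𝕜) • (expQuot 𝕜 * t * PowerSeries.evalNegHom (betaAM 𝕜)) - (1 / 8 : 𝕜) • t

theorem evalNeg_gammaAM_add_gammaV :
    PowerSeries.evalNegHom (gammaAM 𝕜) + gammaV 𝕜 = gammaSum 𝕜 := by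
  have h3 : avg 1 (- mV 𝕜) = - avg 1 (mV 𝕜) := by
    ext n; simp [avg, neg_div]
  rw [gammaAM, gammaV, gammaSum]
  simp only [map_mul, map_add, map_sub, evalNeg_smul, evalNeg_gSeries, evalNeg_evalNeg,
    PowerSeries.evalNegHom_X, evalNeg_avg, evalNeg_mSnd, h3]
  simp only [smul_eq_C_mul', C_quarter, C_eighth]
  have hm : mV 𝕜 = PowerSeries.C (1 / 2) * PowerSeries.C (1 / 2) * t + ψ * g * (t * φ') := by
    rw [mV, smul_eq_C_mul', C_quarter]
  linear_combination -hm + (PowerSeries.C (1 / 2 : 𝕜) ^ 2 * t) * C_half 𝕜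

theorem evalNeg_gammaSum : PowerSeries.evalNegHom (gammaSum 𝕜) = gammaSum 𝕜 := by
  set s := PowerSeries.mk (fun n => PowerSeries.coeff (n + 1) (phi 𝕜 - 1)) with hs_def
  have hs : t * s = φ - 1 := X_mul_shift (φ - 1) (by
    rw [map_sub, coeff_zero_phi]; simp)
  have hs₂ := congrArg PowerSeries.evalNegHom hs
  have hC (c : 𝕜) : PowerSeries.evalNegHom (PowerSeries.C c) = PowerSeries.C c := by
    ext n
    rw [coeff_evalNeg, PowerSeries.coeff_C]
    split_ifs with h <;> simp [h]
  have hr := congrArg PowerSeries.evalNegHom (phi_mul_expQuot 𝕜)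
  simp only [map_mul, map_sub, map_one, PowerSeries.evalNegHom_X] at hs₂ hr
  rw [gammaSum, betaAM_eq, betaSeries, ← hs_def]
  simp only [smul_eq_C_mul', map_mul, map_add, map_sub, hC, evalNeg_gSeries,
    evalNeg_evalNeg, PowerSeries.evalNegHom_X]
  apply IsFractionRing.injective 𝕜⟦X⟧ (FractionRing 𝕜⟦X⟧)
  let ι := algebraMap 𝕜⟦X⟧ (FractionRing 𝕜⟦X⟧)
  have hι : Function.Injective ι := IsFractionRing.injective 𝕜⟦X⟧ (FractionRing 𝕜⟦X⟧)
  have : CharZero (FractionRing 𝕜⟦X⟧) := charZero_of_injective_algebraMap (R := 𝕜) (by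
    exact hι.comp PowerSeries.C_injective)
  have hhalf : ι (PowerSeries.C (1 / 2 : 𝕜)) = 1 / 2 := by
    have := congrArg ι (C_half 𝕜)
    rw [map_mul, map_one, map_ofNat] at this
    linear_combination this / 2
  have hquarter : ι (PowerSeries.C (1 / 4 : 𝕜)) = 1 / 4 := by
    rw [C_quarter, map_mul, hhalf]; norm_num
  have heighth : ι (PowerSeries.C (1 / 8 : 𝕜)) = 1 / 8 := by
    rw [C_eighth, map_mul, map_mul, hhalf]; norm_num
  have hx : ι t ≠ 0 := (map_ne_zero_iff ι hι).2 PowerSeries.X_ne_zero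
  have he1 : ι (PowerSeries.exp 𝕜) - 1 ≠ 0 := by
    rw [← map_one ι, ← map_sub]
    exact (map_ne_zero_iff ι hι).2 (exp_sub_one_ne_zero 𝕜)
  have hf := congrArg ι (exp_mul_expNeg 𝕜)
  have hp := congrArg ι (phi_mul_exp_sub_one 𝕜)
  have hn := congrArg ι (phiNeg_eq 𝕜)
  have hp' := congrArg ι (X_mul_derivative_phi 𝕜)
  have hr' := congrArg ι (X_mul_evalNeg_derivative_phi 𝕜)
  have hG := congrArg ι (X_sq_mul_gSeries 𝕜)
  have hq := congrArg ι (phi_mul_expQuot 𝕜)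
  replace hr := congrArg ι hr
  replace hs := congrArg ι hs
  replace hs₂ := congrArg ι hs₂
  simp only [map_mul, map_sub, map_pow, map_one, map_ofNat, map_neg]
    at hf hp hn hp' hr' hG hq hr hs hs₂
  have := gammaSum_field_identity hx he1 hf hp hn hp' hr' hG hq hr hs
    (s₂ := ι (PowerSeries.evalNegHom s)) (by linear_combination -hs₂)
  simp only [map_mul, map_add, map_sub, map_neg]
  simp only [show algebraMap 𝕜⟦X⟧ (FractionRing 𝕜⟦X⟧) = ι from rfl, hhalf, hquarter, heighth]
  linear_combination -this

theorem coeff_gammaAM_of_odd {n : ℕ} (hn : Odd n) :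
    PowerSeries.coeff n (gammaAM 𝕜) = PowerSeries.coeff n (gammaV 𝕜) := by
  have h1 := congrArg (PowerSeries.coeff n) (evalNeg_gammaAM_add_gammaV 𝕜)
  have h2 := congrArg (PowerSeries.coeff n) (evalNeg_gammaSum 𝕜)
  rw [map_add, coeff_evalNeg, hn.neg_one_pow] at h1
  rw [coeff_evalNeg, hn.neg_one_pow] at h2
  linear_combination -h1 + h2 / 2

/-! ### The coefficients up to degree four -/

theorem bernoulli_four : bernoulli 4 = -1 / 30 := by
  rw [bernoulli_eq_bernoulli'_of_ne_one (by norm_num), bernoulli'_four]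

theorem bernoulli_three : bernoulli 3 = 0 := bernoulli_eq_zero_of_odd (by decide) (by norm_num)

theorem bernoulli_five : bernoulli 5 = 0 := bernoulli_eq_zero_of_odd (by decide) (by norm_num)

theorem coeff_phi_two : PowerSeries.coeff 2 φ = 1 / 12 := by
  simp [phi, bernoulliPowerSeries, Nat.factorial]; norm_num
theorem coeff_phi_three : PowerSeries.coeff 3 φ = 0 := by
  simp [phi, bernoulliPowerSeries, bernoulli_three]
theorem coeff_phi_four : PowerSeries.coeff 4 φ = -1 / 720 := by
  simp [phi, bernoulliPowerSeries, bernoulli_four, Nat.factorial]; norm_num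
theorem coeff_phi_five : PowerSeries.coeff 5 φ = 0 := by
  simp [phi, bernoulliPowerSeries, bernoulli_five]

theorem coeff_rSeries (n : ℕ) : PowerSeries.coeff n (rSeries 𝕜) =
    (1 - (-1) ^ n) / (n + 2).factorial := by
  have h : PowerSeries.coeff (n + 2) (2 * t) = 0 := by
    rw [← map_ofNat (PowerSeries.C (R := 𝕜)) 2, PowerSeries.coeff_C_mul, PowerSeries.coeff_X]
    simp
  rw [rSeries, PowerSeries.coeff_mk, map_sub, map_sub, h, coeff_evalNeg, PowerSeries.coeff_exp]
  simp [pow_add]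
  ring

/-- The coefficients of degree at most `4` of `f` are `a₀, …, a₄`. -/
def Jet (f : 𝕜⟦X⟧) (a₀ a₁ a₂ a₃ a₄ : 𝕜) : Prop :=
  PowerSeries.coeff 0 f = a₀ ∧ PowerSeries.coeff 1 f = a₁ ∧ PowerSeries.coeff 2 f = a₂ ∧
    PowerSeries.coeff 3 f = a₃ ∧ PowerSeries.coeff 4 f = a₄

variable {𝕜}
variable {f h : 𝕜⟦X⟧} {a₀ a₁ a₂ a₃ a₄ b₀ b₁ b₂ b₃ b₄ : 𝕜}

theorem Jet.mul (hf : Jet 𝕜 f a₀ a₁ a₂ a₃ a₄) (hh : Jet 𝕜 h b₀ b₁ b₂ b₃ b₄) :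
    Jet 𝕜 (f * h) (a₀ * b₀) (a₀ * b₁ + a₁ * b₀) (a₀ * b₂ + a₁ * b₁ + a₂ * b₀)
      (a₀ * b₃ + a₁ * b₂ + a₂ * b₁ + a₃ * b₀)
      (a₀ * b₄ + a₁ * b₃ + a₂ * b₂ + a₃ * b₁ + a₄ * b₀) := by
  obtain ⟨rfl, rfl, rfl, rfl, rfl⟩ := hf
  obtain ⟨rfl, rfl, rfl, rfl, rfl⟩ := hh
  refine ⟨?_, ?_, ?_, ?_, ?_⟩ <;>
    (rw [PowerSeries.coeff_mul, Finset.Nat.sum_antidiagonal_eq_sum_range_succ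
      (fun i j => PowerSeries.coeff i f * PowerSeries.coeff j h)]
     simp [Finset.sum_range_succ])

theorem Jet.smul (hf : Jet 𝕜 f a₀ a₁ a₂ a₃ a₄) (c : 𝕜) :
    Jet 𝕜 (c • f) (c * a₀) (c * a₁) (c * a₂) (c * a₃) (c * a₄) := by
  obtain ⟨rfl, rfl, rfl, rfl, rfl⟩ := hf
  exact ⟨map_smul _ _ _, map_smul _ _ _, map_smul _ _ _, map_smul _ _ _, map_smul _ _ _⟩

theorem Jet.sub (hf : Jet 𝕜 f a₀ a₁ a₂ a₃ a₄) (hh : Jet 𝕜 h b₀ b₁ b₂ b₃ b₄) :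
    Jet 𝕜 (f - h) (a₀ - b₀) (a₁ - b₁) (a₂ - b₂) (a₃ - b₃) (a₄ - b₄) := by
  obtain ⟨rfl, rfl, rfl, rfl, rfl⟩ := hf
  obtain ⟨rfl, rfl, rfl, rfl, rfl⟩ := hh
  exact ⟨map_sub _ _ _, map_sub _ _ _, map_sub _ _ _, map_sub _ _ _, map_sub _ _ _⟩

theorem Jet.evalNeg (hf : Jet 𝕜 f a₀ a₁ a₂ a₃ a₄) :
    Jet 𝕜 (PowerSeries.evalNegHom f) a₀ (-a₁) a₂ (-a₃) a₄ := by
  obtain ⟨rfl, rfl, rfl, rfl, rfl⟩ := hf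
  refine ⟨?_, ?_, ?_, ?_, ?_⟩ <;> rw [coeff_evalNeg] <;> ring

theorem Jet.avg (hf : Jet 𝕜 f a₀ a₁ a₂ a₃ a₄) :
    Jet 𝕜 (avg 1 f) (a₀ / 2) (a₁ / 3) (a₂ / 4) (a₃ / 5) (a₄ / 6) := by
  obtain ⟨rfl, rfl, rfl, rfl, rfl⟩ := hf
  refine ⟨?_, ?_, ?_, ?_, ?_⟩ <;> rw [KashiwaraVergne.avg, PowerSeries.coeff_mk] <;> norm_num

theorem Jet.eulerTwo (hf : Jet 𝕜 f a₀ a₁ a₂ a₃ a₄) :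
    Jet 𝕜 (eulerTwo f) (2 * a₀) (3 * a₁) (4 * a₂) (5 * a₃) (6 * a₄) := by
  obtain ⟨rfl, rfl, rfl, rfl, rfl⟩ := hf
  refine ⟨?_, ?_, ?_, ?_, ?_⟩ <;> rw [KashiwaraVergne.eulerTwo, map_add,
    ← map_ofNat (PowerSeries.C (R := 𝕜)) 2, PowerSeries.coeff_C_mul]
  · simp
  all_goals
    rw [PowerSeries.coeff_succ_X_mul, PowerSeries.coeff_derivative]
    norm_num
    ring

theorem Jet.congr (hf : Jet 𝕜 f a₀ a₁ a₂ a₃ a₄) (h₀ : a₀ = b₀) (h₁ : a₁ = b₁) (h₂ : a₂ = b₂)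
    (h₃ : a₃ = b₃) (h₄ : a₄ = b₄) : Jet 𝕜 f b₀ b₁ b₂ b₃ b₄ := by
  subst h₀ h₁ h₂ h₃ h₄
  exact hf

variable (𝕜)

theorem jet_X : Jet 𝕜 t 0 1 0 0 0 := by
  refine ⟨?_, ?_, ?_, ?_, ?_⟩ <;> simp [PowerSeries.coeff_X]

theorem jet_phi : Jet 𝕜 φ 1 (-1 / 2) (1 / 12) 0 (-1 / 720) :=
  ⟨coeff_zero_phi 𝕜, coeff_one_phi 𝕜, coeff_phi_two 𝕜, coeff_phi_three 𝕜, coeff_phi_four 𝕜⟩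

theorem jet_derivative_phi : Jet 𝕜 φ' (-1 / 2) (1 / 6) 0 (-1 / 180) 0 := by
  refine ⟨?_, ?_, ?_, ?_, ?_⟩ <;>
    norm_num [PowerSeries.coeff_derivative, coeff_one_phi, coeff_phi_two, coeff_phi_three,
      coeff_phi_four, coeff_phi_five]

theorem jet_rSeries : Jet 𝕜 (rSeries 𝕜) 0 (1 / 3) 0 (1 / 60) 0 := by
  refine ⟨?_, ?_, ?_, ?_, ?_⟩ <;> norm_num [coeff_rSeries, Nat.factorial]

theorem jet_expQuot : Jet 𝕜 (expQuot 𝕜) 1 (1 / 2) (1 / 6) (1 / 24) (1 / 120) := by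
  refine ⟨?_, ?_, ?_, ?_, ?_⟩ <;>
    norm_num [expQuot, PowerSeries.coeff_mk, PowerSeries.coeff_exp, Nat.factorial]

theorem jet_betaAM : Jet 𝕜 (betaAM 𝕜) (-1 / 4) (-1 / 24) (1 / 48) (1 / 180) (-1 / 2880) := by
  have h : Jet 𝕜 (PowerSeries.mk (fun n => PowerSeries.coeff (n + 1) (phi 𝕜 - 1)) +
      PowerSeries.C (1 / 4)) (-1 / 4) (1 / 12) 0 (-1 / 720) 0 := by
    refine ⟨?_, ?_, ?_, ?_, ?_⟩ <;>
      norm_num [PowerSeries.coeff_one, PowerSeries.coeff_C, coeff_one_phi, coeff_phi_two,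
        coeff_phi_three, coeff_phi_four, coeff_phi_five, PowerSeries.coeff_mk]
  rw [betaAM_eq]
  refine ((jet_phi 𝕜).evalNeg.mul h).congr ?_ ?_ ?_ ?_ ?_ <;> norm_num

theorem jet_gammaV : Jet 𝕜 (gammaV 𝕜) 0 (1 / 24) (1 / 48) (1 / 360) (-1 / 2160) := by
  have h := (((jet_X 𝕜).smul (1 / 8)).sub (((((jet_X 𝕜).mul (jet_phi 𝕜).evalNeg).mul
    (jet_rSeries 𝕜)).mul (jet_derivative_phi 𝕜)).smul (1 / 2))).avg
  rw [← eulerTwo_gammaV, avg_eulerTwo] at h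
  refine h.congr ?_ ?_ ?_ ?_ ?_ <;> norm_num

theorem jet_gammaAM : Jet 𝕜 (gammaAM 𝕜) 0 (1 / 24) (1 / 48) (1 / 360) (-1 / 4320) := by
  have hg : Jet 𝕜 g _ _ _ _ _ := (jet_rSeries 𝕜).smul (1 / 2)
  have h : Jet 𝕜 (gammaSum 𝕜) _ _ _ _ _ :=
    (((((jet_phi 𝕜).evalNeg.mul hg).mul (jet_X 𝕜)).mul (((jet_betaAM 𝕜).evalNeg.sub
      ((jet_phi 𝕜).smul (1 / 4))).sub (jet_derivative_phi 𝕜))).sub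
      ((((jet_expQuot 𝕜).mul (jet_X 𝕜)).mul (jet_betaAM 𝕜).evalNeg).smul (1 / 2))).sub
      ((jet_X 𝕜).smul (1 / 8))
  have h2 := (h.sub (jet_gammaV 𝕜)).evalNeg
  rw [← evalNeg_gammaAM_add_gammaV, add_sub_cancel_right, evalNeg_evalNeg] at h2
  refine h2.congr ?_ ?_ ?_ ?_ ?_ <;> norm_num

theorem trunc_eulerTwo_gammaAM : PowerSeries.trunc 5 (eulerTwo (gammaAM 𝕜)) =
    Polynomial.monomial 1 (1 / 8 : 𝕜) + Polynomial.monomial 2 (1 / 12 : 𝕜)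
      + Polynomial.monomial 3 (1 / 72 : 𝕜) - Polynomial.monomial 4 (1 / 720 : 𝕜) := by
  obtain ⟨h0, h1, h2, h3, h4⟩ := (jet_gammaAM 𝕜).eulerTwo
  ext n
  simp only [PowerSeries.coeff_trunc, Polynomial.coeff_add, Polynomial.coeff_sub,
    Polynomial.coeff_monomial]
  rcases lt_or_ge n 5 with hn | hn
  · interval_cases n <;> simp only [h0, h1, h2, h3, h4] <;> norm_num
  · rw [if_neg (by omega), if_neg (by omega), if_neg (by omega), if_neg (by omega),
      if_neg (by omega)]
    simp

end FirstOrderSeries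

/-! ### Integrals over the unit interval -/

section Parametric

open Set Metric MeasureTheory
open scoped ContDiff

variable {𝕜 : Type*} [RCLike 𝕜]

/-- A property that holds near `0` holds near `0` on whole segments `[0, x]`. -/
theorem eventually_segment {E : Type*} [NormedAddCommGroup E] [NormedSpace 𝕜 E] {P : E → Prop}
    (h : ∀ᶠ x in 𝓝 (0 : E), P x) :
    ∀ᶠ x in 𝓝 (0 : E), ∀ s ∈ Icc (0 : ℝ) 1, P ((s : 𝕜) • x) := by
  obtain ⟨r, hr, h⟩ := Metric.eventually_nhds_iff_ball.1 h
  filter_upwards [ball_mem_nhds (0 : E) hr] with x hx s hs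
  apply h
  rw [mem_ball_zero_iff] at hx ⊢
  rw [norm_smul, RCLike.norm_ofReal, abs_of_nonneg hs.1]
  exact (mul_le_of_le_one_left (norm_nonneg _) hs.2).trans_lt hx

universe u

variable {E : Type u} [NormedAddCommGroup E] [NormedSpace 𝕜 E] [FiniteDimensional 𝕜 E]

/-- Differentiation under the integral sign. -/
theorem hasFDerivAt_integral_unit {G : Type*} [NormedAddCommGroup G] [NormedSpace 𝕜 G]
    [NormedSpace ℝ G] [IsScalarTower ℝ 𝕜 G] {F : 𝕜 × E → G} {U : Set E} (hU : IsOpen U)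
    (hF : ∀ s ∈ Icc (0 : ℝ) 1, ∀ p ∈ U, ContDiffAt 𝕜 1 F ((s : 𝕜), p)) {p : E} (hp : p ∈ U) :
    HasFDerivAt (fun q => ∫ s in (0 : ℝ)..1, F ((s : 𝕜), q))
      (∫ s in (0 : ℝ)..1, (fderiv 𝕜 F ((s : 𝕜), p)).comp (ContinuousLinearMap.inr 𝕜 𝕜 E)) p := by
  have := FiniteDimensional.proper 𝕜 E
  obtain ⟨r, hr, hrU⟩ := nhds_basis_closedBall.mem_iff.1 (hU.mem_nhds hp)
  have hI : uIoc (0 : ℝ) 1 ⊆ Icc 0 1 := by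
    rw [uIoc_of_le zero_le_one]
    exact Ioc_subset_Icc_self
  have hofReal : Continuous (fun s : ℝ => (s : 𝕜)) := RCLike.continuous_ofReal
  have hcont (q : E) (hq : q ∈ U) : ContinuousOn (fun s : ℝ => F ((s : 𝕜), q)) (Icc 0 1) :=
    fun s hs => ((hF s hs q hq).continuousAt.comp (f := fun s : ℝ => ((s : 𝕜), q))
      (by fun_prop)).continuousWithinAt
  have hcont' : ContinuousOn (fun x : ℝ × E =>
      (fderiv 𝕜 F ((x.1 : 𝕜), x.2)).comp (ContinuousLinearMap.inr 𝕜 𝕜 E)) (Icc 0 1 ×ˢ U) := by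
    rintro ⟨s, q⟩ ⟨hs, hq⟩
    have h1 : ContinuousAt (fderiv 𝕜 F) ((s : 𝕜), q) :=
      ((hF s hs q hq).fderiv_right (m := 0) (by norm_num)).continuousAt
    have h2 : ContinuousAt (fun x : ℝ × E => fderiv 𝕜 F ((x.1 : 𝕜), x.2)) (s, q) :=
      h1.comp (f := fun x : ℝ × E => ((x.1 : 𝕜), x.2)) (by fun_prop)
    exact (h2.clm_comp continuousAt_const).continuousWithinAt
  obtain ⟨C, hC⟩ := ((isCompact_Icc (a := (0 : ℝ)) (b := 1)).prod
    (isCompact_closedBall p r)).exists_bound_of_continuousOn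
    (hcont'.mono (prod_mono_right hrU))
  refine intervalIntegral.hasFDerivAt_integral_of_dominated_of_fderiv_le
    (F := fun q s => F ((s : 𝕜), q))
    (F' := fun q s => (fderiv 𝕜 F ((s : 𝕜), q)).comp (ContinuousLinearMap.inr 𝕜 𝕜 E))
    (bound := fun _ => C) (closedBall_mem_nhds p hr) ?_ ?_ ?_ ?_ ?_ ?_
  · filter_upwards [hU.mem_nhds hp] with q hq
    exact ((hcont q hq).mono hI).aestronglyMeasurable measurableSet_uIoc
  · exact (hcont p hp).intervalIntegrable_of_Icc zero_le_one
  · refine ContinuousOn.aestronglyMeasurable ?_ measurableSet_uIoc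
    exact hcont'.comp (f := fun s : ℝ => (s, p)) (by fun_prop) fun s hs => ⟨hI hs, hp⟩
  · exact Filter.Eventually.of_forall fun s hs q hq => hC (s, q) ⟨hI hs, hq⟩
  · exact intervalIntegrable_const
  · refine Filter.Eventually.of_forall fun s hs q hq => ?_
    have h1 := ((hF s (hI hs) q (hrU hq)).differentiableAt (by norm_num)).hasFDerivAt
    exact h1.comp q (hasFDerivAt_prodMk_right (s : 𝕜) q)

theorem contDiffOn_integral_unit_nat (n : ℕ) {G : Type u} [NormedAddCommGroup G]
    [NormedSpace 𝕜 G] [NormedSpace ℝ G] [IsScalarTower ℝ 𝕜 G] {F : 𝕜 × E → G} {U : Set E}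
    (hU : IsOpen U) (hF : ∀ s ∈ Icc (0 : ℝ) 1, ∀ p ∈ U, ContDiffAt 𝕜 ∞ F ((s : 𝕜), p)) :
    ContDiffOn 𝕜 n (fun q => ∫ s in (0 : ℝ)..1, F ((s : 𝕜), q)) U := by
  have hd {p : E} (hp : p ∈ U) := hasFDerivAt_integral_unit hU
    (fun s hs p hp => (hF s hs p hp).of_le (by exact_mod_cast le_top)) hp
  induction n generalizing G with
  | zero =>
    rw [Nat.cast_zero, contDiffOn_zero]
    exact fun p hp => (hd hp).continuousAt.continuousWithinAt
  | succ n ih =>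
    push_cast
    rw [contDiffOn_succ_iff_fderiv_of_isOpen hU]
    refine ⟨fun p hp => (hd hp).differentiableAt.differentiableWithinAt, by simp, ?_⟩
    have h2 : ∀ s ∈ Icc (0 : ℝ) 1, ∀ p ∈ U, ContDiffAt 𝕜 ∞ (fun q : 𝕜 × E =>
        (fderiv 𝕜 F q).comp (ContinuousLinearMap.inr 𝕜 𝕜 E)) ((s : 𝕜), p) := fun s hs p hp =>
      ((hF s hs p hp).fderiv_right (m := ∞) (by simp)).clm_comp contDiffAt_const
    refine (ih h2 fun hp => hasFDerivAt_integral_unit hU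
      (fun s hs p hp => (h2 s hs p hp).of_le (by exact_mod_cast le_top)) hp).congr fun p hp => ?_
    exact (hd hp).fderiv

/-- The integral over the unit interval of a smooth function is smooth in the parameters. -/
theorem contDiffOn_integral_unit {G : Type u} [NormedAddCommGroup G]
    [NormedSpace 𝕜 G] [NormedSpace ℝ G] [IsScalarTower ℝ 𝕜 G] {F : 𝕜 × E → G} {U : Set E}
    (hU : IsOpen U) (hF : ∀ s ∈ Icc (0 : ℝ) 1, ∀ p ∈ U, ContDiffAt 𝕜 ∞ F ((s : 𝕜), p)) :
    ContDiffOn 𝕜 ∞ (fun q => ∫ s in (0 : ℝ)..1, F ((s : 𝕜), q)) U :=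
  contDiffOn_infty.2 fun n => contDiffOn_integral_unit_nat n hU hF

/-- The derivative of an integral over the unit interval in a given direction. -/
theorem fderiv_integral_unit_apply {G : Type*} [NormedAddCommGroup G] [NormedSpace 𝕜 G]
    [NormedSpace ℝ G] [IsScalarTower ℝ 𝕜 G] [CompleteSpace G] {F : 𝕜 × E → G} {U : Set E}
    (hU : IsOpen U) (hF : ∀ s ∈ Icc (0 : ℝ) 1, ∀ p ∈ U, ContDiffAt 𝕜 1 F ((s : 𝕜), p)) {p : E}
    (hp : p ∈ U) (v : E) : fderiv 𝕜 (fun q => ∫ s in (0 : ℝ)..1, F ((s : 𝕜), q)) p v =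
      ∫ s in (0 : ℝ)..1, fderiv 𝕜 (fun q => F ((s : 𝕜), q)) p v := by
  rw [(hasFDerivAt_integral_unit hU hF hp).fderiv, ContinuousLinearMap.intervalIntegral_apply]
  · refine intervalIntegral.integral_congr fun s hs => ?_
    rw [uIcc_of_le zero_le_one] at hs
    have h1 := ((hF s hs p hp).differentiableAt (by norm_num)).hasFDerivAt
    have h2 := (h1.comp p (hasFDerivAt_prodMk_right (s : 𝕜) p)).fderiv
    exact (congrArg (fun T : E →L[𝕜] G => T v) h2).symm
  · refine ContinuousOn.intervalIntegrable_of_Icc zero_le_one fun s hs => ?_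
    have h1 : ContinuousAt (fderiv 𝕜 F) ((s : 𝕜), p) :=
      ((hF s hs p hp).fderiv_right (m := 0) (by norm_num)).continuousAt
    have h2 : ContinuousAt (fun s : ℝ => fderiv 𝕜 F ((s : 𝕜), p)) s :=
      h1.comp (f := fun s : ℝ => ((s : 𝕜), p))
        ((RCLike.continuous_ofReal.prodMk continuous_const).continuousAt)
    exact (h2.clm_comp continuousAt_const).continuousWithinAt

end Parametric

/-! ### Power series along the segment from `0` to an operator -/

section OpEvalIntegral

open Set Metric MeasureTheory

variable {𝕜 : Type*} [RCLike 𝕜] {L : Type*} [NormedLieRing L] [NormedLieAlgebra 𝕜 L]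
  [FiniteDimensional 𝕜 L]

/-- The weighted integral `∫₀¹ sᵏ f(s T) ds` is the series `avg k f` at `T`. -/
theorem Convergent.integral_opEval [NormedSpace ℝ L] [IsScalarTower ℝ 𝕜 L] {f : 𝕜⟦X⟧}
    (hf : Convergent f) (k : ℕ) : ∀ᶠ T : L →L[𝕜] L in 𝓝 0, ∀ v : L,
      ∫ s in (0 : ℝ)..1, (s : 𝕜) ^ k • opEval f ((s : 𝕜) • T) v =
        opEval (KashiwaraVergne.avg k f) T v := by
  have := FiniteDimensional.complete 𝕜 L
  obtain ⟨r, hr, hf'⟩ := hf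
  filter_upwards [eventually_norm_le hr, Convergent.hasSum (L := L) (Convergent.avg ⟨r, hr, hf'⟩ k)]
    with T hT hsum v
  have hterm (n : ℕ) (s : ℝ) (hs : s ∈ Icc (0 : ℝ) 1) :
      ‖(s : 𝕜) ^ k • (PowerSeries.coeff n f • ((s : 𝕜) • T) ^ n) v‖ ≤
        ‖PowerSeries.coeff n f‖ * r ^ n * ‖v‖ := by
    have h1 : ‖(s : 𝕜)‖ ≤ 1 := by
      rw [RCLike.norm_ofReal, abs_of_nonneg hs.1]; exact hs.2
    have h2 : ‖(s : 𝕜) • T‖ ≤ r := by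
      rw [norm_smul]
      exact (mul_le_of_le_one_left (norm_nonneg _) h1).trans hT
    rw [norm_smul, norm_pow]
    refine (mul_le_of_le_one_left (norm_nonneg _) (pow_le_one₀ (norm_nonneg _) h1)).trans ?_
    exact (ContinuousLinearMap.le_opNorm _ _).trans
      (mul_le_mul_of_nonneg_right (norm_coeff_smul_pow_le f h2 n) (norm_nonneg _))
  have hIoc {s : ℝ} (hs : s ∈ uIoc (0 : ℝ) 1) : s ∈ Icc (0 : ℝ) 1 := by
    rw [uIoc_of_le zero_le_one] at hs
    exact Ioc_subset_Icc_self hs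
  have h := intervalIntegral.hasSum_integral_of_dominated_convergence (μ := volume) (a := 0)
    (b := 1) (F := fun n (s : ℝ) => (s : 𝕜) ^ k • (PowerSeries.coeff n f • ((s : 𝕜) • T) ^ n) v)
    (f := fun s : ℝ => (s : 𝕜) ^ k • opEval f ((s : 𝕜) • T) v)
    (fun n _ => ‖PowerSeries.coeff n f‖ * r ^ n * ‖v‖) (fun n => by
      refine Continuous.aestronglyMeasurable ?_
      have : Continuous (fun s : ℝ => (s : 𝕜)) := RCLike.continuous_ofReal
      fun_prop)
    (fun n => Filter.Eventually.of_forall fun s hs => hterm n s (hIoc hs))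
    (Filter.Eventually.of_forall fun s hs => Summable.mul_right _ hf')
    intervalIntegrable_const
    (Filter.Eventually.of_forall fun s hs => by
      have h2 : ‖(s : 𝕜) • T‖ ≤ r := by
        rw [norm_smul, RCLike.norm_ofReal, abs_of_nonneg (hIoc hs).1]
        exact (mul_le_of_le_one_left (norm_nonneg _) (hIoc hs).2).trans hT
      exact ((hasSum_opEval hf' h2).mapL (ContinuousLinearMap.apply 𝕜 L v)).const_smul _)
  have h3 := hsum.mapL (ContinuousLinearMap.apply 𝕜 L v)
  refine (h.congr_fun fun n => ?_).unique h3
  simp only [ContinuousLinearMap.apply_apply, smul_apply, smul_pow]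
  generalize (T ^ n) v = w
  have e (q : ℝ) (w : L) : q • w = (q : 𝕜) • w := by
    rw [← algebraMap_smul 𝕜 q w, RCLike.algebraMap_eq_ofReal]
  have e' (s : ℝ) : (s : 𝕜) ^ k • PowerSeries.coeff n f • (s : 𝕜) ^ n • w =
      (s ^ (n + k)) • (PowerSeries.coeff n f • w) := by
    rw [e, RCLike.ofReal_pow, smul_smul, smul_smul, smul_smul]
    congr 1
    ring
  simp only [e']
  rw [intervalIntegral.integral_smul_const, integral_pow, e, KashiwaraVergne.avg,
    PowerSeries.coeff_mk, smul_smul]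
  congr 1
  push_cast
  simp
  ring

/-- The derivative of a power series in `s T` at `s = 1`. -/
theorem Convergent.hasDerivAt_opEval_smul {f : 𝕜⟦X⟧} (hf : Convergent f) :
    ∀ᶠ T : L →L[𝕜] L in 𝓝 0, HasDerivAt (fun s : 𝕜 => opEval f (s • T))
      (opEval (PowerSeries.X * PowerSeries.derivative 𝕜 f) T) 1 := by
  obtain ⟨r, hr, hf', hfd⟩ := hf.inter (convergent_X.mul hf.derivative)
  filter_upwards [eventually_norm_le (half_pos hr)] with T hT
  have hmem : (1 : 𝕜) ∈ ball (0 : 𝕜) 2 := by simp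
  have h := hasDerivAt_tsum_of_isPreconnected (𝕜 := 𝕜)
    (g := fun n (s : 𝕜) => PowerSeries.coeff n f • (s • T) ^ n)
    (g' := fun n (s : 𝕜) => (PowerSeries.coeff n f * (n * s ^ (n - 1))) • T ^ n)
    (t := ball (0 : 𝕜) 2) (y₀ := 1) (y := 1) hfd isOpen_ball
    (convex_ball (0 : 𝕜) 2).isPreconnected (fun n s _ => ?_) (fun n s hs => ?_) hmem ?_ hmem
  · have e : opEval (PowerSeries.X * PowerSeries.derivative 𝕜 f) T = ∑' n : ℕ,
        (PowerSeries.coeff n f * (n * (1 : 𝕜) ^ (n - 1))) • T ^ n := by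
      refine tsum_congr fun n => ?_
      rcases n with _ | n
      · simp
      · rw [PowerSeries.coeff_succ_X_mul, PowerSeries.coeff_derivative]
        simp
    rw [e]
    exact h
  · simp only [smul_pow, smul_smul]
    have := ((hasDerivAt_pow n s).const_mul (PowerSeries.coeff n f)).smul_const (T ^ n)
    exact this
  · rcases n with _ | n
    · simp
    · rw [PowerSeries.coeff_succ_X_mul, PowerSeries.coeff_derivative, norm_smul]
      rw [mem_ball_zero_iff] at hs
      have h1 : ‖s‖ ^ n ≤ 2 ^ (n + 1) := by
        calc ‖s‖ ^ n ≤ 2 ^ n := by gcongr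
          _ ≤ 2 ^ (n + 1) := by gcongr <;> norm_num
      have h2 : ‖T ^ (n + 1)‖ ≤ (r / 2) ^ (n + 1) := (norm_pow_le_pow T _).trans (by gcongr)
      simp only [norm_mul, norm_pow, Nat.add_sub_cancel, Nat.cast_add, Nat.cast_one]
      calc _ = ‖PowerSeries.coeff (n + 1) f‖ * ‖(n : 𝕜) + 1‖ * (‖s‖ ^ n * ‖T ^ (n + 1)‖) := by ring
        _ ≤ ‖PowerSeries.coeff (n + 1) f‖ * ‖(n : 𝕜) + 1‖ * (2 ^ (n + 1) * (r / 2) ^ (n + 1)) := by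
            gcongr
        _ = _ := by rw [← mul_pow]; congr 2; ring
  · simp only [one_smul]
    exact (hasSum_opEval hf' (hT.trans (by linarith))).summable

end OpEvalIntegral

/-! ### Derivatives of power series in `ad X` -/

section AdjointCalculus

open Set Metric MeasureTheory
open scoped ContDiff

variable {𝕜 : Type*} [RCLike 𝕜] {L : Type*} [NormedLieRing L] [NormedLieAlgebra 𝕜 L]
  [FiniteDimensional 𝕜 L]

theorem adL_apply (x y : L) : adL 𝕜 x y = ⁅x, y⁆ := rfl

theorem adL_self (x : L) : adL 𝕜 x x = 0 := lie_self x

variable (𝕜 L) in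
/-- `X ↦ ad X` as a continuous linear map. -/
def adC : L →L[𝕜] (L →L[𝕜] L) :=
  LinearMap.toContinuousLinearMap
    { toFun := adL 𝕜
      map_add' := fun x y => by ext z; exact add_lie x y z
      map_smul' := fun c x => by ext z; exact smul_lie c x z }

theorem adC_apply (x : L) : adC 𝕜 L x = adL 𝕜 x := rfl

theorem adL_smul (c : 𝕜) (x : L) : adL 𝕜 (c • x) = c • adL 𝕜 x := (adC 𝕜 L).map_smul c x

theorem adL_zero : adL 𝕜 (0 : L) = 0 := (adC 𝕜 L).map_zero

theorem continuous_adL : Continuous (adL 𝕜 : L → L →L[𝕜] L) := (adC 𝕜 L).continuous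

theorem contDiff_adL : ContDiff 𝕜 ∞ (adL 𝕜 : L → L →L[𝕜] L) := (adC 𝕜 L).contDiff

theorem hasFDerivAt_adL (x : L) : HasFDerivAt (adL 𝕜 : L → L →L[𝕜] L) (adC 𝕜 L) x :=
  (adC 𝕜 L).hasFDerivAt

/-- A property of operators near `0` holds for `ad X`, `X` near `0`. -/
theorem eventually_adL {P : (L →L[𝕜] L) → Prop} (h : ∀ᶠ T in 𝓝 0, P T) :
    ∀ᶠ x : L in 𝓝 0, P (adL 𝕜 x) := by
  have : Filter.Tendsto (adL 𝕜 : L → L →L[𝕜] L) (𝓝 0) (𝓝 0) := by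
    simpa [adL_zero] using continuous_adL (𝕜 := 𝕜) (L := L).tendsto 0
  exact this.eventually h

/-- If `S x = 0` then `f(S) x = f(0) x`. -/
theorem Convergent.opEval_apply_of_eq_zero {f : 𝕜⟦X⟧} (hf : Convergent f) :
    ∀ᶠ S : L →L[𝕜] L in 𝓝 0, ∀ x, S x = 0 → opEval f S x = PowerSeries.coeff 0 f • x := by
  filter_upwards [hf.opEval_eq_shift (L := L)] with S hS x hx
  rw [hS]
  simp [hx]

/-- If `W(y₀) x = 0`, the derivative of `f(W(y)) x` at `y₀` is `h(W(y₀))` applied to the derivative of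
`W(y) x`, where `h(t) = (f(t) - f(0)) / t`: in `f(W) x = f(0) x + h(W) (W x)` the last factor vanishes
at `y₀`. -/
theorem Convergent.hasFDerivAt_opEval_apply {E : Type*} [NormedAddCommGroup E] [NormedSpace 𝕜 E]
    {f : 𝕜⟦X⟧} (hf : Convergent f) : ∀ᶠ S : L →L[𝕜] L in 𝓝 0,
      ∀ (W : E → L →L[𝕜] L) (W' : E →L[𝕜] L →L[𝕜] L) (y : E) (x : L), W y = S →
        HasFDerivAt W W' y → S x = 0 → HasFDerivAt (fun z => opEval f (W z) x)
          ((opEval (KashiwaraVergne.shift f) S).comp (W'.flip x)) y := by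
  filter_upwards [(hf.opEval_eq_shift (L := L)).eventually_nhds, hf.shift.analyticAt (L := L)]
    with S h1 h2 W W' y x hWS hW hx
  subst hWS
  have h3 : HasFDerivAt (fun z => W z x) (W'.flip x) y := by
    have := hW.clm_apply (hasFDerivAt_const x y)
    simpa using this
  obtain ⟨D, hD⟩ := h2.differentiableAt
  have h4 := ((hD.comp y hW).clm_apply h3).const_add (PowerSeries.coeff 0 f • x)
  have h5 : (fun z => opEval f (W z) x) =ᶠ[𝓝 y] fun z => PowerSeries.coeff 0 f • x +
      (opEval (KashiwaraVergne.shift f) ∘ W) z (W z x) := by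
    filter_upwards [hW.continuousAt.eventually h1] with z hz
    rw [hz]
    simp
  refine (h4.congr_of_eventuallyEq h5).congr_fderiv ?_
  ext v
  simp [hx]

/-- The product of a differentiable family of operators and a function that vanishes at `y`. -/
theorem hasFDerivAt_clm_apply_of_eq_zero {E F G : Type*} [NormedAddCommGroup E] [NormedSpace 𝕜 E]
    [NormedAddCommGroup F] [NormedSpace 𝕜 F] [NormedAddCommGroup G] [NormedSpace 𝕜 G]
    {C : E → F →L[𝕜] G} {v : E → F} {v' : E →L[𝕜] F} {y : E} (hC : DifferentiableAt 𝕜 C y)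
    (hv : HasFDerivAt v v' y) (h0 : v y = 0) :
    HasFDerivAt (fun z => C z (v z)) ((C y).comp v') y := by
  refine (hC.hasFDerivAt.clm_apply hv).congr_fderiv ?_
  ext u
  simp [h0]

theorem exp_mul_exp_sub_one_hasFDerivAt (S : L →L[𝕜] L) :
    HasFDerivAt (fun y : L => NormedSpace.exp S * NormedSpace.exp (adL 𝕜 y) - 1)
      ((ContinuousLinearMap.mul 𝕜 (L →L[𝕜] L) (NormedSpace.exp S)).comp (adC 𝕜 L)) 0 := by
  have h0 : HasFDerivAt (NormedSpace.exp : (L →L[𝕜] L) → L →L[𝕜] L)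
      (1 : (L →L[𝕜] L) →L[𝕜] (L →L[𝕜] L)) (adL 𝕜 (0 : L)) := by
    rw [adL_zero]
    exact hasFDerivAt_exp_zero
  have h1 := h0.comp (0 : L) (hasFDerivAt_adL (𝕜 := 𝕜) (0 : L))
  have h2 := (ContinuousLinearMap.mul 𝕜 (L →L[𝕜] L) (NormedSpace.exp S)).hasFDerivAt.comp 0 h1
  exact (h2.sub_const 1).congr_fderiv (by ext; simp)

theorem exp_sub_one_eq_opEval (S : L →L[𝕜] L) :
    NormedSpace.exp S - 1 = opEval (PowerSeries.exp 𝕜 - 1) S := by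
  have h1 : Summable fun n => PowerSeries.coeff n (PowerSeries.exp 𝕜) • S ^ n := by
    refine (NormedSpace.expSeries_summable' (𝕂 := 𝕜) S).congr fun n => ?_
    simp [PowerSeries.coeff_exp]
  have h2 : Summable fun n => PowerSeries.coeff n (1 : 𝕜⟦X⟧) • S ^ n :=
    summable_of_ne_finset_zero (s := {0}) fun n hn => by
      rw [PowerSeries.coeff_one, if_neg (by simpa using hn), zero_smul]
  rw [exp_eq_opEval (𝕜 := 𝕜), ← opEval_one (𝕜 := 𝕜) S]
  unfold opEval
  rw [← h1.tsum_sub h2]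
  simp [sub_smul]

theorem tendsto_exp_sub_one :
    Filter.Tendsto (fun S : L →L[𝕜] L => NormedSpace.exp S - 1) (𝓝 0) (𝓝 0) := by
  have h : Continuous fun S : L →L[𝕜] L => NormedSpace.exp S - 1 :=
    (continuous_iff_continuousAt.2 fun S =>
      (NormedSpace.exp_analytic (𝕂 := 𝕜) S).continuousAt).sub continuous_const
  simpa using h.tendsto 0

/-- `log W / (W - 1) = φ₁(S)` for `W = e ^ S`. -/
theorem opEval_logQuot_exp : ∀ᶠ S : L →L[𝕜] L in 𝓝 0,
    opEval (logQuot 𝕜) (NormedSpace.exp S - 1) = opEval (phi 𝕜) S := by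
  filter_upwards [(convergent_logQuot 𝕜).opEval_subst ((convergent_exp 𝕜).sub convergent_one)
    (by simp) (L := L)] with S hS
  rw [← logQuot_subst, hS, exp_sub_one_eq_opEval]

/-- The chain rule for `φ₁(log W)`, in the variable `W = e ^ t`. -/
theorem shift_logQuot_subst_mul_exp :
    (shift (logQuot 𝕜)).subst (PowerSeries.exp 𝕜 - 1) * PowerSeries.exp 𝕜 =
      PowerSeries.evalNegHom (PowerSeries.derivative 𝕜 (phi 𝕜)) := by
  have hs : PowerSeries.HasSubst (PowerSeries.exp 𝕜 - 1) := PowerSeries.HasSubst.exp_sub_one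
  have h := logQuot_subst 𝕜
  have h1 : logQuot 𝕜 = 1 + PowerSeries.X * shift (logQuot 𝕜) := by
    conv_lhs => rw [eq_C_add_X_mul_shift (logQuot 𝕜)]
    simp [logQuot]
  rw [h1, PowerSeries.subst_add hs, PowerSeries.subst_mul hs, PowerSeries.subst_X hs,
    ← PowerSeries.coe_substAlgHom hs, map_one] at h
  rw [PowerSeries.coe_substAlgHom hs] at h
  apply mul_left_cancel₀ (PowerSeries.X_ne_zero (R := 𝕜))
  rw [X_mul_evalNeg_derivative_phi, phiNeg_eq]
  linear_combination (phi 𝕜 * PowerSeries.exp 𝕜) * h -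
    PowerSeries.exp 𝕜 * (shift (logQuot 𝕜)).subst (PowerSeries.exp 𝕜 - 1) * phi_mul_exp_sub_one 𝕜

/-- The derivative in `Y` at `Y = 0` of `φ₁(ad log (exp S exp Y)) X` when `S X = 0`. -/
theorem hasFDerivAt_logQuot_exp_mul_exp : ∀ᶠ S : L →L[𝕜] L in 𝓝 0, ∀ x, S x = 0 →
    HasFDerivAt (fun y : L => opEval (logQuot 𝕜)
        (NormedSpace.exp S * NormedSpace.exp (adL 𝕜 y) - 1) x)
      (-(opEval (PowerSeries.evalNegHom (PowerSeries.derivative 𝕜 (phi 𝕜))) S * adL 𝕜 x)) 0 := by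
  have hc : Convergent ((shift (logQuot 𝕜)).subst (PowerSeries.exp 𝕜 - 1)) :=
    (convergent_logQuot 𝕜).shift.subst ((convergent_exp 𝕜).sub convergent_one) (by simp)
  filter_upwards [tendsto_exp_sub_one.eventually
    ((convergent_logQuot 𝕜).hasFDerivAt_opEval_apply (L := L) (E := L)),
    (convergent_logQuot 𝕜).shift.opEval_subst ((convergent_exp 𝕜).sub convergent_one)
    (by simp) (L := L), hc.opEval_mul (convergent_exp 𝕜) (L := L),
    (convergent_exp 𝕜).opEval_apply_of_eq_zero (L := L)] with S h1 h2 h3 h4 x hx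
  have h5 : (NormedSpace.exp S - 1) x = 0 := by
    rw [exp_eq_opEval (𝕜 := 𝕜), sub_apply, h4 x hx]
    simp
  have h6 := h1 _ _ 0 x (by simp [adL_zero]) (exp_mul_exp_sub_one_hasFDerivAt S) h5
  refine h6.congr_fderiv ?_
  rw [exp_sub_one_eq_opEval, ← h2, ← shift_logQuot_subst_mul_exp, h3, ← exp_eq_opEval]
  ext v
  change opEval ((shift (logQuot 𝕜)).subst (PowerSeries.exp 𝕜 - 1)) S
    (NormedSpace.exp S ⁅v, x⁆) = -(opEval ((shift (logQuot 𝕜)).subst (PowerSeries.exp 𝕜 - 1)) S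
    (NormedSpace.exp S ⁅x, v⁆))
  rw [← lie_skew x v, map_neg, map_neg, neg_neg]

end AdjointCalculus

/-! ### The Campbell-Hausdorff series near the axes -/

section CampbellHausdorff

open Set Metric MeasureTheory
open scoped ContDiff

universe u

variable {𝕜 : Type*} [RCLike 𝕜] {L : Type u} [NormedLieRing L] [NormedLieAlgebra 𝕜 L]
  [FiniteDimensional 𝕜 L]

variable (𝕜 L) in
/-- The map `(X, Y) ↦ log (exp X exp Y)`. -/
abbrev bchMap : L × L → L := fun q => bch 𝕜 q.1 q.2

/-- The integrand `φ₁(ad log (exp (s X) exp Y)) X` of the Campbell-Hausdorff series. -/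
def bchIntegrand (q : 𝕜 × (L × L)) : L :=
  opEval (logQuot 𝕜)
    (NormedSpace.exp (q.1 • adL 𝕜 q.2.1) * NormedSpace.exp (adL 𝕜 q.2.2) - 1) q.2.1

/-- The value of a derivative on the first factor of a product. -/
theorem fderiv_apply_fst {E F G : Type*} [NormedAddCommGroup E] [NormedSpace 𝕜 E]
    [NormedAddCommGroup F] [NormedSpace 𝕜 F] [NormedAddCommGroup G] [NormedSpace 𝕜 G]
    {f : E × F → G} {x : E} {y : F} {g' : E →L[𝕜] G} (hf : DifferentiableAt 𝕜 f (x, y))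
    (hg : HasFDerivAt (fun z => f (z, y)) g' x) (u : E) : fderiv 𝕜 f (x, y) (u, 0) = g' u := by
  have h : HasFDerivAt (fun z => f (z, y)) _ x :=
    HasFDerivAt.comp (g := f) (f := fun z => (z, y)) x hf.hasFDerivAt
      (hasFDerivAt_prodMk_left (𝕜 := 𝕜) x y)
  exact congrArg (fun T : E →L[𝕜] G => T u) (h.unique hg)

/-- The value of a derivative on the second factor of a product. -/
theorem fderiv_apply_snd {E F G : Type*} [NormedAddCommGroup E] [NormedSpace 𝕜 E]
    [NormedAddCommGroup F] [NormedSpace 𝕜 F] [NormedAddCommGroup G] [NormedSpace 𝕜 G]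
    {f : E × F → G} {x : E} {y : F} {g' : F →L[𝕜] G} (hf : DifferentiableAt 𝕜 f (x, y))
    (hg : HasFDerivAt (fun z => f (x, z)) g' y) (u : F) : fderiv 𝕜 f (x, y) (0, u) = g' u := by
  have h : HasFDerivAt (fun z => f (x, z)) _ y :=
    HasFDerivAt.comp (g := f) (f := fun z => (x, z)) y hf.hasFDerivAt
      (hasFDerivAt_prodMk_right (𝕜 := 𝕜) x y)
  exact congrArg (fun T : F →L[𝕜] G => T u) (h.unique hg)

theorem restrictScalars_isScalarTower (𝕜 E : Type*) [RCLike 𝕜] [NormedAddCommGroup E]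
    [NormedSpace 𝕜 E] : letI : NormedSpace ℝ E := NormedSpace.restrictScalars ℝ 𝕜 E
    IsScalarTower ℝ 𝕜 E :=
  letI : NormedSpace ℝ E := NormedSpace.restrictScalars ℝ 𝕜 E
  IsScalarTower.of_algebraMap_smul fun _ _ => rfl

theorem continuous_exp_mul_exp_sub_one : Continuous fun p : L × L =>
    (NormedSpace.exp (adL 𝕜 p.1) * NormedSpace.exp (adL 𝕜 p.2) - 1 : L →L[𝕜] L) := by
  have h : Continuous (NormedSpace.exp : (L →L[𝕜] L) → L →L[𝕜] L) :=
    continuous_iff_continuousAt.2 fun S => (NormedSpace.exp_analytic (𝕂 := 𝕜) S).continuousAt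
  exact ((h.comp (continuous_adL.comp continuous_fst)).mul
    (h.comp (continuous_adL.comp continuous_snd))).sub continuous_const

theorem tendsto_exp_mul_exp_sub_one : Filter.Tendsto (fun p : L × L =>
    (NormedSpace.exp (adL 𝕜 p.1) * NormedSpace.exp (adL 𝕜 p.2) - 1 : L →L[𝕜] L))
    (𝓝 0) (𝓝 0) := by
  simpa [adL_zero] using (continuous_exp_mul_exp_sub_one (𝕜 := 𝕜) (L := L)).tendsto 0

theorem contDiffAt_bchIntegrand : ∃ r > 0, ∀ s : 𝕜, ‖s‖ ≤ 2 →
    ∀ p ∈ ball (0 : L × L) r, ContDiffAt 𝕜 ∞ (bchIntegrand (𝕜 := 𝕜) (L := L)) (s, p) := by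
  obtain ⟨r, hr, h⟩ := Metric.eventually_nhds_iff_ball.1
    ((tendsto_exp_mul_exp_sub_one (𝕜 := 𝕜) (L := L)).eventually
      ((convergent_logQuot 𝕜).analyticAt (L := L)))
  refine ⟨r / 2, by positivity, fun s hs p hp => ?_⟩
  have hp' : (s • p.1, p.2) ∈ ball (0 : L × L) r := by
    rw [mem_ball_zero_iff, Prod.norm_def, max_lt_iff] at hp ⊢
    refine ⟨?_, hp.2.trans (by linarith)⟩
    rw [norm_smul]
    calc ‖s‖ * ‖p.1‖ ≤ 2 * ‖p.1‖ := by gcongr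
      _ < r := by linarith [hp.1]
  have h1 := (h _ hp').contDiffAt (n := ∞)
  have hexp (S : L →L[𝕜] L) : ContDiffAt 𝕜 ∞ (NormedSpace.exp : (L →L[𝕜] L) → L →L[𝕜] L) S :=
    (NormedSpace.exp_analytic (𝕂 := 𝕜) S).contDiffAt
  have hX : ContDiffAt 𝕜 ∞ (fun q : 𝕜 × (L × L) => q.1 • adL 𝕜 q.2.1) (s, p) :=
    contDiffAt_fst.smul (contDiff_adL.contDiffAt.comp _ (contDiffAt_fst.comp _ contDiffAt_snd))
  have hY : ContDiffAt 𝕜 ∞ (fun q : 𝕜 × (L × L) => adL 𝕜 q.2.2) (s, p) :=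
    contDiff_adL.contDiffAt.comp _ (contDiffAt_snd.comp _ contDiffAt_snd)
  have hW : ContDiffAt 𝕜 ∞ (fun q : 𝕜 × (L × L) => NormedSpace.exp (q.1 • adL 𝕜 q.2.1) *
      NormedSpace.exp (adL 𝕜 q.2.2) - 1) (s, p) :=
    (((hexp _).comp _ hX).mul ((hexp _).comp _ hY)).sub contDiffAt_const
  rw [show NormedSpace.exp (adL 𝕜 (s • p.1, p.2).1) = NormedSpace.exp (s • adL 𝕜 p.1) by
    rw [adL_smul]] at h1
  exact (h1.comp (s, p) hW).clm_apply (contDiffAt_fst.comp _ contDiffAt_snd)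

theorem contDiffAt_bchIntegrand_unit : ∃ r > 0, ∀ s ∈ Icc (0 : ℝ) 1,
    ∀ p ∈ ball (0 : L × L) r,
      ContDiffAt 𝕜 ∞ (bchIntegrand (𝕜 := 𝕜) (L := L)) ((s : 𝕜), p) := by
  obtain ⟨r, hr, h⟩ := contDiffAt_bchIntegrand (𝕜 := 𝕜) (L := L)
  refine ⟨r, hr, fun s hs p hp => h s ?_ p hp⟩
  rw [RCLike.norm_ofReal, abs_of_nonneg hs.1]
  linarith [hs.2]

/-- The Campbell-Hausdorff series is smooth near the origin. -/
theorem contDiffAt_bch : ∀ᶠ p : L × L in 𝓝 0, ContDiffAt 𝕜 ∞ (bchMap 𝕜 L) p := by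
  let _ : NormedSpace ℝ L := NormedSpace.restrictScalars ℝ 𝕜 L
  have : IsScalarTower ℝ 𝕜 L := restrictScalars_isScalarTower 𝕜 L
  obtain ⟨r, hr, h⟩ := contDiffAt_bchIntegrand_unit (𝕜 := 𝕜) (L := L)
  have h1 := contDiffOn_integral_unit (isOpen_ball (x := (0 : L × L)) (ε := r)) h
  filter_upwards [ball_mem_nhds (0 : L × L) hr] with p hp
  exact contDiffAt_snd.add (h1.contDiffAt (isOpen_ball.mem_nhds hp))

/-- The derivative of the Campbell-Hausdorff series as an integral. -/
theorem fderiv_bch_apply [NormedSpace ℝ L] [IsScalarTower ℝ 𝕜 L] :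
    ∀ᶠ p : L × L in 𝓝 0, ∀ v : L × L, fderiv 𝕜 (bchMap 𝕜 L) p v =
      v.2 + ∫ s in (0 : ℝ)..1, fderiv 𝕜 (fun q => bchIntegrand ((s : 𝕜), q)) p v := by
  have := FiniteDimensional.complete 𝕜 L
  have hinst : ‹NormedSpace ℝ L› = NormedSpace.restrictScalars ℝ 𝕜 L := by
    ext r x
    exact (algebraMap_smul 𝕜 r x).symm
  obtain ⟨r, hr, h⟩ := contDiffAt_bchIntegrand_unit (𝕜 := 𝕜) (L := L)
  have h' : ∀ s ∈ Icc (0 : ℝ) 1, ∀ p ∈ ball (0 : L × L) r,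
      ContDiffAt 𝕜 1 (bchIntegrand (𝕜 := 𝕜) (L := L)) ((s : 𝕜), p) :=
    fun s hs p hp => (h s hs p hp).of_le (by exact_mod_cast le_top)
  filter_upwards [ball_mem_nhds (0 : L × L) hr] with p hp v
  rw [← fderiv_integral_unit_apply isOpen_ball h' hp]
  have h1 := (hasFDerivAt_integral_unit isOpen_ball h' hp)
  have h2 : bchMap 𝕜 L = fun q : L × L => q.2 + ∫ s in (0 : ℝ)..1, bchIntegrand ((s : 𝕜), q) := by
    subst hinst
    rfl
  rw [h2, fderiv_fun_add differentiableAt_snd h1.differentiableAt, fderiv_snd]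
  rfl

theorem bch_zero_left (y : L) : bch 𝕜 0 y = y := by
  simp [bch]

/-- For commuting `X`, `Y` the integrand of the Campbell-Hausdorff series is the constant `X`. -/
theorem bch_of_lie_eq_zero : ∀ᶠ p : L × L in 𝓝 0, ⁅p.1, p.2⁆ = 0 →
    bch 𝕜 p.1 p.2 = p.1 + p.2 := by
  let _ : NormedSpace ℝ L := NormedSpace.restrictScalars ℝ 𝕜 L
  have : IsScalarTower ℝ 𝕜 L := restrictScalars_isScalarTower 𝕜 L
  have := FiniteDimensional.complete 𝕜 L
  obtain ⟨r, hr, h⟩ := Metric.eventually_nhds_iff_ball.1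
    (((tendsto_exp_mul_exp_sub_one (𝕜 := 𝕜) (L := L)).eventually
      ((convergent_logQuot 𝕜).opEval_apply_of_eq_zero (L := L))).and
    ((continuous_fst.tendsto' (0 : L × L) 0 rfl).eventually
        (eventually_adL ((convergent_exp 𝕜).opEval_apply_of_eq_zero (L := L))) |>.and
      ((continuous_snd.tendsto' (0 : L × L) 0 rfl).eventually
        (eventually_adL ((convergent_exp 𝕜).opEval_apply_of_eq_zero (L := L))))))
  filter_upwards [ball_mem_nhds (0 : L × L) hr] with p hp hlie
  have hint : ∀ s ∈ uIcc (0 : ℝ) 1, opEval (logQuot 𝕜)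
      (NormedSpace.exp ((s : 𝕜) • adL 𝕜 p.1) * NormedSpace.exp (adL 𝕜 p.2) - 1) p.1 = p.1 := by
    intro s hs
    rw [uIcc_of_le zero_le_one] at hs
    have hp' : ((s : 𝕜) • p.1, p.2) ∈ ball (0 : L × L) r := by
      rw [mem_ball_zero_iff, Prod.norm_def, max_lt_iff] at hp ⊢
      refine ⟨?_, hp.2⟩
      rw [norm_smul, RCLike.norm_ofReal, abs_of_nonneg hs.1]
      exact (mul_le_of_le_one_left (norm_nonneg _) hs.2).trans_lt hp.1
    obtain ⟨h1, h2, h3⟩ := h _ hp'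
    have e1 : NormedSpace.exp (adL 𝕜 p.2) p.1 = p.1 := by
      rw [exp_eq_opEval (𝕜 := 𝕜), h3 p.1 (by rw [adL_apply, ← lie_skew, hlie, neg_zero])]
      simp
    have e2 : NormedSpace.exp (adL 𝕜 ((s : 𝕜) • p.1)) p.1 = p.1 := by
      rw [exp_eq_opEval (𝕜 := 𝕜), h2 p.1 (by
        rw [adL_smul, smul_apply, adL_self, smul_zero])]
      simp
    rw [← adL_smul, h1 p.1 (by
      rw [sub_apply, mul_apply_eq_comp, e1, e2]
      exact sub_self _)]
    simp [logQuot]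
  rw [bch, intervalIntegral.integral_congr hint]
  simp [add_comm]

theorem bch_zero_right : ∀ᶠ x : L in 𝓝 0, bch 𝕜 x 0 = x := by
  filter_upwards [((continuous_id.prodMk continuous_const).tendsto' (0 : L) ((0 : L), (0 : L))
    rfl).eventually (bch_of_lie_eq_zero (𝕜 := 𝕜) (L := L))] with x hx
  simpa using hx

theorem tendsto_inl : Filter.Tendsto (fun x : L => (x, (0 : L))) (𝓝 0) (𝓝 0) :=
  (continuous_id.prodMk continuous_const).tendsto' _ _ rfl

theorem tendsto_inr : Filter.Tendsto (fun x : L => ((0 : L), x)) (𝓝 0) (𝓝 0) :=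
  (continuous_const.prodMk continuous_id).tendsto' _ _ rfl

/-- The differential of `log (exp X exp Y)` at `(X, 0)` is `(u, v) ↦ u + φ₁(- ad X) v`. -/
theorem fderiv_bch_inl : ∀ᶠ x : L in 𝓝 0, ∀ v : L × L, fderiv 𝕜 (bchMap 𝕜 L) (x, 0) v =
    v.1 + opEval (phiNeg 𝕜) (adL 𝕜 x) v.2 := by
  let _ : NormedSpace ℝ L := NormedSpace.restrictScalars ℝ 𝕜 L
  have : IsScalarTower ℝ 𝕜 L := restrictScalars_isScalarTower 𝕜 L
  obtain ⟨r, hr, h⟩ := contDiffAt_bchIntegrand_unit (𝕜 := 𝕜) (L := L)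
  have hc := (convergent_phi 𝕜).derivative.evalNeg
  filter_upwards [(bch_zero_right (𝕜 := 𝕜) (L := L)).eventually_nhds,
    tendsto_inl.eventually (contDiffAt_bch (𝕜 := 𝕜) (L := L)),
    tendsto_inl.eventually (fderiv_bch_apply (𝕜 := 𝕜) (L := L)),
    eventually_adL (eventually_segment (𝕜 := 𝕜)
      (hasFDerivAt_logQuot_exp_mul_exp (𝕜 := 𝕜) (L := L))),
    eventually_adL (hc.integral_opEval 0 (L := L)),
    eventually_adL ((hc.avg 0).opEval_mul convergent_X (L := L)),
    eventually_adL (convergent_one.opEval_sub (convergent_phi 𝕜).evalNeg (L := L)),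
    tendsto_inl.eventually (ball_mem_nhds (0 : L × L) hr)]
    with x h1 h2 h3 h4 h5 h6 h7 h8 v
  have hd := h2.differentiableAt (by simp)
  have hfst (u : L) : fderiv 𝕜 (bchMap 𝕜 L) (x, 0) (u, 0) = u := by
    have e1 : HasFDerivAt (fun z : L => bch 𝕜 z 0) (ContinuousLinearMap.id 𝕜 L) x :=
      (hasFDerivAt_id x).congr_of_eventuallyEq h1
    exact fderiv_apply_fst hd e1 u
  have hsnd (w : L) : fderiv 𝕜 (bchMap 𝕜 L) (x, 0) (0, w) = opEval (phiNeg 𝕜) (adL 𝕜 x) w := by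
    rw [h3]
    have e1 : ∀ s ∈ uIcc (0 : ℝ) 1, fderiv 𝕜 (fun q => bchIntegrand ((s : 𝕜), q)) (x, 0)
        (0, w) = (s : 𝕜) ^ 0 • opEval (PowerSeries.evalNegHom
          (PowerSeries.derivative 𝕜 (phi 𝕜))) ((s : 𝕜) • adL 𝕜 x) (-(adL 𝕜 x w)) := by
      intro s hs
      rw [uIcc_of_le zero_le_one] at hs
      have f1 := h4 s hs x (by rw [smul_apply, adL_self, smul_zero])
      have f2 : DifferentiableAt 𝕜 (fun q : L × L => bchIntegrand ((s : 𝕜), q)) (x, 0) :=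
        ((h s hs _ h8).differentiableAt (by simp)).comp _
          (hasFDerivAt_prodMk_right (s : 𝕜) ((x, 0) : L × L)).differentiableAt
      have f4 := fderiv_apply_snd f2 f1 w
      rw [pow_zero, one_smul, map_neg]
      exact f4
    rw [intervalIntegral.integral_congr e1, h5, map_neg]
    have e2 := congrArg (fun f => opEval f (adL 𝕜 x) w) (X_mul_avg_evalNeg_derivative_phi 𝕜)
    rw [mul_comm, h6, h7, opEval_one, opEval_X, mul_apply_eq_comp, sub_apply] at e2
    rw [e2]
    simp
  have hv : v = (v.1, 0) + (0, v.2) := by simp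
  conv_lhs => rw [hv, map_add, hfst, hsnd]

/-- The differential of `log (exp X exp Y)` at `(0, Y)` is `(u, v) ↦ φ₁(ad Y) u + v`. -/
theorem fderiv_bch_inr : ∀ᶠ y : L in 𝓝 0, ∀ v : L × L, fderiv 𝕜 (bchMap 𝕜 L) (0, y) v =
    opEval (phi 𝕜) (adL 𝕜 y) v.1 + v.2 := by
  let _ : NormedSpace ℝ L := NormedSpace.restrictScalars ℝ 𝕜 L
  have : IsScalarTower ℝ 𝕜 L := restrictScalars_isScalarTower 𝕜 L
  have := FiniteDimensional.complete 𝕜 L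
  obtain ⟨r, hr, h⟩ := contDiffAt_bchIntegrand_unit (𝕜 := 𝕜) (L := L)
  filter_upwards [tendsto_inr.eventually (contDiffAt_bch (𝕜 := 𝕜) (L := L)),
    tendsto_inr.eventually (fderiv_bch_apply (𝕜 := 𝕜) (L := L)),
    eventually_adL (opEval_logQuot_exp (𝕜 := 𝕜) (L := L)),
    tendsto_inr.eventually (tendsto_exp_mul_exp_sub_one.eventually
      ((convergent_logQuot 𝕜).analyticAt (L := L))),
    tendsto_inr.eventually (ball_mem_nhds (0 : L × L) hr)]
    with y h2 h3 h4 h5 h8 v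
  have hd := h2.differentiableAt (by simp)
  have hsnd (w : L) : fderiv 𝕜 (bchMap 𝕜 L) (0, y) (0, w) = w := by
    have e1 : HasFDerivAt (fun z : L => bch 𝕜 0 z) (ContinuousLinearMap.id 𝕜 L) y := by
      simp only [bch_zero_left]
      exact hasFDerivAt_id y
    exact fderiv_apply_snd hd e1 w
  have hfst (u : L) : fderiv 𝕜 (bchMap 𝕜 L) (0, y) (u, 0) = opEval (phi 𝕜) (adL 𝕜 y) u := by
    rw [h3]
    have e1 : ∀ s ∈ uIcc (0 : ℝ) 1, fderiv 𝕜 (fun q => bchIntegrand ((s : 𝕜), q)) (0, y)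
        (u, 0) = opEval (phi 𝕜) (adL 𝕜 y) u := by
      intro s hs
      rw [uIcc_of_le zero_le_one] at hs
      have f2 : DifferentiableAt 𝕜 (fun q : L × L => bchIntegrand ((s : 𝕜), q)) (0, y) :=
        ((h s hs _ h8).differentiableAt (by simp)).comp _
          (hasFDerivAt_prodMk_right (s : 𝕜) ((0, y) : L × L)).differentiableAt
      have g1 : DifferentiableAt 𝕜 (fun x : L => opEval (logQuot 𝕜)
          (NormedSpace.exp ((s : 𝕜) • adL 𝕜 x) * NormedSpace.exp (adL 𝕜 y) - 1)) 0 := by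
        have i1 : DifferentiableAt 𝕜 (fun x : L =>
            NormedSpace.exp ((s : 𝕜) • adL 𝕜 x) * NormedSpace.exp (adL 𝕜 y) - 1) 0 := by
          have i2 : DifferentiableAt 𝕜 (fun x : L => (s : 𝕜) • adL 𝕜 x) 0 :=
            (hasFDerivAt_adL (𝕜 := 𝕜) (0 : L)).differentiableAt.fun_const_smul _
          have i3 := (NormedSpace.exp_analytic (𝕂 := 𝕜) ((s : 𝕜) • adL 𝕜 (0 : L))).differentiableAt
          exact ((i3.comp (0 : L) i2).mul_const _).sub_const _
        have i4 : AnalyticAt 𝕜 (opEval (logQuot 𝕜)) (NormedSpace.exp ((s : 𝕜) • adL 𝕜 (0 : L)) *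
            NormedSpace.exp (adL 𝕜 y) - 1) := by
          simpa [adL_zero] using h5
        exact i4.differentiableAt.comp (0 : L) i1
      have f1 := hasFDerivAt_clm_apply_of_eq_zero g1 (hasFDerivAt_id (0 : L)) rfl
      have f4 := fderiv_apply_fst f2 f1 u
      rw [← h4]
      refine f4.trans ?_
      simp [adL_zero]
    rw [intervalIntegral.integral_congr e1]
    simp
  have hv : v = (v.1, 0) + (0, v.2) := by simp
  conv_lhs => rw [hv, map_add, hfst, hsnd]

/-- Poincaré's differential equation: the derivative of `log (exp (s X) exp Y)` at `s = 1`. -/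
theorem fderiv_bch_self : ∀ᶠ p : L × L in 𝓝 0, fderiv 𝕜 (bchMap 𝕜 L) p (p.1, 0) =
    opEval (logQuot 𝕜) (NormedSpace.exp (adL 𝕜 p.1) * NormedSpace.exp (adL 𝕜 p.2) - 1) p.1 := by
  let _ : NormedSpace ℝ L := NormedSpace.restrictScalars ℝ 𝕜 L
  have : IsScalarTower ℝ 𝕜 L := restrictScalars_isScalarTower 𝕜 L
  have := FiniteDimensional.complete 𝕜 L
  obtain ⟨r, hr, h⟩ := contDiffAt_bchIntegrand (𝕜 := 𝕜) (L := L)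
  filter_upwards [contDiffAt_bch (𝕜 := 𝕜) (L := L), ball_mem_nhds (0 : L × L) hr] with p h1 h2
  -- the integrand is defined beyond `s = 1`, as the fundamental theorem of calculus at `1` requires
  have hcont (s : ℝ) (hs : |s| ≤ 2) : ContinuousAt (fun s : ℝ => bchIntegrand ((s : 𝕜), p)) s := by
    have := (h (s : 𝕜) (by simpa using hs) p h2).continuousAt
    exact this.comp (f := fun s : ℝ => ((s : 𝕜), p))
      ((RCLike.continuous_ofReal.prodMk continuous_const).continuousAt)
  have hFTC : HasDerivAt (fun τ : ℝ => ∫ s in (0 : ℝ)..τ, bchIntegrand ((s : 𝕜), p))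
      (bchIntegrand (((1 : ℝ) : 𝕜), p)) 1 := by
    refine intervalIntegral.integral_hasDerivAt_right ?_ ?_ (hcont 1 (by norm_num))
    · refine ContinuousOn.intervalIntegrable_of_Icc zero_le_one fun s hs => ?_
      refine (hcont s ?_).continuousWithinAt
      rw [abs_of_nonneg hs.1]
      linarith [hs.2]
    · refine ContinuousAt.stronglyMeasurableAtFilter (s := ball (0 : ℝ) 2) isOpen_ball
        (fun s hs => hcont s ?_) 1 (by simp)
      rw [mem_ball_zero_iff, Real.norm_eq_abs] at hs
      exact hs.le
  -- the substitution `s ↦ τ s`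
  have hscale : (fun τ : ℝ => bch 𝕜 ((τ : 𝕜) • p.1) p.2) =ᶠ[𝓝 1] fun τ : ℝ =>
      p.2 + ∫ s in (0 : ℝ)..τ, bchIntegrand ((s : 𝕜), p) := by
    filter_upwards with τ
    have e := intervalIntegral.smul_integral_comp_mul_right (a := 0) (b := 1)
      (fun s : ℝ => bchIntegrand (𝕜 := 𝕜) ((s : 𝕜), p)) τ
    rw [zero_mul, one_mul] at e
    rw [← e, bch, ← intervalIntegral.integral_smul]
    congr 1
    refine intervalIntegral.integral_congr fun s _ => ?_
    simp only [bchIntegrand, adL_smul, map_smul, smul_smul]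
    push_cast
    rfl
  have h3 := (hFTC.const_add p.2).congr_of_eventuallyEq hscale
  have h4 : HasDerivAt (fun τ : 𝕜 => (τ • p.1, p.2)) ((1 : 𝕜) • p.1, (0 : L)) 1 :=
    ((hasDerivAt_id (1 : 𝕜)).smul_const p.1).prodMk (hasDerivAt_const _ _)
  have h5 : HasDerivAt (fun τ : 𝕜 => bch 𝕜 (τ • p.1) p.2)
      (fderiv 𝕜 (bchMap 𝕜 L) p ((1 : 𝕜) • p.1, 0)) ((1 : ℝ) : 𝕜) := by
    have h6 : HasFDerivAt (bchMap 𝕜 L) (fderiv 𝕜 (bchMap 𝕜 L) p) ((1 : 𝕜) • p.1, p.2) := by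
      rw [one_smul]
      exact (h1.differentiableAt (by simp)).hasFDerivAt
    rw [RCLike.ofReal_one]
    exact h6.comp_hasDerivAt (1 : 𝕜) h4
  have h7 : HasDerivAt (fun τ : ℝ => (τ : 𝕜)) (1 : 𝕜) 1 := by
    simpa using (RCLike.ofRealCLM (K := 𝕜)).hasDerivAt (x := (1 : ℝ))
  have h8 := (h5.scomp (1 : ℝ) h7).unique h3
  rw [one_smul, one_smul] at h8
  rw [h8]
  simp [bchIntegrand]

/-- The mixed second derivative of `log (exp X exp Y)` at `(0, Y)` in the directions `(u, 0)` and
`(0, Y)`. -/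
theorem fderiv_fderiv_bch_inr : ∀ᶠ y : L in 𝓝 0, ∀ u : L,
    fderiv 𝕜 (fderiv 𝕜 (bchMap 𝕜 L)) (0, y) (u, 0) (0, y) =
      opEval (PowerSeries.X * PowerSeries.derivative 𝕜 (phi 𝕜)) (adL 𝕜 y) u := by
  filter_upwards [tendsto_inr.eventually (contDiffAt_bch (𝕜 := 𝕜) (L := L)),
    (fderiv_bch_inr (𝕜 := 𝕜) (L := L)).eventually_nhds,
    eventually_adL ((convergent_phi 𝕜).hasDerivAt_opEval_smul (L := L))] with y h1 h2 h3 u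
  rw [(h1.isSymmSndFDerivAt (by
    rw [minSmoothness_of_isRCLikeNormedField]
    exact WithTop.coe_le_coe.2 (le_top (a := (2 : ℕ∞))))).eq]
  have h4 : DifferentiableAt 𝕜 (fderiv 𝕜 (bchMap 𝕜 L)) (0, y) :=
    (h1.fderiv_right (m := ∞) (by simp)).differentiableAt (by simp)
  -- the derivative along the line `s ↦ (0, s y)`
  have h5 : HasDerivAt (fun s : 𝕜 => ((0 : L), s • y)) (0, (1 : 𝕜) • y) 1 :=
    (hasDerivAt_const _ _).prodMk ((hasDerivAt_id (1 : 𝕜)).smul_const y)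
  have h6 : HasDerivAt (fun s : 𝕜 => fderiv 𝕜 (bchMap 𝕜 L) (0, s • y) (u, 0))
      (fderiv 𝕜 (fderiv 𝕜 (bchMap 𝕜 L)) (0, y) (0, (1 : 𝕜) • y) (u, 0)) 1 := by
    have h7 : HasFDerivAt (fderiv 𝕜 (bchMap 𝕜 L)) (fderiv 𝕜 (fderiv 𝕜 (bchMap 𝕜 L)) (0, y))
        (0, (1 : 𝕜) • y) := by
      rw [one_smul]
      exact h4.hasFDerivAt
    exact (ContinuousLinearMap.apply 𝕜 L ((u, 0) : L × L)).hasFDerivAt.comp_hasDerivAt (1 : 𝕜)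
      (h7.comp_hasDerivAt (1 : 𝕜) h5)
  have h9 : HasDerivAt (fun s : 𝕜 => opEval (phi 𝕜) (s • adL 𝕜 y) u)
      (opEval (PowerSeries.X * PowerSeries.derivative 𝕜 (phi 𝕜)) (adL 𝕜 y) u) 1 := by
    simpa using h3.clm_apply (hasDerivAt_const (1 : 𝕜) u)
  have h10 : (fun s : 𝕜 => fderiv 𝕜 (bchMap 𝕜 L) (0, s • y) (u, 0)) =ᶠ[𝓝 1]
      fun s : 𝕜 => opEval (phi 𝕜) (s • adL 𝕜 y) u := by
    have : Filter.Tendsto (fun s : 𝕜 => s • y) (𝓝 1) (𝓝 y) :=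
      (continuous_id.smul continuous_const).tendsto' _ _ (one_smul 𝕜 y)
    filter_upwards [this.eventually h2] with s hs
    rw [hs, adL_smul]
    simp
  have h11 := h6.unique (h9.congr_of_eventuallyEq h10)
  rwa [one_smul] at h11

end CampbellHausdorff

/-! ### The two-form on a quadratic Lie algebra -/

section TwoForm

open Set Metric MeasureTheory
open scoped ContDiff

universe u

variable {𝕜 : Type*} [RCLike 𝕜] {L : Type u} [NormedLieRing L] [NormedLieAlgebra 𝕜 L]
  [FiniteDimensional 𝕜 L] (κ : QuadraticStructure 𝕜 L)

theorem QuadraticStructure.ext_form {u v : L} (h : ∀ w, κ.form u w = κ.form v w) : u = v :=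
  (κ.form.toDual κ.nondeg).injective (LinearMap.ext h)

/-- The adjoint of an operator with respect to the invariant form. -/
def QuadraticStructure.adjLin (T : L →L[𝕜] L) : L →ₗ[𝕜] L :=
  (κ.form.toDual κ.nondeg).symm.toLinearMap ∘ₗ T.toLinearMap.dualMap ∘ₗ
    (κ.form.toDual κ.nondeg).toLinearMap

theorem QuadraticStructure.form_adjLin (T : L →L[𝕜] L) (v w : L) :
    κ.form (κ.adjLin T v) w = κ.form v (T w) := by
  have h : κ.form.toDual κ.nondeg (κ.adjLin T v) =
      T.toLinearMap.dualMap (κ.form.toDual κ.nondeg v) :=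
    LinearEquiv.apply_symm_apply _ _
  exact congrArg (fun ℓ : Module.Dual 𝕜 L => ℓ w) h

/-- The adjoint as a continuous linear map on operators. -/
def QuadraticStructure.adj : (L →L[𝕜] L) →L[𝕜] (L →L[𝕜] L) :=
  LinearMap.toContinuousLinearMap
    { toFun := fun T => LinearMap.toContinuousLinearMap (κ.adjLin T)
      map_add' := fun S T => by
        ext v
        refine κ.ext_form fun w => ?_
        change κ.form (κ.adjLin (S + T) v) w = κ.form (κ.adjLin S v + κ.adjLin T v) w
        rw [map_add, LinearMap.add_apply, κ.form_adjLin, κ.form_adjLin, κ.form_adjLin, add_apply,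
          map_add]
      map_smul' := fun c T => by
        ext v
        refine κ.ext_form fun w => ?_
        change κ.form (κ.adjLin (c • T) v) w = κ.form (c • κ.adjLin T v) w
        rw [map_smul, LinearMap.smul_apply, κ.form_adjLin, κ.form_adjLin, smul_apply, map_smul] }

theorem QuadraticStructure.form_adj (T : L →L[𝕜] L) (v w : L) :
    κ.form (κ.adj T v) w = κ.form v (T w) :=
  κ.form_adjLin T v w

theorem QuadraticStructure.adj_one : κ.adj 1 = 1 := by
  ext v
  exact κ.ext_form fun w => by rw [κ.form_adj]; rfl

theorem QuadraticStructure.adj_mul (S T : L →L[𝕜] L) : κ.adj (S * T) = κ.adj T * κ.adj S := by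
  ext v
  refine κ.ext_form fun w => ?_
  rw [κ.form_adj, mul_apply_eq_comp, mul_apply_eq_comp, κ.form_adj, κ.form_adj]

theorem QuadraticStructure.adj_adL (x : L) : κ.adj (adL 𝕜 x) = -adL 𝕜 x := by
  ext v
  refine κ.ext_form fun w => ?_
  rw [κ.form_adj, neg_apply, adL_apply, adL_apply, ← κ.invariant, ← lie_skew]

theorem QuadraticStructure.adj_pow (x : L) (n : ℕ) : κ.adj (adL 𝕜 x ^ n) = (-adL 𝕜 x) ^ n := by
  induction n with
  | zero => simp [κ.adj_one]
  | succ n ih => rw [pow_succ, κ.adj_mul, ih, κ.adj_adL, pow_succ']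

/-- The adjoint of `f(ad X)` is `f(- ad X)`. -/
theorem QuadraticStructure.adj_opEval {f : 𝕜⟦X⟧} (hf : Convergent f) : ∀ᶠ x : L in 𝓝 0,
    κ.adj (opEval f (adL 𝕜 x)) = opEval (PowerSeries.evalNegHom f) (adL 𝕜 x) := by
  filter_upwards [eventually_adL (hf.hasSum (L := L)), eventually_adL (hf.evalNeg.hasSum (L := L))]
    with x h1 h2
  refine ((h1.mapL κ.adj).congr_fun fun n => ?_).unique h2
  rw [map_smul, κ.adj_pow, coeff_evalNeg, neg_pow (adL 𝕜 x), mul_comm, mul_smul]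
  rcases n.even_or_odd with h | h <;> simp [h.neg_one_pow]

theorem QuadraticStructure.form_sharp_fst (ℓ : Module.Dual 𝕜 (L × L)) (w : L) :
    κ.form (κ.sharp ℓ).1 w = ℓ (w, 0) := by
  have h : κ.form.toDual κ.nondeg (κ.sharp ℓ).1 = (LinearMap.inl 𝕜 L L).dualMap ℓ :=
    LinearEquiv.apply_symm_apply _ _
  exact congrArg (fun ℓ : Module.Dual 𝕜 L => ℓ w) h

theorem QuadraticStructure.form_sharp_snd (ℓ : Module.Dual 𝕜 (L × L)) (w : L) :
    κ.form (κ.sharp ℓ).2 w = ℓ (0, w) := by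
  have h : κ.form.toDual κ.nondeg (κ.sharp ℓ).2 = (LinearMap.inr 𝕜 L L).dualMap ℓ :=
    LinearEquiv.apply_symm_apply _ _
  exact congrArg (fun ℓ : Module.Dual 𝕜 L => ℓ w) h

variable (𝕜) in
/-- The operator `g(ad Z) dZ` at `p`. -/
def gdZ (p : L × L) : L × L →L[𝕜] L :=
  (opEval (gSeries 𝕜) (adL 𝕜 (bchMap 𝕜 L p))).comp (fderiv 𝕜 (bchMap 𝕜 L) p)

/-- The first component of `u ↦ σ_p(u, ·)` in terms of adjoints. -/
def sigmaFst (p : L × L) : L × L →L[𝕜] L :=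
  (κ.adj ((fderiv 𝕜 (bchMap 𝕜 L) p).comp (ContinuousLinearMap.inl 𝕜 L L))).comp (gdZ 𝕜 p)
    - (opEval (gSeries 𝕜) (adL 𝕜 p.1)).comp (ContinuousLinearMap.fst 𝕜 L L)
    - (1 / 2 : 𝕜) • ((κ.adj (opEval (expQuot 𝕜) (-adL 𝕜 p.1))).comp
      ((opEval (expQuot 𝕜) (adL 𝕜 p.2)).comp (ContinuousLinearMap.snd 𝕜 L L)))

/-- The second component of `u ↦ σ_p(u, ·)` in terms of adjoints. -/
def sigmaSnd (p : L × L) : L × L →L[𝕜] L :=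
  (κ.adj ((fderiv 𝕜 (bchMap 𝕜 L) p).comp (ContinuousLinearMap.inr 𝕜 L L))).comp (gdZ 𝕜 p)
    - (opEval (gSeries 𝕜) (adL 𝕜 p.2)).comp (ContinuousLinearMap.snd 𝕜 L L)
    + (1 / 2 : 𝕜) • ((κ.adj (opEval (expQuot 𝕜) (adL 𝕜 p.2))).comp
      ((opEval (expQuot 𝕜) (-adL 𝕜 p.1)).comp (ContinuousLinearMap.fst 𝕜 L L)))

/-- The operator `u ↦ σ_p(u, ·)` in terms of adjoints. -/
def sigmaC (p : L × L) : L × L →L[𝕜] L × L :=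
  (ContinuousLinearMap.inl 𝕜 L L).comp (sigmaFst κ p) +
    (ContinuousLinearMap.inr 𝕜 L L).comp (sigmaSnd κ p)

theorem sigmaC_fst (p q : L × L) : (sigmaC κ p q).1 =
    κ.adj ((fderiv 𝕜 (bchMap 𝕜 L) p).comp (ContinuousLinearMap.inl 𝕜 L L)) (gdZ 𝕜 p q)
      - opEval (gSeries 𝕜) (adL 𝕜 p.1) q.1
      - (1 / 2 : 𝕜) • κ.adj (opEval (expQuot 𝕜) (-adL 𝕜 p.1))
        (opEval (expQuot 𝕜) (adL 𝕜 p.2) q.2) := by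
  simp [sigmaC, sigmaFst]

theorem sigmaC_snd (p q : L × L) : (sigmaC κ p q).2 =
    κ.adj ((fderiv 𝕜 (bchMap 𝕜 L) p).comp (ContinuousLinearMap.inr 𝕜 L L)) (gdZ 𝕜 p q)
      - opEval (gSeries 𝕜) (adL 𝕜 p.2) q.2
      + (1 / 2 : 𝕜) • κ.adj (opEval (expQuot 𝕜) (adL 𝕜 p.2))
        (opEval (expQuot 𝕜) (-adL 𝕜 p.1) q.1) := by
  simp [sigmaC, sigmaSnd]

theorem sigma_apply (p q r : L × L) : sigma κ p q r =
    κ.form (gdZ 𝕜 p q) (fderiv 𝕜 (bchMap 𝕜 L) p r)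
      - κ.form (opEval (gSeries 𝕜) (adL 𝕜 p.1) q.1) r.1
      - κ.form (opEval (gSeries 𝕜) (adL 𝕜 p.2) q.2) r.2
      + (1 / 2 : 𝕜) * (κ.form (opEval (expQuot 𝕜) (-adL 𝕜 p.1) q.1)
          (opEval (expQuot 𝕜) (adL 𝕜 p.2) r.2)
        - κ.form (opEval (expQuot 𝕜) (adL 𝕜 p.2) q.2)
          (opEval (expQuot 𝕜) (-adL 𝕜 p.1) r.1)) := rfl

theorem sigmaMap_eq (p : L × L) : sigmaMap κ p = (sigmaC κ p).toLinearMap := by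
  refine LinearMap.ext fun q => Prod.ext ?_ ?_
  · refine κ.ext_form fun w => ?_
    change κ.form (κ.sharp (sigma κ p q)).1 w = κ.form (sigmaC κ p q).1 w
    rw [κ.form_sharp_fst, sigmaC_fst, sigma_apply]
    simp only [map_sub, map_smul, LinearMap.sub_apply, LinearMap.smul_apply, κ.form_adj]
    simp
    ring
  · refine κ.ext_form fun w => ?_
    change κ.form (κ.sharp (sigma κ p q)).2 w = κ.form (sigmaC κ p q).2 w
    rw [κ.form_sharp_snd, sigmaC_snd, sigma_apply]
    simp only [map_sub, map_add, map_smul, LinearMap.sub_apply, LinearMap.add_apply,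
      LinearMap.smul_apply, κ.form_adj]
    simp

theorem sigmaMap_apply (p q : L × L) : sigmaMap κ p q = sigmaC κ p q := by
  rw [sigmaMap_eq]; rfl

theorem tendsto_bch : Filter.Tendsto (bchMap 𝕜 L) (𝓝 0) (𝓝 0) := by
  have h := (contDiffAt_bch (𝕜 := 𝕜) (L := L)).self_of_nhds.continuousAt
  have h0 : bchMap 𝕜 L 0 = 0 := bch_zero_left 0
  rw [ContinuousAt, h0] at h
  exact h

theorem tendsto_fst_zero : Filter.Tendsto (Prod.fst : L × L → L) (𝓝 0) (𝓝 0) :=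
  continuous_fst.tendsto' _ _ rfl

theorem tendsto_snd_zero : Filter.Tendsto (Prod.snd : L × L → L) (𝓝 0) (𝓝 0) :=
  continuous_snd.tendsto' _ _ rfl

theorem contDiffAt_gdZ : ∀ᶠ p : L × L in 𝓝 0, ContDiffAt 𝕜 ∞ (gdZ 𝕜 (L := L)) p := by
  filter_upwards [contDiffAt_bch (𝕜 := 𝕜) (L := L), (tendsto_bch (𝕜 := 𝕜) (L := L)).eventually
    (eventually_adL ((convergent_gSeries 𝕜).analyticAt (L := L)))] with p h1 h2
  exact (h2.contDiffAt.comp p (contDiff_adL.contDiffAt.comp p h1)).clm_comp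
    (h1.fderiv_right (by simp))

theorem contDiffAt_sigmaC : ∀ᶠ p : L × L in 𝓝 0, ContDiffAt 𝕜 ∞ (sigmaC κ) p := by
  have hneg : Filter.Tendsto (fun x : L => -x) (𝓝 0) (𝓝 0) :=
    continuous_neg.tendsto' _ _ neg_zero
  filter_upwards [contDiffAt_bch (𝕜 := 𝕜) (L := L), contDiffAt_gdZ (𝕜 := 𝕜) (L := L),
    tendsto_fst_zero.eventually (eventually_adL ((convergent_gSeries 𝕜).analyticAt (L := L))),
    tendsto_snd_zero.eventually (eventually_adL ((convergent_gSeries 𝕜).analyticAt (L := L))),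
    tendsto_fst_zero.eventually (hneg.eventually
      (eventually_adL ((convergent_expQuot 𝕜).analyticAt (L := L)))),
    tendsto_snd_zero.eventually (eventually_adL ((convergent_expQuot 𝕜).analyticAt (L := L)))]
    with p h1 h2 h3 h4 h5 h6
  have hdZ : ContDiffAt 𝕜 ∞ (fderiv 𝕜 (bchMap 𝕜 L)) p := h1.fderiv_right (by simp)
  have hX : ContDiffAt 𝕜 ∞ (fun p : L × L => adL 𝕜 p.1) p :=
    contDiff_adL.contDiffAt.comp p contDiffAt_fst
  have hY : ContDiffAt 𝕜 ∞ (fun p : L × L => adL 𝕜 p.2) p :=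
    contDiff_adL.contDiffAt.comp p contDiffAt_snd
  have e : adL 𝕜 (-p.1) = -adL 𝕜 p.1 := (adC 𝕜 L).map_neg p.1
  rw [e] at h5
  have gX := h3.contDiffAt (n := ∞) |>.comp p hX
  have gY := h4.contDiffAt (n := ∞) |>.comp p hY
  have qX := h5.contDiffAt (n := ∞) |>.comp p hX.neg
  have qY := h6.contDiffAt (n := ∞) |>.comp p hY
  have hadj {F : L × L → L →L[𝕜] L} (hF : ContDiffAt 𝕜 ∞ F p) :
      ContDiffAt 𝕜 ∞ (fun p => κ.adj (F p)) p := κ.adj.contDiff.contDiffAt.comp p hF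
  have hdZ1 : ContDiffAt 𝕜 ∞ (fun p => κ.adj ((fderiv 𝕜 (bchMap 𝕜 L) p).comp
      (ContinuousLinearMap.inl 𝕜 L L))) p := hadj (hdZ.clm_comp contDiffAt_const)
  have hdZ2 : ContDiffAt 𝕜 ∞ (fun p => κ.adj ((fderiv 𝕜 (bchMap 𝕜 L) p).comp
      (ContinuousLinearMap.inr 𝕜 L L))) p := hadj (hdZ.clm_comp contDiffAt_const)
  have i1 : ContDiffAt 𝕜 ∞ (sigmaFst κ) p := by
    have j1 := hdZ1.clm_comp h2
    have j2 := gX.clm_comp (contDiffAt_const (c := ContinuousLinearMap.fst 𝕜 L L))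
    have j3 := qY.clm_comp (contDiffAt_const (c := ContinuousLinearMap.snd 𝕜 L L))
    have j4 := ((hadj qX).clm_comp j3).const_smul (1 / 2 : 𝕜)
    exact (j1.sub j2).sub j4
  have i2 : ContDiffAt 𝕜 ∞ (sigmaSnd κ) p := by
    have j1 := hdZ2.clm_comp h2
    have j2 := gY.clm_comp (contDiffAt_const (c := ContinuousLinearMap.snd 𝕜 L L))
    have j3 := qX.clm_comp (contDiffAt_const (c := ContinuousLinearMap.fst 𝕜 L L))
    have j4 := ((hadj qY).clm_comp j3).const_smul (1 / 2 : 𝕜)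
    exact (j1.sub j2).add j4
  have j1 := (contDiffAt_const (c := ContinuousLinearMap.inl 𝕜 L L)).clm_comp i1
  have j2 := (contDiffAt_const (c := ContinuousLinearMap.inr 𝕜 L L)).clm_comp i2
  exact j1.add j2

end TwoForm

/-! ### First-order expansion of `σ_p(p, ·)` -/

section FirstOrder

open Set Metric MeasureTheory
open scoped ContDiff

universe u

variable {𝕜 : Type*} [RCLike 𝕜] {L : Type u} [NormedLieRing L] [NormedLieAlgebra 𝕜 L]
  [FiniteDimensional 𝕜 L] (κ : QuadraticStructure 𝕜 L)

variable (𝕜) in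
/-- The coefficient of `v` in the first component of `σ_{(X, 0)}((u, v), ·)`. -/
def sigmaB : 𝕜⟦X⟧ := gSeries 𝕜 * phiNeg 𝕜 - (1 / 2 : 𝕜) • expQuot 𝕜

variable (𝕜) in
/-- The coefficient of `u` in the second component of `σ_{(X, 0)}((u, v), ·)`. -/
def sigmaA : 𝕜⟦X⟧ := phi 𝕜 * gSeries 𝕜 + (1 / 2 : 𝕜) • PowerSeries.evalNegHom (expQuot 𝕜)

variable (𝕜) in
/-- The coefficient of `v` in the second component of `σ_{(X, 0)}((u, v), ·)`. -/
def sigmaD : 𝕜⟦X⟧ := gSeries 𝕜 * phi 𝕜 * phiNeg 𝕜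

variable (𝕜) in
theorem convergent_sigmaB : Convergent (sigmaB 𝕜) :=
  ((convergent_gSeries 𝕜).mul (convergent_phi 𝕜).evalNeg).sub ((convergent_expQuot 𝕜).smul _)

variable (𝕜) in
theorem convergent_sigmaA : Convergent (sigmaA 𝕜) :=
  ((convergent_phi 𝕜).mul (convergent_gSeries 𝕜)).add ((convergent_expQuot 𝕜).evalNeg.smul _)

variable (𝕜) in
theorem convergent_sigmaD : Convergent (sigmaD 𝕜) :=
  ((convergent_gSeries 𝕜).mul (convergent_phi 𝕜)).mul (convergent_phi 𝕜).evalNeg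

variable (𝕜) in
theorem convergent_gammaAM : Convergent (gammaAM 𝕜) :=
  (((convergent_mSnd 𝕜).sub ((convergent_mSnd 𝕜).avg 1)).add ((convergent_sigmaA 𝕜).mul
    (convergent_X.mul (convergent_betaAM 𝕜)))).sub
    (((convergent_sigmaD 𝕜).mul convergent_X).smul _)

variable (𝕜) in
theorem coeff_zero_expQuot : PowerSeries.coeff 0 (expQuot 𝕜) = 1 := by
  simp [expQuot, PowerSeries.coeff_exp]

variable (𝕜) in
theorem coeff_one_expQuot : PowerSeries.coeff 1 (expQuot 𝕜) = 1 / 2 := (jet_expQuot 𝕜).2.1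

/-- The two-form at `(X, 0)`. -/
theorem sigmaC_inl : ∀ᶠ x : L in 𝓝 0, ∀ q : L × L, sigmaC κ (x, 0) q =
    (opEval (sigmaB 𝕜) (adL 𝕜 x) q.2,
      opEval (sigmaA 𝕜) (adL 𝕜 x) q.1 + opEval (sigmaD 𝕜) (adL 𝕜 x) q.2) := by
  have cg := convergent_gSeries 𝕜
  have cφ := convergent_phi 𝕜
  have cq := convergent_expQuot 𝕜
  filter_upwards [fderiv_bch_inl (𝕜 := 𝕜) (L := L), bch_zero_right (𝕜 := 𝕜) (L := L),
    κ.adj_opEval cq.evalNeg, κ.adj_opEval cφ.evalNeg,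
    eventually_adL ((cg.mul cφ.evalNeg).opEval_sub (cq.smul (1 / 2 : 𝕜)) (L := L)),
    eventually_adL (cg.opEval_mul cφ.evalNeg (L := L)),
    eventually_adL ((cφ.mul cg).opEval_add (cq.evalNeg.smul (1 / 2 : 𝕜)) (L := L)),
    eventually_adL (cφ.opEval_mul cg (L := L)),
    eventually_adL ((cg.mul cφ).opEval_mul cφ.evalNeg (L := L))]
    with x h1 h2 h3 h4 h5 h6 h7 h8 h9 q
  have e1 : (fderiv 𝕜 (bchMap 𝕜 L) (x, 0)).comp (ContinuousLinearMap.inl 𝕜 L L) = 1 := by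
    ext v
    change fderiv 𝕜 (bchMap 𝕜 L) (x, 0) (v, 0) = v
    rw [h1]
    simp
  have e2 : (fderiv 𝕜 (bchMap 𝕜 L) (x, 0)).comp (ContinuousLinearMap.inr 𝕜 L L) =
      opEval (phiNeg 𝕜) (adL 𝕜 x) := by
    ext v
    change fderiv 𝕜 (bchMap 𝕜 L) (x, 0) (0, v) = _
    rw [h1]
    simp
  have e3 : gdZ 𝕜 (x, 0) q = opEval (gSeries 𝕜) (adL 𝕜 x)
      (q.1 + opEval (phiNeg 𝕜) (adL 𝕜 x) q.2) := by
    change opEval (gSeries 𝕜) (adL 𝕜 (bch 𝕜 x 0)) (fderiv 𝕜 (bchMap 𝕜 L) (x, 0) q) = _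
    rw [h2, h1]
  have e4 : gSeries 𝕜 * phi 𝕜 = phi 𝕜 * gSeries 𝕜 := mul_comm _ _
  refine Prod.ext ?_ ?_
  · rw [sigmaC_fst, e1, e3, κ.adj_one]
    simp only [adL_zero, opEval_zero_right, coeff_zero_expQuot, one_smul, one_apply_eq_self]
    rw [← opEval_evalNeg, h3, evalNeg_evalNeg, sigmaB, h5, h6]
    simp [opEval_smul, map_add]
  · rw [sigmaC_snd, e2, e3]
    simp only [adL_zero, opEval_zero_right, coeff_zero_expQuot, coeff_zero_gSeries, one_smul,
      zero_smul, κ.adj_one, one_apply_eq_self, zero_apply]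
    rw [← opEval_evalNeg, h4, evalNeg_evalNeg, sigmaA, h7, sigmaD, h9, e4, h8]
    simp [opEval_smul, map_add]
    abel

/-- The first component of the two-form at `(0, Y)`. -/
theorem sigmaC_inr_fst : ∀ᶠ y : L in 𝓝 0, ∀ q : L × L, (sigmaC κ (0, y) q).1 =
    opEval (sigmaD 𝕜) (adL 𝕜 y) q.1 + opEval (sigmaB 𝕜) (adL 𝕜 y) q.2 := by
  have cg := convergent_gSeries 𝕜
  have cφ := convergent_phi 𝕜
  have cq := convergent_expQuot 𝕜
  filter_upwards [fderiv_bch_inr (𝕜 := 𝕜) (L := L), κ.adj_opEval cφ,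
    eventually_adL ((cg.mul cφ.evalNeg).opEval_sub (cq.smul (1 / 2 : 𝕜)) (L := L)),
    eventually_adL (cφ.evalNeg.opEval_mul cg (L := L)),
    eventually_adL ((cφ.evalNeg.mul cg).opEval_mul cφ (L := L))]
    with y h1 h4 h5 h8 h9 q
  have e1 : (fderiv 𝕜 (bchMap 𝕜 L) (0, y)).comp (ContinuousLinearMap.inl 𝕜 L L) =
      opEval (phi 𝕜) (adL 𝕜 y) := by
    ext v
    change fderiv 𝕜 (bchMap 𝕜 L) (0, y) (v, 0) = _
    rw [h1]
    simp
  have e3 : gdZ 𝕜 (0, y) q = opEval (gSeries 𝕜) (adL 𝕜 y)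
      (opEval (phi 𝕜) (adL 𝕜 y) q.1 + q.2) := by
    change opEval (gSeries 𝕜) (adL 𝕜 (bch 𝕜 0 y)) (fderiv 𝕜 (bchMap 𝕜 L) (0, y) q) = _
    rw [bch_zero_left, h1]
  have e4 : gSeries 𝕜 * phiNeg 𝕜 = phiNeg 𝕜 * gSeries 𝕜 := mul_comm _ _
  have e5 : sigmaD 𝕜 = phiNeg 𝕜 * gSeries 𝕜 * phi 𝕜 := by rw [sigmaD]; ring
  rw [sigmaC_fst, e1, e3, h4]
  simp only [adL_zero, opEval_zero_right, coeff_zero_expQuot, coeff_zero_gSeries, one_smul,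
    zero_smul, κ.adj_one, one_apply_eq_self, zero_apply, neg_zero]
  rw [e5, h9, h8, sigmaB, h5, e4, h8]
  simp [opEval_smul, map_add]
  abel

/-- `σ_p(p, ·)` as a vector. -/
def sigmaSelf (p : L × L) : L × L := sigmaC κ p p

theorem contDiffAt_sigmaSelf : ∀ᶠ p : L × L in 𝓝 0, ContDiffAt 𝕜 ∞ (sigmaSelf κ) p := by
  filter_upwards [contDiffAt_sigmaC κ] with p hp
  exact hp.clm_apply contDiffAt_id

/-- The derivative at `y = 0` of `f(ad y) x`. -/
theorem hasFDerivAt_opEval_adL_zero {f : 𝕜⟦X⟧} (hf : Convergent f) (x : L) :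
    HasFDerivAt (fun y : L => opEval f (adL 𝕜 y) x)
      (-(PowerSeries.coeff 1 f • adL 𝕜 x)) 0 := by
  have h := (hf.hasFDerivAt_opEval_apply (L := L) (E := L)).self_of_nhds (adL 𝕜) (adC 𝕜 L) 0 x
    adL_zero (hasFDerivAt_adL 0) rfl
  refine h.congr_fderiv ?_
  ext w
  simp [opEval_zero_right, shift, adC_apply, adL_apply]
  rw [← lie_skew, smul_neg]

/-- The derivative of `g(ad Z) dZ(X, 0)` in `Y` at `(X, 0)`. -/
theorem hasFDerivAt_gdZ_inl : ∀ᶠ x : L in 𝓝 0, HasFDerivAt (fun y : L => gdZ 𝕜 (x, y) (x, 0))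
    (-(opEval (sigmaD 𝕜) (adL 𝕜 x))) 0 := by
  have cg := convergent_gSeries 𝕜
  have cφ := convergent_phi 𝕜
  filter_upwards [fderiv_bch_inl (𝕜 := 𝕜) (L := L), bch_zero_right (𝕜 := 𝕜) (L := L),
    tendsto_inl.eventually (contDiffAt_bch (𝕜 := 𝕜) (L := L)),
    tendsto_inl.eventually (fderiv_bch_self (𝕜 := 𝕜) (L := L)).eventually_nhds,
    eventually_adL (hasFDerivAt_logQuot_exp_mul_exp (𝕜 := 𝕜) (L := L)),
    eventually_adL (cg.hasFDerivAt_opEval_apply (L := L) (E := L)),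
    eventually_adL (cg.analyticAt (L := L)),
    eventually_adL (cg.shift.opEval_mul convergent_X (L := L)),
    eventually_adL (cφ.derivative.evalNeg.opEval_mul convergent_X (L := L)),
    eventually_adL (cg.opEval_mul cφ.evalNeg (L := L)),
    eventually_adL (cg.opEval_mul (cφ.evalNeg.mul (cφ.sub convergent_one)) (L := L)),
    eventually_adL ((cg.mul cφ.evalNeg).opEval_add
      (cg.mul (cφ.evalNeg.mul (cφ.sub convergent_one))) (L := L))]
    with x h1 h2 h3 h4 h5 h6 h7 h8 h9 h10 h11 h12
  have hx : adL 𝕜 x x = 0 := adL_self x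
  have hZ : HasFDerivAt (fun y : L => bch 𝕜 x y) (opEval (phiNeg 𝕜) (adL 𝕜 x)) 0 := by
    have := (h3.differentiableAt (by simp)).hasFDerivAt.comp (0 : L)
      (hasFDerivAt_prodMk_right (𝕜 := 𝕜) x (0 : L))
    refine this.congr_fderiv ?_
    ext v
    change fderiv 𝕜 (bchMap 𝕜 L) (x, 0) (0, v) = _
    rw [h1]
    simp
  have hadZ : HasFDerivAt (fun y : L => adL 𝕜 (bch 𝕜 x y))
      ((adC 𝕜 L).comp (opEval (phiNeg 𝕜) (adL 𝕜 x))) 0 := (adC 𝕜 L).hasFDerivAt.comp 0 hZ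
  have hu : HasFDerivAt (fun y : L => fderiv 𝕜 (bchMap 𝕜 L) (x, y) (x, 0))
      (-(opEval (PowerSeries.evalNegHom (PowerSeries.derivative 𝕜 (phi 𝕜))) (adL 𝕜 x) *
        adL 𝕜 x)) 0 := by
    refine (h5 x hx).congr_of_eventuallyEq ?_
    have ht : Filter.Tendsto (fun y : L => (x, y)) (𝓝 0) (𝓝 (x, 0)) :=
      (continuous_const.prodMk continuous_id).tendsto' _ _ rfl
    exact ht.eventually h4
  have hgd : DifferentiableAt 𝕜 (fun y : L => opEval (gSeries 𝕜) (adL 𝕜 (bch 𝕜 x y))) 0 := by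
    have h7' : DifferentiableAt 𝕜 (opEval (gSeries 𝕜)) (adL 𝕜 (bch 𝕜 x 0)) := by
      rw [h2]; exact h7.differentiableAt
    exact h7'.comp (0 : L) hadZ.differentiableAt
  have hux : fderiv 𝕜 (bchMap 𝕜 L) (x, 0) (x, 0) = x := by rw [h1]; simp
  have hK := h6 (fun y : L => adL 𝕜 (bch 𝕜 x y)) _ 0 x (by rw [h2]) hadZ hx
  have hprod := hgd.hasFDerivAt.clm_apply hu
  have hK' := hgd.hasFDerivAt.clm_apply (hasFDerivAt_const x (0 : L))
  refine hprod.congr_fderiv ?_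
  have hKK := hK.unique hK'
  ext w
  have e1 := congrArg (fun T : L →L[𝕜] L => T w) hKK
  simp only [ContinuousLinearMap.comp_apply, ContinuousLinearMap.flip_apply,
    zero_add, ContinuousLinearMap.comp_zero] at e1
  have e2 : sigmaD 𝕜 = gSeries 𝕜 * phiNeg 𝕜 +
      gSeries 𝕜 * (phiNeg 𝕜 * (phi 𝕜 - 1)) := by rw [sigmaD]; ring
  have e3 : opEval (gSeries 𝕜) (adL 𝕜 x) =
      opEval (shift (gSeries 𝕜)) (adL 𝕜 x) * adL 𝕜 x := by
    have := X_mul_shift (gSeries 𝕜) (coeff_zero_gSeries 𝕜)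
    conv_lhs => rw [← this, mul_comm, h8, opEval_X]
  have e4 : opEval (phiNeg 𝕜 * (phi 𝕜 - 1)) (adL 𝕜 x) =
      opEval (PowerSeries.evalNegHom (PowerSeries.derivative 𝕜 (phi 𝕜))) (adL 𝕜 x) * adL 𝕜 x := by
    rw [← X_mul_evalNeg_derivative_phi, mul_comm, h9, opEval_X]
  simp only [add_apply, ContinuousLinearMap.comp_apply, ContinuousLinearMap.flip_apply, neg_apply]
  rw [hux, ← e1, h2, e2, h12, h10, h11, e4, e3]
  simp only [add_apply, mul_apply_eq_comp, adC_apply, adL_apply, neg_add, map_neg]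
  rw [← lie_skew x (opEval (phiNeg 𝕜) (adL 𝕜 x) w), map_neg, neg_neg]
  abel

/-- The derivative of `g(ad Z) dZ(0, Y)` in `X` at `(0, Y)`. -/
theorem hasFDerivAt_gdZ_inr : ∀ᶠ y : L in 𝓝 0, HasFDerivAt (fun x : L => gdZ 𝕜 (x, y) (0, y))
    (opEval (gSeries 𝕜 * (PowerSeries.X * PowerSeries.derivative 𝕜 (phi 𝕜)) -
      gSeries 𝕜 * phi 𝕜) (adL 𝕜 y)) 0 := by
  have cg := convergent_gSeries 𝕜
  have cφ := convergent_phi 𝕜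
  have cd := (convergent_X (𝕜 := 𝕜)).mul cφ.derivative
  filter_upwards [fderiv_bch_inr (𝕜 := 𝕜) (L := L),
    tendsto_inr.eventually (contDiffAt_bch (𝕜 := 𝕜) (L := L)),
    fderiv_fderiv_bch_inr (𝕜 := 𝕜) (L := L),
    eventually_adL (cg.hasFDerivAt_opEval_apply (L := L) (E := L)),
    eventually_adL (cg.analyticAt (L := L)),
    eventually_adL (cg.shift.opEval_mul convergent_X (L := L)),
    eventually_adL (cg.opEval_mul cφ (L := L)),
    eventually_adL (cg.opEval_mul cd (L := L)),
    eventually_adL ((cg.mul cd).opEval_sub (cg.mul cφ) (L := L))]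
    with y h1 h3 h5 h6 h7 h8 h10 h11 h12
  have hy : adL 𝕜 y y = 0 := adL_self y
  have hZ : HasFDerivAt (fun x : L => bch 𝕜 x y) (opEval (phi 𝕜) (adL 𝕜 y)) 0 := by
    have := HasFDerivAt.comp (g := bchMap 𝕜 L) (f := fun x : L => (x, y)) (0 : L)
      (h3.differentiableAt (by simp)).hasFDerivAt (hasFDerivAt_prodMk_left (𝕜 := 𝕜) (0 : L) y)
    refine this.congr_fderiv ?_
    ext v
    change fderiv 𝕜 (bchMap 𝕜 L) (0, y) (v, 0) = _
    rw [h1]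
    simp
  have hadZ : HasFDerivAt (fun x : L => adL 𝕜 (bch 𝕜 x y))
      ((adC 𝕜 L).comp (opEval (phi 𝕜) (adL 𝕜 y))) 0 := (adC 𝕜 L).hasFDerivAt.comp 0 hZ
  have hu : HasFDerivAt (fun x : L => fderiv 𝕜 (bchMap 𝕜 L) (x, y) (0, y))
      (opEval (PowerSeries.X * PowerSeries.derivative 𝕜 (phi 𝕜)) (adL 𝕜 y)) 0 := by
    have h4 : DifferentiableAt 𝕜 (fderiv 𝕜 (bchMap 𝕜 L)) (0, y) :=
      (h3.fderiv_right (m := ∞) (by simp)).differentiableAt (by simp)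
    have i1 := HasFDerivAt.comp (g := fderiv 𝕜 (bchMap 𝕜 L)) (f := fun x : L => (x, y)) (0 : L)
      h4.hasFDerivAt (hasFDerivAt_prodMk_left (𝕜 := 𝕜) (0 : L) y)
    have i2 := (ContinuousLinearMap.apply 𝕜 L ((0, y) : L × L)).hasFDerivAt.comp (0 : L) i1
    refine i2.congr_fderiv ?_
    ext u
    exact h5 u
  have hgd : DifferentiableAt 𝕜 (fun x : L => opEval (gSeries 𝕜) (adL 𝕜 (bch 𝕜 x y))) 0 := by
    have h7' : DifferentiableAt 𝕜 (opEval (gSeries 𝕜)) (adL 𝕜 (bch 𝕜 0 y)) := by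
      rw [bch_zero_left]; exact h7.differentiableAt
    exact h7'.comp (0 : L) hadZ.differentiableAt
  have hux : fderiv 𝕜 (bchMap 𝕜 L) (0, y) (0, y) = y := by rw [h1]; simp
  have hK := h6 (fun x : L => adL 𝕜 (bch 𝕜 x y)) _ 0 y (by rw [bch_zero_left]) hadZ hy
  have hprod := hgd.hasFDerivAt.clm_apply hu
  have hK' := hgd.hasFDerivAt.clm_apply (hasFDerivAt_const y (0 : L))
  refine hprod.congr_fderiv ?_
  have hKK := hK.unique hK'
  ext w
  have e1 := congrArg (fun T : L →L[𝕜] L => T w) hKK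
  simp only [ContinuousLinearMap.comp_apply, ContinuousLinearMap.flip_apply,
    zero_add, ContinuousLinearMap.comp_zero] at e1
  have e3 : opEval (gSeries 𝕜) (adL 𝕜 y) =
      opEval (shift (gSeries 𝕜)) (adL 𝕜 y) * adL 𝕜 y := by
    have := X_mul_shift (gSeries 𝕜) (coeff_zero_gSeries 𝕜)
    conv_lhs => rw [← this, mul_comm, h8, opEval_X]
  simp only [add_apply, ContinuousLinearMap.comp_apply, ContinuousLinearMap.flip_apply]
  rw [hux, ← e1, bch_zero_left, h12, h10, h11, e3]
  simp only [sub_apply, mul_apply_eq_comp, adC_apply, adL_apply]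
  rw [← lie_skew y (opEval (phi 𝕜) (adL 𝕜 y) w), map_neg, sub_eq_add_neg, neg_neg]

/-- The derivative of `σ_p(p, ·)` in `Y` at `(X, 0)`. -/
theorem hasFDerivAt_sigmaSelf_inl : ∀ᶠ x : L in 𝓝 0,
    HasFDerivAt (fun y : L => (sigmaSelf κ (x, y)).1) (opEval (mFst 𝕜) (adL 𝕜 x)) 0 ∧
      HasFDerivAt (fun y : L => (sigmaSelf κ (x, y)).2) (opEval (mSnd 𝕜) (adL 𝕜 x)) 0 := by
  have cg := convergent_gSeries 𝕜
  have cφ := convergent_phi 𝕜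
  have cq := convergent_expQuot 𝕜
  filter_upwards [hasFDerivAt_gdZ_inl (𝕜 := 𝕜) (L := L),
    fderiv_bch_inl (𝕜 := 𝕜) (L := L), bch_zero_right (𝕜 := 𝕜) (L := L), sigmaC_inl κ,
    tendsto_inl.eventually (contDiffAt_bch (𝕜 := 𝕜) (L := L)),
    tendsto_inl.eventually (contDiffAt_sigmaC κ), κ.adj_opEval cφ.evalNeg,
    eventually_adL (cg.opEval_apply_of_eq_zero (L := L)),
    eventually_adL (cq.evalNeg.opEval_apply_of_eq_zero (L := L)),
    eventually_adL ((convergent_sigmaB 𝕜).opEval_sub (convergent_sigmaD 𝕜) (L := L)),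
    eventually_adL (cφ.opEval_mul (convergent_sigmaD 𝕜) (L := L)),
    eventually_adL ((convergent_sigmaD 𝕜).opEval_sub (cφ.mul (convergent_sigmaD 𝕜)) (L := L)),
    eventually_adL (((convergent_sigmaD 𝕜).sub (cφ.mul (convergent_sigmaD 𝕜))).opEval_add
      (convergent_X.smul (1 / 4 : 𝕜)) (L := L))]
    with x h1 h2 h3 h4 h5 h6 h7 h8 h9 h10 h11 h12 h13
  have hx : adL 𝕜 x x = 0 := adL_self x
  have hinr : HasFDerivAt (fun y : L => ((0 : L), y)) (ContinuousLinearMap.inr 𝕜 L L) 0 :=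
    (ContinuousLinearMap.inr 𝕜 L L).hasFDerivAt
  have hslice : HasFDerivAt (fun y : L => (x, y)) (ContinuousLinearMap.inr 𝕜 L L) (0 : L) :=
    hasFDerivAt_prodMk_right (𝕜 := 𝕜) x (0 : L)
  -- the part `σ_p((0, Y), ·)`
  have hS : DifferentiableAt 𝕜 (fun y : L => sigmaC κ (x, y)) 0 :=
    (h6.differentiableAt (by simp)).comp (0 : L) hslice.differentiableAt
  have hB := hasFDerivAt_clm_apply_of_eq_zero hS hinr rfl
  -- the part `σ_p((X, 0), ·)`
  have hdZ : DifferentiableAt 𝕜 (fun y : L => fderiv 𝕜 (bchMap 𝕜 L) (x, y)) 0 :=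
    ((h5.fderiv_right (m := ∞) (by simp)).differentiableAt (by simp)).comp (0 : L)
      hslice.differentiableAt
  have hadj (J : L →L[𝕜] L × L) : DifferentiableAt 𝕜 (fun y : L =>
      κ.adj ((fderiv 𝕜 (bchMap 𝕜 L) (x, y)).comp J)) 0 :=
    κ.adj.differentiableAt.comp (0 : L) (hdZ.clm_comp (differentiableAt_const J))
  have hV0 : gdZ 𝕜 (x, 0) (x, 0) = 0 := by
    change opEval (gSeries 𝕜) (adL 𝕜 (bch 𝕜 x 0)) (fderiv 𝕜 (bchMap 𝕜 L) (x, 0) (x, 0)) = 0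
    rw [h3, h2, map_zero, add_zero, h8 x hx, coeff_zero_gSeries, zero_smul]
  have hA1 := hasFDerivAt_clm_apply_of_eq_zero (hadj (ContinuousLinearMap.inl 𝕜 L L)) h1 hV0
  have hA2 := hasFDerivAt_clm_apply_of_eq_zero (hadj (ContinuousLinearMap.inr 𝕜 L L)) h1 hV0
  have e1 : (fderiv 𝕜 (bchMap 𝕜 L) (x, 0)).comp (ContinuousLinearMap.inl 𝕜 L L) = 1 := by
    ext v
    change fderiv 𝕜 (bchMap 𝕜 L) (x, 0) (v, 0) = v
    rw [h2]
    simp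
  have e2 : (fderiv 𝕜 (bchMap 𝕜 L) (x, 0)).comp (ContinuousLinearMap.inr 𝕜 L L) =
      opEval (phiNeg 𝕜) (adL 𝕜 x) := by
    ext v
    change fderiv 𝕜 (bchMap 𝕜 L) (x, 0) (0, v) = _
    rw [h2]
    simp
  have hθ : HasFDerivAt (fun y : L => κ.adj (opEval (expQuot 𝕜) (adL 𝕜 y)) x)
      ((1 / 2 : 𝕜) • adL 𝕜 x) 0 := by
    have i1 := (hasFDerivAt_opEval_adL_zero cq.evalNeg x).congr_of_eventuallyEq
      (f₁ := fun y : L => κ.adj (opEval (expQuot 𝕜) (adL 𝕜 y)) x)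
      ((κ.adj_opEval cq).mono fun y hy => by simp only [hy])
    refine i1.congr_fderiv ?_
    rw [coeff_evalNeg, coeff_one_expQuot]
    simp
  have hsplit (y : L) : sigmaSelf κ (x, y) = sigmaC κ (x, y) (x, 0) + sigmaC κ (x, y) (0, y) := by
    rw [← map_add, sigmaSelf]
    simp
  constructor
  · have hB1 := (ContinuousLinearMap.fst 𝕜 L L).hasFDerivAt.comp (0 : L) hB
    have hsum := (hA1.sub_const (opEval (gSeries 𝕜) (adL 𝕜 x) x)).fun_add hB1
    refine (hsum.congr_of_eventuallyEq (Filter.Eventually.of_forall fun y => ?_)).congr_fderiv ?_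
    · rw [hsplit, Prod.fst_add, sigmaC_fst]
      simp
    · ext w
      have e3 : mFst 𝕜 = sigmaB 𝕜 - sigmaD 𝕜 := by rw [mFst, sigmaB, sigmaD]; ring
      rw [e1, κ.adj_one, e3, h10]
      simp only [add_apply, ContinuousLinearMap.comp_apply, neg_apply, one_apply_eq_self,
        ContinuousLinearMap.inr_apply, ContinuousLinearMap.coe_fst', sub_apply]
      rw [h4]
      abel
  · have hB1 := (ContinuousLinearMap.snd 𝕜 L L).hasFDerivAt.comp (0 : L) hB
    have hsum := (hA2.fun_add (hθ.fun_const_smul (1 / 2 : 𝕜))).fun_add hB1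
    refine (hsum.congr_of_eventuallyEq (Filter.Eventually.of_forall fun y => ?_)).congr_fderiv ?_
    · rw [hsplit, Prod.snd_add, sigmaC_snd, ← opEval_evalNeg]
      simp only
      rw [h9 x hx, coeff_evalNeg, coeff_zero_expQuot]
      simp
    · ext w
      have e3 : mSnd 𝕜 = sigmaD 𝕜 - phi 𝕜 * sigmaD 𝕜 + (1 / 4 : 𝕜) • PowerSeries.X := by
        rw [mSnd, sigmaD]; ring
      rw [e2, h7, evalNeg_evalNeg, e3, h13, h12, h11]
      simp only [add_apply, ContinuousLinearMap.comp_apply, neg_apply, smul_apply,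
        ContinuousLinearMap.inr_apply, ContinuousLinearMap.coe_snd', sub_apply, smul_smul]
      rw [h4, opEval_smul, opEval_X]
      simp only [map_neg, map_zero, zero_add, mul_apply_eq_comp, smul_apply]
      norm_num
      abel

/-- The derivative of the first component of `σ_p(p, ·)` in `X` at `(0, Y)`. -/
theorem hasFDerivAt_sigmaSelf_inr : ∀ᶠ y : L in 𝓝 0,
    HasFDerivAt (fun x : L => (sigmaSelf κ (x, y)).1) (opEval (mV 𝕜) (adL 𝕜 y)) 0 := by
  have cg := convergent_gSeries 𝕜
  have cφ := convergent_phi 𝕜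
  have cq := convergent_expQuot 𝕜
  have cd := (convergent_X (𝕜 := 𝕜)).mul cφ.derivative
  have cV := (cg.mul cd).sub (cg.mul cφ)
  filter_upwards [hasFDerivAt_gdZ_inr (𝕜 := 𝕜) (L := L),
    fderiv_bch_inr (𝕜 := 𝕜) (L := L), sigmaC_inr_fst κ,
    tendsto_inr.eventually (contDiffAt_bch (𝕜 := 𝕜) (L := L)),
    tendsto_inr.eventually (contDiffAt_sigmaC κ), κ.adj_opEval cφ,
    eventually_adL (cg.opEval_apply_of_eq_zero (L := L)),
    eventually_adL (cq.opEval_apply_of_eq_zero (L := L)),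
    eventually_adL (cφ.evalNeg.opEval_mul cV (L := L)),
    eventually_adL ((cφ.evalNeg.mul cV).opEval_add (convergent_sigmaD 𝕜) (L := L)),
    eventually_adL (((cφ.evalNeg.mul cV).add (convergent_sigmaD 𝕜)).opEval_add
      (convergent_X.smul (1 / 4 : 𝕜)) (L := L))]
    with y h1 h2 h4 h5 h6 h7 h8 h9 h11 h12 h13
  have hy : adL 𝕜 y y = 0 := adL_self y
  have hinl : HasFDerivAt (fun x : L => (x, (0 : L))) (ContinuousLinearMap.inl 𝕜 L L) 0 :=
    (ContinuousLinearMap.inl 𝕜 L L).hasFDerivAt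
  have hslice : HasFDerivAt (fun x : L => (x, y)) (ContinuousLinearMap.inl 𝕜 L L) (0 : L) :=
    hasFDerivAt_prodMk_left (𝕜 := 𝕜) (0 : L) y
  have hS : DifferentiableAt 𝕜 (fun x : L => sigmaC κ (x, y)) 0 :=
    DifferentiableAt.comp (g := sigmaC κ) (f := fun x : L => (x, y)) (0 : L)
      (h6.differentiableAt (by simp)) hslice.differentiableAt
  have hB := (ContinuousLinearMap.fst 𝕜 L L).hasFDerivAt.comp (0 : L)
    (hasFDerivAt_clm_apply_of_eq_zero hS hinl rfl)
  have hdZ : DifferentiableAt 𝕜 (fun x : L => fderiv 𝕜 (bchMap 𝕜 L) (x, y)) 0 :=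
    DifferentiableAt.comp (g := fderiv 𝕜 (bchMap 𝕜 L)) (f := fun x : L => (x, y)) (0 : L)
      ((h5.fderiv_right (m := ∞) (by simp)).differentiableAt (by simp)) hslice.differentiableAt
  have hadj : DifferentiableAt 𝕜 (fun x : L =>
      κ.adj ((fderiv 𝕜 (bchMap 𝕜 L) (x, y)).comp (ContinuousLinearMap.inl 𝕜 L L))) 0 :=
    κ.adj.differentiableAt.comp (0 : L) (hdZ.clm_comp (differentiableAt_const _))
  have hV0 : gdZ 𝕜 (0, y) (0, y) = 0 := by
    change opEval (gSeries 𝕜) (adL 𝕜 (bch 𝕜 0 y)) (fderiv 𝕜 (bchMap 𝕜 L) (0, y) (0, y)) = 0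
    rw [bch_zero_left, h2, map_zero, zero_add, h8 y hy, coeff_zero_gSeries, zero_smul]
  have hA1 := hasFDerivAt_clm_apply_of_eq_zero hadj h1 hV0
  have e2 : (fderiv 𝕜 (bchMap 𝕜 L) (0, y)).comp (ContinuousLinearMap.inl 𝕜 L L) =
      opEval (phi 𝕜) (adL 𝕜 y) := by
    ext v
    change fderiv 𝕜 (bchMap 𝕜 L) (0, y) (v, 0) = _
    rw [h2]
    simp
  have hθ : HasFDerivAt (fun x : L => κ.adj (opEval (expQuot 𝕜) (-adL 𝕜 x)) y)
      (-((1 / 2 : 𝕜) • adL 𝕜 y)) 0 := by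
    have i1 := (hasFDerivAt_opEval_adL_zero cq y).congr_of_eventuallyEq
      (f₁ := fun x : L => κ.adj (opEval (expQuot 𝕜) (-adL 𝕜 x)) y)
      ((κ.adj_opEval cq.evalNeg).mono fun x hx => by
        simp only [← opEval_evalNeg, hx, evalNeg_evalNeg])
    refine i1.congr_fderiv ?_
    rw [coeff_one_expQuot]
  have hsplit (x : L) : sigmaSelf κ (x, y) = sigmaC κ (x, y) (0, y) + sigmaC κ (x, y) (x, 0) := by
    rw [← map_add, sigmaSelf]
    simp
  have hsum := (hA1.fun_sub (hθ.fun_const_smul (1 / 2 : 𝕜))).fun_add hB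
  refine (hsum.congr_of_eventuallyEq (Filter.Eventually.of_forall fun x => ?_)).congr_fderiv ?_
  · rw [hsplit, Prod.fst_add, sigmaC_fst]
    simp only
    rw [h9 y hy, coeff_zero_expQuot]
    simp
  · ext w
    have e3 : mV 𝕜 = phiNeg 𝕜 * (gSeries 𝕜 * (PowerSeries.X * PowerSeries.derivative 𝕜 (phi 𝕜)) -
        gSeries 𝕜 * phi 𝕜) + sigmaD 𝕜 + (1 / 4 : 𝕜) • PowerSeries.X := by
      rw [mV, sigmaD]; ring
    rw [e2, h7, e3, h13, h12, h11]
    simp only [add_apply, ContinuousLinearMap.comp_apply, neg_apply, smul_apply,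
      ContinuousLinearMap.inl_apply, ContinuousLinearMap.coe_fst', sub_apply]
    rw [h4, opEval_smul, opEval_X]
    simp only [map_zero, add_zero, mul_apply_eq_comp, smul_apply, smul_neg, smul_smul]
    norm_num
    abel

end FirstOrder

/-! ### The radial primitive -/

section Solutions

open Set Metric MeasureTheory
open scoped ContDiff

universe u

variable {𝕜 : Type*} [RCLike 𝕜] {L : Type u} [NormedLieRing L] [NormedLieAlgebra 𝕜 L]
  [FiniteDimensional 𝕜 L] (κ : QuadraticStructure 𝕜 L)

omit [FiniteDimensional 𝕜 L] in
theorem exists_contDiffAt_segment {F : L × L → L} (hF : ∀ᶠ p in 𝓝 0, ContDiffAt 𝕜 ∞ F p) :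
    ∃ r > 0, ∀ s ∈ Icc (0 : ℝ) 1, ∀ p ∈ ball (0 : L × L) r,
      ContDiffAt 𝕜 ∞ (fun q : 𝕜 × (L × L) => F (q.1 • q.2)) ((s : 𝕜), p) := by
  obtain ⟨r, hr, h⟩ := Metric.eventually_nhds_iff_ball.1 (eventually_segment (𝕜 := 𝕜) hF)
  refine ⟨r, hr, fun s hs p hp => ?_⟩
  exact ContDiffAt.comp (g := F) ((s : 𝕜), p) (h p hp s hs) (contDiffAt_fst.smul contDiffAt_snd)

/-- The average of `F` along the segment from `0` to `p`. -/
def radialAvg [NormedSpace ℝ L] (F : L × L → L) (p : L × L) : L :=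
  ∫ s in (0 : ℝ)..1, F ((s : 𝕜) • p)

theorem contDiffAt_radialAvg [NormedSpace ℝ L] [IsScalarTower ℝ 𝕜 L] {F : L × L → L}
    (hF : ∀ᶠ p in 𝓝 0, ContDiffAt 𝕜 ∞ F p) :
    ∀ᶠ p in 𝓝 0, ContDiffAt 𝕜 ∞ (radialAvg (𝕜 := 𝕜) F) p := by
  obtain ⟨r, hr, h⟩ := exists_contDiffAt_segment hF
  filter_upwards [ball_mem_nhds (0 : L × L) hr] with p hp
  exact (contDiffOn_integral_unit isOpen_ball h).contDiffAt (isOpen_ball.mem_nhds hp)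

/-- Averaging along segments turns the derivative `m(ad X)` in `Y` into `∫₀¹ s m(s ad X) ds`. -/
theorem hasFDerivAt_radialAvg [NormedSpace ℝ L] [IsScalarTower ℝ 𝕜 L] {F : L × L → L}
    (hF : ∀ᶠ p in 𝓝 0, ContDiffAt 𝕜 ∞ F p) {m : 𝕜⟦X⟧} (hm : Convergent m)
    (h : ∀ᶠ x in 𝓝 0, HasFDerivAt (fun y => F (x, y)) (opEval m (adL 𝕜 x)) 0) :
    ∀ᶠ x in 𝓝 0, HasFDerivAt (fun y => radialAvg (𝕜 := 𝕜) F (x, y))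
      (opEval (avg 1 m) (adL 𝕜 x)) 0 := by
  have := FiniteDimensional.complete 𝕜 L
  obtain ⟨r, hr, hr'⟩ := exists_contDiffAt_segment hF
  have hF1 : ∀ s ∈ Icc (0 : ℝ) 1, ∀ p ∈ ball (0 : L × L) r,
      ContDiffAt 𝕜 1 (fun q : 𝕜 × (L × L) => F (q.1 • q.2)) ((s : 𝕜), p) :=
    fun s hs p hp => (hr' s hs p hp).of_le (by exact_mod_cast le_top)
  filter_upwards [tendsto_inl.eventually (ball_mem_nhds (0 : L × L) hr),
    eventually_segment (𝕜 := 𝕜) h, eventually_adL (hm.integral_opEval 1 (L := L)),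
    tendsto_inl.eventually (contDiffAt_radialAvg (𝕜 := 𝕜) hF)] with x h1 h2 h3 h4
  have hd := (h4.differentiableAt (by simp)).hasFDerivAt
  refine (HasFDerivAt.comp (g := radialAvg (𝕜 := 𝕜) F) (f := fun y : L => (x, y)) (0 : L) hd
    (hasFDerivAt_prodMk_right (𝕜 := 𝕜) x (0 : L))).congr_fderiv ?_
  ext w
  change fderiv 𝕜 (radialAvg (𝕜 := 𝕜) F) (x, 0) (0, w) = _
  refine (fderiv_integral_unit_apply isOpen_ball hF1 h1 (0, w)).trans ?_
  rw [← h3]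
  refine intervalIntegral.integral_congr fun s hs => ?_
  rw [uIcc_of_le zero_le_one] at hs
  have e1 : DifferentiableAt 𝕜 (fun q : L × L => F ((s : 𝕜) • q)) (x, 0) :=
    ((hF1 s hs _ h1).differentiableAt (by simp)).comp ((x, 0) : L × L)
      (hasFDerivAt_prodMk_right (s : 𝕜) ((x, 0) : L × L)).differentiableAt
  have e2 : HasFDerivAt (fun y : L => F ((s : 𝕜) • (x, y)))
      ((opEval m (adL 𝕜 ((s : 𝕜) • x))).comp ((s : 𝕜) • ContinuousLinearMap.id 𝕜 L)) 0 := by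
    have i1 : HasFDerivAt (fun y : L => F ((s : 𝕜) • x, y)) (opEval m (adL 𝕜 ((s : 𝕜) • x)))
        ((s : 𝕜) • (0 : L)) := by
      rw [smul_zero]; exact h2 s hs
    have i2 := HasFDerivAt.comp (g := fun y : L => F ((s : 𝕜) • x, y))
      (f := fun y : L => (s : 𝕜) • y) (0 : L) i1 ((hasFDerivAt_id (0 : L)).fun_const_smul (s : 𝕜))
    exact i2
  have e3 := fderiv_apply_snd e1 e2 w
  rw [adL_smul] at e3
  refine e3.trans ?_
  simp only [ContinuousLinearMap.comp_apply, smul_apply, ContinuousLinearMap.id_apply, map_smul,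
    pow_one]

/-- The primitive is the average of `σ_p(p, ·)` along segments. -/
theorem primitive_eq [NormedSpace ℝ L] [IsScalarTower ℝ 𝕜 L] : ∀ᶠ p : L × L in 𝓝 0,
    primitive κ p = (radialAvg (𝕜 := 𝕜) (fun q => (sigmaSelf κ q).1) p,
      radialAvg (𝕜 := 𝕜) (fun q => (sigmaSelf κ q).2) p) := by
  have := FiniteDimensional.complete 𝕜 L
  filter_upwards [eventually_segment (𝕜 := 𝕜) (contDiffAt_sigmaSelf κ)] with p hp
  have hinst : (NormedSpace.restrictScalars ℝ 𝕜 (L × L)) = Prod.normedSpace := by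
    ext r q
    · exact algebraMap_smul 𝕜 r q.1
    · exact algebraMap_smul 𝕜 r q.2
  have h1 : primitive κ p = ∫ s in (0 : ℝ)..1, sigmaSelf κ ((s : 𝕜) • p) := by
    rw [primitive, hinst]
    refine intervalIntegral.integral_congr fun s _ => ?_
    simp only [sigmaMap_apply]
    rw [sigmaSelf, map_smul]
  have hint : IntervalIntegrable (fun s : ℝ => sigmaSelf κ ((s : 𝕜) • p)) volume 0 1 := by
    refine ContinuousOn.intervalIntegrable_of_Icc zero_le_one fun s hs => ?_
    have i1 : ContinuousAt (fun s : ℝ => (s : 𝕜) • p) s :=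
      ((RCLike.continuous_ofReal (K := 𝕜)).smul (continuous_const (y := p))).continuousAt
    exact (ContinuousAt.comp (f := fun s : ℝ => (s : 𝕜) • p) (hp s hs).continuousAt
      i1).continuousWithinAt
  rw [h1]
  exact Prod.ext ((ContinuousLinearMap.fst 𝕜 L L).intervalIntegral_comp_comm hint).symm
    ((ContinuousLinearMap.snd 𝕜 L L).intervalIntegral_comp_comm hint).symm

theorem coeff_zero_mul_of_right (f : 𝕜⟦X⟧) {h : 𝕜⟦X⟧} (h0 : PowerSeries.coeff 0 h = 0) :
    PowerSeries.coeff 0 (f * h) = 0 := by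
  rw [PowerSeries.coeff_mul, Finset.Nat.antidiagonal_zero, Finset.sum_singleton, h0, mul_zero]

theorem sigmaSelf_inl : ∀ᶠ x : L in 𝓝 0, sigmaSelf κ (x, 0) = (0, (1 / 2 : 𝕜) • x) := by
  filter_upwards [sigmaC_inl κ,
    eventually_adL ((convergent_sigmaA 𝕜).opEval_apply_of_eq_zero (L := L))] with x h1 h2
  rw [sigmaSelf, h1]
  simp only [map_zero, add_zero]
  rw [h2 x (adL_self x), sigmaA, map_add, map_smul, coeff_evalNeg, coeff_zero_expQuot,
    coeff_zero_mul_of_right _ (coeff_zero_gSeries 𝕜)]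
  simp

theorem sigmaSelf_inr_fst : ∀ᶠ y : L in 𝓝 0, (sigmaSelf κ (0, y)).1 = -((1 / 2 : 𝕜) • y) := by
  filter_upwards [sigmaC_inr_fst κ,
    eventually_adL ((convergent_sigmaB 𝕜).opEval_apply_of_eq_zero (L := L))] with y h1 h2
  rw [sigmaSelf, h1]
  simp only [map_zero, zero_add]
  rw [h2 y (adL_self y), sigmaB, map_sub, map_smul, coeff_zero_expQuot, mul_comm,
    coeff_zero_mul_of_right _ (coeff_zero_gSeries 𝕜)]
  simp

theorem integral_ofReal_smul [NormedSpace ℝ L] [IsScalarTower ℝ 𝕜 L] (x : L) :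
    ∫ s in (0 : ℝ)..1, (s : 𝕜) • x = (1 / 2 : 𝕜) • x := by
  have := FiniteDimensional.complete 𝕜 L
  have h (s : ℝ) : (s : 𝕜) • x = s • x := algebraMap_smul 𝕜 s x
  simp_rw [h]
  rw [intervalIntegral.integral_smul_const, integral_id, ← h]
  congr 1
  push_cast
  norm_num

theorem primitive_inl : ∀ᶠ x : L in 𝓝 0, primitive κ (x, 0) = (0, (1 / 4 : 𝕜) • x) := by
  let _ : NormedSpace ℝ L := NormedSpace.restrictScalars ℝ 𝕜 L
  have : IsScalarTower ℝ 𝕜 L := restrictScalars_isScalarTower 𝕜 L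
  filter_upwards [tendsto_inl.eventually (primitive_eq κ),
    eventually_segment (𝕜 := 𝕜) (sigmaSelf_inl κ)] with x h1 h2
  have e : ∀ s ∈ uIcc (0 : ℝ) 1, sigmaSelf κ ((s : 𝕜) • (x, 0)) =
      (0, (s : 𝕜) • ((1 / 2 : 𝕜) • x)) := by
    intro s hs
    rw [uIcc_of_le zero_le_one] at hs
    rw [Prod.smul_mk, smul_zero, h2 s hs, smul_comm]
  rw [h1]
  refine Prod.ext ?_ ?_
  · refine (intervalIntegral.integral_congr fun s hs => congrArg Prod.fst (e s hs)).trans ?_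
    simp
  · refine (intervalIntegral.integral_congr fun s hs => congrArg Prod.snd (e s hs)).trans ?_
    simp only
    rw [integral_ofReal_smul, smul_smul]
    norm_num

theorem primitive_inr_fst : ∀ᶠ y : L in 𝓝 0, (primitive κ (0, y)).1 = -((1 / 4 : 𝕜) • y) := by
  let _ : NormedSpace ℝ L := NormedSpace.restrictScalars ℝ 𝕜 L
  have : IsScalarTower ℝ 𝕜 L := restrictScalars_isScalarTower 𝕜 L
  filter_upwards [tendsto_inr.eventually (primitive_eq κ),
    eventually_segment (𝕜 := 𝕜) (sigmaSelf_inr_fst κ)] with y h1 h2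
  have e : ∀ s ∈ uIcc (0 : ℝ) 1, (sigmaSelf κ ((s : 𝕜) • (0, y))).1 =
      (s : 𝕜) • (-((1 / 2 : 𝕜) • y)) := by
    intro s hs
    rw [uIcc_of_le zero_le_one] at hs
    rw [Prod.smul_mk, smul_zero, h2 s hs, smul_neg, smul_comm]
  rw [h1]
  refine (intervalIntegral.integral_congr e).trans ?_
  rw [integral_ofReal_smul, smul_neg, smul_smul]
  norm_num

theorem contDiffAt_primitive : ∀ᶠ p : L × L in 𝓝 0, ContDiffAt 𝕜 ∞ (primitive κ) p := by
  let _ : NormedSpace ℝ L := NormedSpace.restrictScalars ℝ 𝕜 L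
  have : IsScalarTower ℝ 𝕜 L := restrictScalars_isScalarTower 𝕜 L
  have hN := contDiffAt_sigmaSelf κ
  filter_upwards [(primitive_eq κ).eventually_nhds,
    contDiffAt_radialAvg (𝕜 := 𝕜) (hN.mono fun p hp => contDiffAt_fst.comp p hp),
    contDiffAt_radialAvg (𝕜 := 𝕜) (hN.mono fun p hp => contDiffAt_snd.comp p hp)] with p h1 h2 h3
  exact (h2.prodMk h3).congr_of_eventuallyEq h1

/-- The derivative of the primitive in `Y` at `(X, 0)`. -/
theorem hasFDerivAt_primitive_inl : ∀ᶠ x : L in 𝓝 0,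
    HasFDerivAt (fun y : L => primitive κ (x, y))
      ((opEval (avg 1 (mFst 𝕜)) (adL 𝕜 x)).prod (opEval (avg 1 (mSnd 𝕜)) (adL 𝕜 x))) 0 := by
  let _ : NormedSpace ℝ L := NormedSpace.restrictScalars ℝ 𝕜 L
  have : IsScalarTower ℝ 𝕜 L := restrictScalars_isScalarTower 𝕜 L
  have hN := contDiffAt_sigmaSelf κ
  have hd := hasFDerivAt_sigmaSelf_inl κ
  filter_upwards [tendsto_inl.eventually (primitive_eq κ).eventually_nhds,
    hasFDerivAt_radialAvg (hN.mono fun p hp => contDiffAt_fst.comp p hp) (convergent_mFst 𝕜)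
      (hd.mono fun x hx => hx.1),
    hasFDerivAt_radialAvg (hN.mono fun p hp => contDiffAt_snd.comp p hp) (convergent_mSnd 𝕜)
      (hd.mono fun x hx => hx.2)] with x h1 h2 h3
  have ht : Filter.Tendsto (fun y : L => (x, y)) (𝓝 0) (𝓝 (x, 0)) :=
    (continuous_const.prodMk continuous_id).tendsto' _ _ rfl
  exact (h2.prodMk h3).congr_of_eventuallyEq (ht.eventually h1)

/-- The derivative of the first component of the primitive in `X` at `(0, Y)`. -/
theorem hasFDerivAt_primitive_inr : ∀ᶠ y : L in 𝓝 0,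
    HasFDerivAt (fun x : L => (primitive κ (x, y)).1) (opEval (avg 1 (mV 𝕜)) (adL 𝕜 y)) 0 := by
  let _ : NormedSpace ℝ L := NormedSpace.restrictScalars ℝ 𝕜 L
  have : IsScalarTower ℝ 𝕜 L := restrictScalars_isScalarTower 𝕜 L
  have hN := contDiffAt_sigmaSelf κ
  have hswap : Filter.Tendsto (Prod.swap : L × L → L × L) (𝓝 0) (𝓝 0) :=
    continuous_swap.tendsto' _ _ rfl
  have hN' : ∀ᶠ p : L × L in 𝓝 0, ContDiffAt 𝕜 ∞ (fun q => (sigmaSelf κ q.swap).1) p := by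
    filter_upwards [hswap.eventually hN] with p hp
    have i1 : ContDiffAt 𝕜 ∞ (fun q : L × L => q.swap) p :=
      contDiffAt_snd.prodMk contDiffAt_fst
    exact contDiffAt_fst.comp p (ContDiffAt.comp (g := sigmaSelf κ) p hp i1)
  filter_upwards [tendsto_inr.eventually (primitive_eq κ).eventually_nhds,
    hasFDerivAt_radialAvg hN' (convergent_mV 𝕜) (hasFDerivAt_sigmaSelf_inr κ)] with y h1 h2
  have ht : Filter.Tendsto (fun x : L => (x, y)) (𝓝 0) (𝓝 (0, y)) :=
    (continuous_id.prodMk continuous_const).tendsto' _ _ rfl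
  exact h2.congr_of_eventuallyEq ((ht.eventually h1).mono fun x hx => congrArg Prod.fst hx)

/-! ### First-order expansion of the solutions -/

variable (𝕜 L) in
/-- The operator `(u, v) ↦ ([X, u], [Y, v])`, as a continuous linear map depending linearly on
`(X, Y)`. -/
def adPairC : L × L →L[𝕜] (L × L →L[𝕜] L × L) :=
  LinearMap.toContinuousLinearMap
    { toFun := fun p => LinearMap.toContinuousLinearMap (adPair 𝕜 p)
      map_add' := fun p q => by
        ext z <;> simp [adPair]
      map_smul' := fun c p => by
        ext z <;> simp [adPair] }

theorem adPairC_apply (p q : L × L) : adPairC 𝕜 L p q = (⁅p.1, q.1⁆, ⁅p.2, q.2⁆) := rfl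

/-- The operator `1 - σ_p(([X, ·], [Y, ·]), ·)` that defines the solution of Alekseev and
Meinrenken. -/
def moserC (p : L × L) : L × L →L[𝕜] L × L := 1 - sigmaC κ p * adPairC 𝕜 L p

theorem contDiffAt_moserC : ∀ᶠ p : L × L in 𝓝 0, ContDiffAt 𝕜 ∞ (moserC κ) p := by
  filter_upwards [contDiffAt_sigmaC κ] with p hp
  exact contDiffAt_const.sub (hp.clm_comp (adPairC 𝕜 L).contDiff.contDiffAt)

theorem isUnit_moserC : ∀ᶠ p : L × L in 𝓝 0, IsUnit (moserC κ p) := by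
  have := FiniteDimensional.complete 𝕜 (L × L)
  have h0 : moserC κ 0 = 1 := by simp [moserC]
  have hc := (contDiffAt_moserC κ).self_of_nhds.continuousAt
  rw [ContinuousAt, h0] at hc
  exact hc.eventually (Units.isOpen.mem_nhds isUnit_one)

theorem solutionAM_eq : ∀ᶠ p : L × L in 𝓝 0, solutionAM κ p =
    Ring.inverse (moserC κ p) (sigmaSelf κ p - primitive κ p) := by
  filter_upwards [isUnit_moserC κ] with p hp
  have h1 : (1 - sigmaMap κ p * adPair 𝕜 p : Module.End 𝕜 (L × L)) =
      ContinuousLinearMap.toLinearMapRingHom (moserC κ p) := by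
    rw [sigmaMap_eq]; rfl
  rw [solutionAM, h1, sigmaMap_apply]
  obtain ⟨u, hu⟩ := hp
  have h2 : ContinuousLinearMap.toLinearMapRingHom (u : L × L →L[𝕜] L × L) =
    ((Units.map ContinuousLinearMap.toLinearMapRingHom.toMonoidHom u : (Module.End 𝕜 (L × L))ˣ) :
      Module.End 𝕜 (L × L)) := rfl
  rw [← hu, h2, Ring.inverse_unit, Ring.inverse_unit]
  rfl

theorem differentiableAt_solutionAM : ∀ᶠ p : L × L in 𝓝 0,
    DifferentiableAt 𝕜 (solutionAM κ) p := by
  have := FiniteDimensional.complete 𝕜 (L × L)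
  filter_upwards [(solutionAM_eq κ).eventually_nhds, isUnit_moserC κ, contDiffAt_moserC κ,
    contDiffAt_sigmaSelf κ, contDiffAt_primitive κ] with p h1 h2 h3 h4 h5
  have i1 : DifferentiableAt 𝕜 (fun p => Ring.inverse (moserC κ p)) p := by
    obtain ⟨u, hu⟩ := h2
    have i2 : DifferentiableAt 𝕜 (Ring.inverse : (L × L →L[𝕜] L × L) → _) (moserC κ p) := by
      rw [← hu]
      exact (contDiffAt_ringInverse 𝕜 u (n := 1)).differentiableAt (by simp)
    exact i2.comp p (h3.differentiableAt (by simp))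
  exact (i1.clm_apply ((h4.differentiableAt (by simp)).sub
    (h5.differentiableAt (by simp)))).congr_of_eventuallyEq h1

/-- The linear equation characterising the solution of Alekseev and Meinrenken. -/
theorem solutionAM_equation : ∀ᶠ p : L × L in 𝓝 0,
    solutionAM κ p = (sigmaSelf κ p - primitive κ p)
      + sigmaC κ p (⁅p.1, (solutionAM κ p).1⁆, ⁅p.2, (solutionAM κ p).2⁆) := by
  filter_upwards [solutionAM_eq κ, isUnit_moserC κ] with p h1 h2
  have h3 : moserC κ p (solutionAM κ p) = sigmaSelf κ p - primitive κ p := by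
    rw [h1, ← mul_apply_eq_comp, Ring.mul_inverse_cancel _ h2]
    rfl
  rw [← h3, moserC, sub_apply, one_apply_eq_self, mul_apply_eq_comp, adPairC_apply]
  abel

theorem solutionAM_inl : ∀ᶠ x : L in 𝓝 0, solutionAM κ (x, 0) = (0, (1 / 4 : 𝕜) • x) := by
  filter_upwards [tendsto_inl.eventually (solutionAM_eq κ),
    tendsto_inl.eventually (isUnit_moserC κ), sigmaSelf_inl κ, primitive_inl κ]
    with x h1 h2 h3 h4
  have h5 : moserC κ (x, 0) (0, (1 / 4 : 𝕜) • x) = sigmaSelf κ (x, 0) - primitive κ (x, 0) := by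
    rw [moserC, sub_apply, one_apply_eq_self, mul_apply_eq_comp, adPairC_apply, h3, h4]
    simp only [lie_zero, zero_lie, Prod.mk_zero_zero, map_zero, sub_zero]
    rw [Prod.mk_sub_mk, ← sub_smul, sub_zero]
    norm_num
  rw [h1, ← h5, ← mul_apply_eq_comp, Ring.inverse_mul_cancel _ h2]
  rfl

/-- The first-order expansion of the solution of Alekseev and Meinrenken. -/
theorem hasFDerivAt_solutionAM : ∀ᶠ x : L in 𝓝 0,
    HasFDerivAt (fun y : L => solutionAM κ (x, y))
      ((opEval (betaAM 𝕜) (adL 𝕜 x)).prod (opEval (gammaAM 𝕜) (adL 𝕜 x))) 0 := by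
  have c1 := convergent_mFst 𝕜
  have c2 := convergent_mSnd 𝕜
  have cA := convergent_sigmaA 𝕜
  have cB := convergent_sigmaB 𝕜
  have cD := convergent_sigmaD 𝕜
  have cβ := convergent_betaAM 𝕜
  have ct := convergent_X (𝕜 := 𝕜)
  filter_upwards [solutionAM_inl κ,
    tendsto_inl.eventually (differentiableAt_solutionAM κ),
    tendsto_inl.eventually (solutionAM_equation κ).eventually_nhds,
    tendsto_inl.eventually (contDiffAt_sigmaC κ), sigmaC_inl κ,
    hasFDerivAt_sigmaSelf_inl κ, hasFDerivAt_primitive_inl κ,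
    eventually_adL (c1.opEval_sub (c1.avg 1) (L := L)),
    eventually_adL ((c1.sub (c1.avg 1)).opEval_sub ((cB.mul ct).smul (1 / 4 : 𝕜)) (L := L)),
    eventually_adL (cB.opEval_mul ct (L := L)),
    eventually_adL (c2.opEval_sub (c2.avg 1) (L := L)),
    eventually_adL ((c2.sub (c2.avg 1)).opEval_add (cA.mul (ct.mul cβ)) (L := L)),
    eventually_adL (cA.opEval_mul (ct.mul cβ) (L := L)),
    eventually_adL (ct.opEval_mul cβ (L := L)),
    eventually_adL (((c2.sub (c2.avg 1)).add (cA.mul (ct.mul cβ))).opEval_sub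
      ((cD.mul ct).smul (1 / 4 : 𝕜)) (L := L)),
    eventually_adL (cD.opEval_mul ct (L := L))]
    with x h1 h2 h3 h4 h5 h6 h7 k1 k2 k3 k4 k5 k6 k7 k8 k9
  have hslice : HasFDerivAt (fun y : L => (x, y)) (ContinuousLinearMap.inr 𝕜 L L) (0 : L) :=
    hasFDerivAt_prodMk_right (𝕜 := 𝕜) x (0 : L)
  set w : L → L × L := fun y => solutionAM κ (x, y) with hw
  have hwd : DifferentiableAt 𝕜 w 0 := h2.comp (0 : L) hslice.differentiableAt
  set D := fderiv 𝕜 w 0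
  have hD : HasFDerivAt w D 0 := hwd.hasFDerivAt
  have hw0 : w 0 = (0, (1 / 4 : 𝕜) • x) := h1
  have hq : HasFDerivAt (fun y : L => adPairC 𝕜 L (x, y) (w y))
      ((adPairC 𝕜 L (x, 0)).comp D +
        ((adPairC 𝕜 L).comp (ContinuousLinearMap.inr 𝕜 L L)).flip (w 0)) 0 :=
    ((adPairC 𝕜 L).hasFDerivAt.comp (0 : L) hslice).clm_apply hD
  have hS : DifferentiableAt 𝕜 (fun y : L => sigmaC κ (x, y)) 0 :=
    (h4.differentiableAt (by simp)).comp (0 : L) hslice.differentiableAt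
  -- `w(0)` is a multiple of `(0, X)`, so the derivative of `σ` itself does not contribute
  have hq0 : adPairC 𝕜 L (x, 0) (w 0) = 0 := by
    rw [adPairC_apply, hw0]
    simp
  have hSq := hasFDerivAt_clm_apply_of_eq_zero hS hq hq0
  have ht : Filter.Tendsto (fun y : L => (x, y)) (𝓝 0) (𝓝 (x, 0)) :=
    (continuous_const.prodMk continuous_id).tendsto' _ _ rfl
  -- differentiating the linear equation for `w` gives a triangular system for `D`
  have hsum := (((h6.1.prodMk h6.2).sub h7).add hSq).congr_of_eventuallyEq (ht.eventually h3)
  have hDeq := hD.unique hsum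
  have hD1 (v : L) : (D v).1 = opEval (betaAM 𝕜) (adL 𝕜 x) v := by
    have e1 := congrArg (fun T : L →L[𝕜] L × L => (T v).1) hDeq
    have e2 : betaAM 𝕜 = mFst 𝕜 - avg 1 (mFst 𝕜) - (1 / 4 : 𝕜) • (sigmaB 𝕜 * PowerSeries.X) := rfl
    rw [e2, k2, k1, opEval_smul, k3, opEval_X]
    refine e1.trans ?_
    simp only [add_apply, sub_apply, ContinuousLinearMap.comp_apply,
      ContinuousLinearMap.prod_apply, ContinuousLinearMap.flip_apply, adPairC_apply, h5,
      Prod.fst_add, Prod.snd_add, Prod.fst_sub, ContinuousLinearMap.inr_apply, hw0]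
    simp only [zero_lie, zero_add, lie_smul, map_smul, smul_apply, mul_apply_eq_comp, adL_apply]
    rw [← lie_skew v x, map_neg, smul_neg, sub_eq_add_neg _ ((1 / 4 : 𝕜) • _)]
  have hD2 (v : L) : (D v).2 = opEval (gammaAM 𝕜) (adL 𝕜 x) v := by
    have e1 := congrArg (fun T : L →L[𝕜] L × L => (T v).2) hDeq
    have e2 : gammaAM 𝕜 = mSnd 𝕜 - avg 1 (mSnd 𝕜) + sigmaA 𝕜 * (PowerSeries.X * betaAM 𝕜) -
      (1 / 4 : 𝕜) • (sigmaD 𝕜 * PowerSeries.X) := rfl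
    rw [e2, k8, k5, k4, k6, k7, opEval_smul, k9, opEval_X]
    refine e1.trans ?_
    simp only [add_apply, sub_apply, ContinuousLinearMap.comp_apply,
      ContinuousLinearMap.prod_apply, ContinuousLinearMap.flip_apply, adPairC_apply, h5,
      Prod.fst_add, Prod.snd_add, Prod.snd_sub, ContinuousLinearMap.inr_apply, hw0, hD1]
    simp only [zero_lie, zero_add, lie_smul, map_smul, smul_apply, mul_apply_eq_comp, adL_apply,
      lie_zero, add_zero]
    rw [← lie_skew v x, map_neg, smul_neg]
    abel
  refine hD.congr_fderiv ?_
  ext v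
  · exact hD1 v
  · exact hD2 v

/-- `A_AM(X, Y) = β_AM(ad X)(Y) + o(Y)`. -/
theorem hasFirstOrder_solutionAM_fst :
    HasFirstOrder (fun p => (solutionAM κ p).1) (0 : 𝕜) (betaAM 𝕜) := by
  filter_upwards [solutionAM_inl κ, hasFDerivAt_solutionAM κ,
    eventually_adL ((convergent_betaAM 𝕜).hasSum (L := L))] with x h1 h2 h3
  exact ⟨by simp [h1], _, h3, (ContinuousLinearMap.fst 𝕜 L L).hasFDerivAt.comp (0 : L) h2⟩

/-- `B_AM(X, Y) = X / 4 + γ_AM(ad X)(Y) + o(Y)`. -/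
theorem hasFirstOrder_solutionAM_snd :
    HasFirstOrder (fun p => (solutionAM κ p).2) (1 / 4 : 𝕜) (gammaAM 𝕜) := by
  filter_upwards [solutionAM_inl κ, hasFDerivAt_solutionAM κ,
    eventually_adL ((convergent_gammaAM 𝕜).hasSum (L := L))] with x h1 h2 h3
  exact ⟨by simp [h1], _, h3, (ContinuousLinearMap.snd 𝕜 L L).hasFDerivAt.comp (0 : L) h2⟩

/-- `B_V(X, Y) = X / 4 + γ_V(ad X)(Y) + o(Y)`, from the primitive at `(Y, X)`. -/
theorem hasFirstOrder_solutionV_snd :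
    HasFirstOrder (fun p => (solutionV κ p).2) (1 / 4 : 𝕜) (gammaV 𝕜) := by
  have cV := convergent_mV 𝕜
  have ct := convergent_X (𝕜 := 𝕜)
  have cφ := convergent_phi 𝕜
  filter_upwards [primitive_inr_fst κ, hasFDerivAt_primitive_inr κ,
    eventually_adL (((ct.smul (1 / 8 : 𝕜)).sub (cV.avg 1)).hasSum (L := L)),
    eventually_adL ((ct.smul (1 / 8 : 𝕜)).opEval_sub (cV.avg 1) (L := L))] with x h1 h2 h3 h4
  refine ⟨?_, _, h3, ?_⟩
  · simp [solutionV, adL_zero, opEval_zero_right, coeff_zero_phi, h1]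
  have hφ : DifferentiableAt 𝕜 (fun y : L => opEval (phi 𝕜) (adL 𝕜 y)) 0 := by
    have i1 : AnalyticAt 𝕜 (opEval (phi 𝕜)) (adL 𝕜 (0 : L)) := by
      rw [adL_zero]
      exact (cφ.analyticAt (L := L)).self_of_nhds
    exact i1.differentiableAt.comp (0 : L) (hasFDerivAt_adL (0 : L)).differentiableAt
  have hprod := hφ.hasFDerivAt.clm_apply h2.neg
  -- the term of degree one of `φ₁` adds `X / 8` to the series
  have hK := (hφ.hasFDerivAt.clm_apply (hasFDerivAt_const ((1 / 4 : 𝕜) • x) (0 : L))).unique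
    (hasFDerivAt_opEval_adL_zero cφ ((1 / 4 : 𝕜) • x))
  refine hprod.congr_fderiv ?_
  ext v
  have e1 := congrArg (fun T : L →L[𝕜] L => T v) hK
  simp only [ContinuousLinearMap.flip_apply,
    zero_add, ContinuousLinearMap.comp_zero, neg_apply, smul_apply,
    coeff_one_phi, adL_smul] at e1
  have e2 : gammaV 𝕜 = (1 / 8 : 𝕜) • PowerSeries.X - avg 1 (mV 𝕜) := rfl
  rw [h4]
  simp only [add_apply, ContinuousLinearMap.comp_apply, ContinuousLinearMap.flip_apply, neg_apply,
    h1, neg_neg, e1, opEval_smul, opEval_X, smul_apply, sub_apply, adL_zero, opEval_zero_right,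
    coeff_zero_phi, one_smul, one_apply_eq_self, smul_smul, ← neg_smul, Pi.neg_apply]
  norm_num
  abel

end Solutions

/-! ### Universal solutions to first order -/

section Universal

/-- A convergent power series with vector coefficients and sum zero has zero coefficients. -/
theorem hasSum_pow_smul_eq_zero {𝕜 F : Type*} [RCLike 𝕜] [NormedAddCommGroup F] [NormedSpace 𝕜 F]
    {e : ℕ → F} (h : ∀ᶠ s : 𝕜 in 𝓝 0, HasSum (fun n => s ^ n • e n) 0) : e = 0 := by
  let p : FormalMultilinearSeries 𝕜 𝕜 F := fun n => ContinuousMultilinearMap.mkPiRing 𝕜 (Fin n) (e n)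
  have hp (n : ℕ) : p.coeff n = e n := by
    simp [p, FormalMultilinearSeries.coeff]
  have h1 : HasFPowerSeriesAt (fun _ : 𝕜 => (0 : F)) p 0 :=
    hasFPowerSeriesAt_iff.2 (h.mono fun s hs => by simpa only [hp] using hs)
  funext n
  rw [← hp, h1.eq_zero]
  rfl

/-- The derivative of a convergent power series is the sum of the derivatives of its homogeneous
components. -/
theorem HasFPowerSeriesOnBall.hasSum_fderiv {𝕜 E F : Type*} [RCLike 𝕜] [NormedAddCommGroup E]
    [NormedSpace 𝕜 E] [NormedAddCommGroup F] [NormedSpace 𝕜 F] [CompleteSpace F] {f : E → F}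
    {p : FormalMultilinearSeries 𝕜 E F} {r : ENNReal} (hf : HasFPowerSeriesOnBall f p 0 r) {y : E}
    (hy : y ∈ Metric.eball (0 : E) r) :
    HasSum (fun n => fderiv 𝕜 (fun z => p (n + 1) fun _ => z) y) (fderiv 𝕜 f y) := by
  have h1 := hf.fderiv.hasSum hy
  rw [zero_add] at h1
  refine h1.congr_fun fun n => ?_
  -- the homogeneous component as a power series
  let q : FormalMultilinearSeries 𝕜 E F := fun m => if m = n + 1 then p m else 0
  have hq : HasFPowerSeriesOnBall (fun z => p (n + 1) fun _ => z) q 0 ⊤ := by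
    refine ⟨?_, by simp, fun {z} _ => ?_⟩
    · rw [q.radius_eq_top_of_forall_image_add_eq_zero (n + 2) fun m => if_neg (by omega)]
    · rw [zero_add]
      convert hasSum_single (n + 1) fun m hm => ?_ using 1
      · simp [q]
      · simp [q, if_neg hm]
  have h2 := hq.fderiv.hasSum (y := y) (by simp)
  rw [zero_add] at h2
  have h3 := h2.unique (hasSum_single n fun m hm => by
    rw [FormalMultilinearSeries.derivSeries_eq_zero _ (if_neg (by omega))]
    rfl)
  rw [h3]
  have h4 : q.derivSeries n = p.derivSeries n := by
    simp only [FormalMultilinearSeries.derivSeries, FormalMultilinearSeries.changeOriginSeries,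
      FormalMultilinearSeries.changeOriginSeriesTerm,
      ContinuousLinearMap.compFormalMultilinearSeries_apply]
    have h6 : q (1 + n) = p (1 + n) := if_pos (add_comm _ _)
    rw [h6]
  rw [h4]

variable {𝕜 : Type} [RCLike 𝕜]

theorem IsLieWord.one_le {n : ℕ} {u : FreeLieAlgebra 𝕜 (Fin 2)} (h : IsLieWord 𝕜 n u) : 1 ≤ n := by
  induction h with
  | of i => exact le_rfl
  | lie _ _ h1 h2 => omega

theorem IsLieWord.lift_smul {n : ℕ} {u : FreeLieAlgebra 𝕜 (Fin 2)} (h : IsLieWord 𝕜 n u)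
    {L : Type*} [LieRing L] [LieAlgebra 𝕜 L] (r : 𝕜) (x y : L) :
    FreeLieAlgebra.lift 𝕜 ![r • x, r • y] u = r ^ n • FreeLieAlgebra.lift 𝕜 ![x, y] u := by
  induction h with
  | of i =>
    rw [FreeLieAlgebra.lift_of_apply, FreeLieAlgebra.lift_of_apply, pow_one]
    fin_cases i <;> rfl
  | lie _ _ h1 h2 => rw [LieHom.map_lie, LieHom.map_lie, h1, h2, smul_lie, lie_smul, smul_smul,
      pow_add]

/-- The values of a free Lie algebra element to first order in the second variable: it is `d X` at
`(X, 0)`, and its derivative in `Y` there is `c (ad X) ^ (n - 1)`, on every Lie algebra. -/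
def FirstOrderData (n : ℕ) (u : FreeLieAlgebra 𝕜 (Fin 2)) (d c : 𝕜) : Prop :=
  ∀ (L : Type) [NormedLieRing L] [NormedLieAlgebra 𝕜 L] [FiniteDimensional 𝕜 L] (x : L),
    FreeLieAlgebra.lift 𝕜 ![x, 0] u = d • x ∧
      HasFDerivAt (fun y : L => FreeLieAlgebra.lift 𝕜 ![x, y] u) (c • adL 𝕜 x ^ (n - 1)) 0

/-- In a bracket `[u, v]` only the values of the two factors at `(X, 0)`, multiples of `X` in degree
one and `0` otherwise, and their derivatives in `Y` enter. -/
theorem IsLieWord.exists_firstOrderData {n : ℕ} {u : FreeLieAlgebra 𝕜 (Fin 2)}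
    (h : IsLieWord 𝕜 n u) : ∃ d c : 𝕜, (n ≠ 1 → d = 0) ∧ FirstOrderData n u d c := by
  induction h with
  | of i =>
    fin_cases i
    · refine ⟨1, 0, fun h => absurd rfl h, fun L _ _ _ x => ⟨?_, ?_⟩⟩
      · rw [FreeLieAlgebra.lift_of_apply]
        exact (one_smul 𝕜 x).symm
      · simp only [FreeLieAlgebra.lift_of_apply, zero_smul]
        exact hasFDerivAt_const x 0
    · refine ⟨0, 1, fun _ => rfl, fun L _ _ _ x => ⟨?_, ?_⟩⟩
      · rw [FreeLieAlgebra.lift_of_apply]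
        exact (zero_smul 𝕜 x).symm
      · simp only [FreeLieAlgebra.lift_of_apply, one_smul, Nat.sub_self, pow_zero]
        exact hasFDerivAt_id (0 : L)
  | @lie m n u v hu hv ihu ihv =>
    obtain ⟨d₁, c₁, hd₁, h₁⟩ := ihu
    obtain ⟨d₂, c₂, hd₂, h₂⟩ := ihv
    have hm := hu.one_le
    have hn := hv.one_le
    refine ⟨0, d₁ * c₂ - d₂ * c₁, fun _ => rfl, fun L _ _ _ x => ⟨?_, ?_⟩⟩
    · rw [LieHom.map_lie, (h₁ L x).1, (h₂ L x).1, smul_lie, lie_smul, lie_self, smul_zero,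
        smul_zero, zero_smul]
    · simp only [LieHom.map_lie]
      have hU := (adC 𝕜 L).hasFDerivAt.comp (0 : L) (h₁ L x).2
      refine (hU.clm_apply (h₂ L x).2).congr_fderiv ?_
      ext w
      have e1 : d₁ • adL 𝕜 x ((c₂ • adL 𝕜 x ^ (n - 1)) w) =
          (d₁ * c₂) • (adL 𝕜 x ^ (m + n - 1)) w := by
        by_cases hm1 : m = 1
        · rw [hm1, show 1 + n - 1 = (n - 1) + 1 by omega, pow_succ', mul_apply_eq_comp, smul_apply,
            map_smul, smul_smul]
        · rw [hd₁ hm1]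
          simp
      have e2 : d₂ • adL 𝕜 x ((c₁ • adL 𝕜 x ^ (m - 1)) w) =
          (d₂ * c₁) • (adL 𝕜 x ^ (m + n - 1)) w := by
        by_cases hn1 : n = 1
        · rw [hn1, show m + 1 - 1 = (m - 1) + 1 by omega, pow_succ', mul_apply_eq_comp, smul_apply,
            map_smul, smul_smul]
        · rw [hd₂ hn1]
          simp
      simp only [add_apply, ContinuousLinearMap.comp_apply, ContinuousLinearMap.flip_apply,
        adC_apply, Function.comp_apply, (h₁ L x).1, (h₂ L x).1, adL_smul, smul_apply, sub_smul,
        sub_apply] at e1 e2 ⊢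
      rw [e1, ← e2]
      simp only [map_smul, adL_apply]
      rw [← lie_skew x, smul_neg, smul_neg, sub_neg_eq_add, smul_comm c₁]

theorem exists_firstOrderData {n : ℕ} {u : FreeLieAlgebra 𝕜 (Fin 2)}
    (h : u ∈ Submodule.span 𝕜 {w | IsLieWord 𝕜 n w}) :
    ∃ d c : 𝕜, (n ≠ 1 → d = 0) ∧ FirstOrderData n u d c := by
  induction h using Submodule.span_induction with
  | mem w hw => exact hw.exists_firstOrderData
  | zero =>
    refine ⟨0, 0, fun _ => rfl, fun L _ _ _ x => ⟨by simp, ?_⟩⟩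
    simp only [map_zero, zero_smul]
    exact hasFDerivAt_const 0 0
  | add u v _ _ ihu ihv =>
    obtain ⟨d₁, c₁, hd₁, h₁⟩ := ihu
    obtain ⟨d₂, c₂, hd₂, h₂⟩ := ihv
    refine ⟨d₁ + d₂, c₁ + c₂, fun hn => by rw [hd₁ hn, hd₂ hn, add_zero],
      fun L _ _ _ x => ⟨by rw [map_add, (h₁ L x).1, (h₂ L x).1, add_smul], ?_⟩⟩
    simp only [map_add, add_smul]
    exact (h₁ L x).2.add (h₂ L x).2
  | smul r u _ ih =>
    obtain ⟨d, c, hd, h⟩ := ih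
    refine ⟨r * d, r * c, fun hn => by rw [hd hn, mul_zero],
      fun L _ _ _ x => ⟨by rw [map_smul, (h L x).1, smul_smul], ?_⟩⟩
    simp only [map_smul, mul_smul]
    exact (h L x).2.const_smul r

theorem LieSeries.term_smul (a : LieSeries 𝕜) {L : Type*} [LieRing L] [LieAlgebra 𝕜 L] (n : ℕ)
    (r : 𝕜) (p : L × L) : a.term n (r • p) = r ^ n • a.term n p := by
  have h := a.homogeneous n
  unfold LieSeries.term
  generalize a.comp n = u at h
  induction h using Submodule.span_induction with
  | mem w hw => exact hw.lift_smul r p.1 p.2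
  | zero => simp
  | add u v _ _ h1 h2 => rw [map_add, h1, h2, map_add, smul_add]
  | smul c u _ h1 => rw [map_smul, h1, map_smul, smul_comm]

theorem LieSeries.comp_zero (a : LieSeries 𝕜) : a.comp 0 = 0 := by
  have h := a.homogeneous 0
  rwa [show {w | IsLieWord 𝕜 0 w} = ∅ from Set.eq_empty_of_forall_notMem fun w hw =>
    absurd (IsLieWord.one_le hw) (by norm_num), Submodule.span_empty, Submodule.mem_bot] at h

/-- A Lie series has an expansion to first order in `Y`, whose coefficients do not depend on the
Lie algebra on which it is evaluated. -/
theorem LieSeries.exists_hasFirstOrder (a : LieSeries 𝕜) : ∃ (d : 𝕜) (f : 𝕜⟦X⟧),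
    ∀ (L : Type) [NormedLieRing L] [NormedLieAlgebra 𝕜 L] [FiniteDimensional 𝕜 L],
      (∀ᶠ p : L × L in 𝓝 (0, 0), Summable fun n => a.term n p) →
      AnalyticAt 𝕜 (a.eval (L := L)) (0, 0) → HasFirstOrder (a.eval (L := L)) d f := by
  choose d c hd h using fun n => exists_firstOrderData (a.homogeneous n)
  refine ⟨d 1, PowerSeries.mk fun n => c (n + 1), fun L _ _ _ hsum han => ?_⟩
  have := FiniteDimensional.complete 𝕜 L
  obtain ⟨P, r, hP⟩ := han
  have hball : ∀ᶠ p : L × L in 𝓝 0, p ∈ Metric.eball (0 : L × L) r :=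
    Metric.eball_mem_nhds 0 hP.r_pos
  -- on a ball, the Taylor components are the homogeneous components of the Lie series
  obtain ⟨ρ, hρ, hboth⟩ := Metric.eventually_nhds_iff_ball.1 (hball.and hsum)
  have hterm : ∀ p ∈ Metric.ball (0 : L × L) ρ, ∀ n, (P n fun _ => p) = a.term n p := by
    intro p hp n
    have h0 : (fun n => (P n fun _ => p) - a.term n p) = 0 := by
      refine hasSum_pow_smul_eq_zero (𝕜 := 𝕜) ?_
      filter_upwards [Metric.closedBall_mem_nhds (0 : 𝕜) one_pos] with s hs
      have hsp : s • p ∈ Metric.ball (0 : L × L) ρ := by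
        rw [mem_ball_zero_iff] at hp ⊢
        rw [norm_smul]
        exact (mul_le_of_le_one_left (norm_nonneg _) (by simpa using hs)).trans_lt hp
      obtain ⟨k1, k2⟩ := hboth _ hsp
      have k3 := hP.hasSum k1
      have k4 := k3.sub k2.hasSum
      have k5 : a.eval (((0 : L), (0 : L)) + s • p) - ∑' n, a.term n (s • p) = 0 := by
        rw [show ((0 : L), (0 : L)) + s • p = s • p from zero_add _]
        exact sub_self _
      rw [k5] at k4
      refine k4.congr_fun fun n => ?_
      have k6 : (P n fun _ => s • p) = s ^ n • P n fun _ => p := by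
        have := (P n).map_smul_univ (fun _ => s) (fun _ => p)
        simpa using this
      rw [a.term_smul, k6, smul_sub]
    exact sub_eq_zero.1 (congrFun h0 n)
  have hterm0 (p : L × L) : a.term 0 p = 0 := by
    rw [LieSeries.term, a.comp_zero, map_zero]
  filter_upwards [(continuous_id.prodMk continuous_const).tendsto' (0 : L) (0 : L × L) rfl
    |>.eventually (Metric.ball_mem_nhds (0 : L × L) hρ)] with x hx
  replace hx : (x, (0 : L)) ∈ Metric.ball (0 : L × L) ρ := hx
  obtain ⟨k1, k2⟩ := hboth _ hx
  have hcompn (n : ℕ) : a.term n (x, (0 : L)) = d n • x := (h n L x).1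
  refine ⟨?_, (fderiv 𝕜 (a.eval (L := L)) (x, 0)).comp (ContinuousLinearMap.inr 𝕜 L L), ?_, ?_⟩
  · rw [LieSeries.eval, tsum_eq_single 1 fun n hn => by rw [hcompn, hd n hn, zero_smul], hcompn]
  · have hs := (HasFPowerSeriesOnBall.hasSum_fderiv (f := a.eval (L := L)) hP k1).mapL
      ((ContinuousLinearMap.compL 𝕜 L (L × L) L).flip (ContinuousLinearMap.inr 𝕜 L L))
    refine hs.congr_fun fun n => ?_
    have hdiff : DifferentiableAt 𝕜 (fun z => P (n + 1) fun _ => z) ((x, 0) : L × L) :=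
      ((P (n + 1)).contDiff.differentiable (n := 1) (by simp)).differentiableAt.comp _
        (differentiableAt_pi.2 fun _ => differentiableAt_id)
    ext v
    have hslice : HasFDerivAt (fun y : L => P (n + 1) fun _ => (x, y))
        (c (n + 1) • adL 𝕜 x ^ n) 0 := by
      refine (h (n + 1) L x).2.congr_of_eventuallyEq ?_
      have ht : Filter.Tendsto (fun y : L => (x, y)) (𝓝 0) (𝓝 (x, 0)) :=
        (continuous_const.prodMk continuous_id).tendsto' _ _ rfl
      filter_upwards [ht.eventually (Metric.isOpen_ball.mem_nhds hx)] with y hy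
      exact hterm _ hy (n + 1)
    rw [PowerSeries.coeff_mk]
    exact (fderiv_apply_snd hdiff hslice v).symm
  · have hd : HasFDerivAt (a.eval (L := L)) (fderiv 𝕜 (a.eval (L := L)) (x, 0)) (x, 0) :=
      ((hP.analyticAt_of_mem k1).differentiableAt).hasFDerivAt
    exact HasFDerivAt.comp (g := a.eval (L := L)) (f := fun y : L => (x, y)) (0 : L) hd
      (hasFDerivAt_prodMk_right (𝕜 := 𝕜) x (0 : L))

end Universal

/-! ### Uniqueness of the coefficients -/

section Uniqueness

variable {𝕜 : Type*} [RCLike 𝕜]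

theorem powerSeries_eq_zero_of_hasSum {f : 𝕜⟦X⟧} {c : 𝕜} (hc : c ≠ 0)
    (h : ∀ᶠ s : 𝕜 in 𝓝 0, HasSum (fun n => PowerSeries.coeff n f * (s * c) ^ n) 0) : f = 0 := by
  have h1 : (fun n => PowerSeries.coeff n f * c ^ n) = 0 := by
    refine hasSum_pow_smul_eq_zero (𝕜 := 𝕜) (h.mono fun s hs => hs.congr_fun fun n => ?_)
    rw [smul_eq_mul, mul_pow]
    ring
  ext n
  have := congrFun h1 n
  simpa [hc] using this

variable {L : Type*} [NormedLieRing L] [NormedLieAlgebra 𝕜 L] [FiniteDimensional 𝕜 L]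

theorem adL_smul_pow_apply {H E : L} {c : 𝕜} (hHE : ⁅H, E⁆ = c • E) (s : 𝕜) (n : ℕ) :
    (adL 𝕜 (s • H) ^ n) E = (s * c) ^ n • E := by
  induction n with
  | zero => simp
  | succ n ih =>
    rw [pow_succ', mul_apply_eq_comp, ih, map_smul, adL_apply, smul_lie, hHE, smul_smul, smul_smul,
      pow_succ, mul_assoc]

omit [FiniteDimensional 𝕜 L] in
theorem tendsto_smul_zero (H : L) : Filter.Tendsto (fun s : 𝕜 => s • H) (𝓝 0) (𝓝 0) :=
  (continuous_id.smul continuous_const).tendsto' _ _ (zero_smul 𝕜 H)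

/-- On a Lie algebra containing `H`, `E` with `[H, E] = c E ≠ 0`, the expansion of a function to
first order determines its coefficients. -/
theorem HasFirstOrder.unique {F : L × L → L} {d d' : 𝕜} {f f' : 𝕜⟦X⟧} (h : HasFirstOrder F d f)
    (h' : HasFirstOrder F d' f') {H E : L} {c : 𝕜} (hHE : ⁅H, E⁆ = c • E) (hc : c ≠ 0)
    (ℓ : L →L[𝕜] 𝕜) (hℓ : ℓ E = 1) : f = f' := by
  rw [← sub_eq_zero]
  refine powerSeries_eq_zero_of_hasSum hc ?_
  filter_upwards [(tendsto_smul_zero (𝕜 := 𝕜) H).eventually h,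
    (tendsto_smul_zero (𝕜 := 𝕜) H).eventually h'] with s hs hs'
  obtain ⟨-, T, hT, hF⟩ := hs
  obtain ⟨-, T', hT', hF'⟩ := hs'
  rw [hF.unique hF'] at hT
  have h1 := (hT.sub hT').mapL (ℓ.comp (ContinuousLinearMap.apply 𝕜 L E))
  rw [sub_self, map_zero] at h1
  refine h1.congr_fun fun n => ?_
  simp only [ContinuousLinearMap.comp_apply, ContinuousLinearMap.apply_apply,
    adL_smul_pow_apply hHE, map_sub, map_smul, hℓ, smul_eq_mul, mul_one]
  ring

theorem HasFirstOrder.congr {F G : L × L → L} {d : 𝕜} {f : 𝕜⟦X⟧} (h : HasFirstOrder F d f)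
    (hFG : F =ᶠ[𝓝 (0, 0)] G) : HasFirstOrder G d f := by
  have h0 : ∀ᶠ p : L × L in 𝓝 0, F =ᶠ[𝓝 p] G := hFG.eventually_nhds
  have hin : Filter.Tendsto (fun x : L => (x, (0 : L))) (𝓝 0) (𝓝 0) :=
    (continuous_id.prodMk continuous_const).tendsto' _ _ rfl
  filter_upwards [h, hin.eventually h0] with x hx hx0
  obtain ⟨hx1, T, hT, hF⟩ := hx
  have ht : Filter.Tendsto (fun y : L => (x, y)) (𝓝 0) (𝓝 (x, 0)) :=
    (continuous_const.prodMk continuous_id).tendsto' _ _ rfl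
  exact ⟨by rw [← hx0.self_of_nhds, hx1], T, hT,
    hF.congr_of_eventuallyEq ((ht.eventually hx0).mono fun y hy => hy.symm)⟩

end Uniqueness

/-! ### The two-dimensional affine Lie algebra -/

section Affine

variable (𝕜 : Type) [RCLike 𝕜]

/-- The Lie algebra with basis `x = (1, 0)`, `f = (0, 1)` and bracket `[x, f] = f`. -/
def AffineLie : Type := 𝕜 × 𝕜

namespace AffineLie

/-- The normed group structure of `𝕜 × 𝕜`. -/
abbrev normedAddCommGroup : NormedAddCommGroup (AffineLie 𝕜) :=
  inferInstanceAs (NormedAddCommGroup (𝕜 × 𝕜))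

instance : NormedLieRing (AffineLie 𝕜) where
  __ := normedAddCommGroup 𝕜
  bracket u v := ((0, u.1 * v.2 - v.1 * u.2) : 𝕜 × 𝕜)
  add_lie u v w := Prod.ext (add_zero 0).symm (by
    change (u.1 + v.1) * w.2 - w.1 * (u.2 + v.2) =
      (u.1 * w.2 - w.1 * u.2) + (v.1 * w.2 - w.1 * v.2)
    ring)
  lie_add u v w := Prod.ext (add_zero 0).symm (by
    change u.1 * (v.2 + w.2) - (v.1 + w.1) * u.2 =
      (u.1 * v.2 - v.1 * u.2) + (u.1 * w.2 - w.1 * u.2)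
    ring)
  lie_self u := Prod.ext rfl (by
    change u.1 * u.2 - u.1 * u.2 = 0
    ring)
  leibniz_lie u v w := Prod.ext (add_zero 0).symm (by
    change u.1 * (v.1 * w.2 - w.1 * v.2) - 0 * u.2 =
      (0 * w.2 - w.1 * (u.1 * v.2 - v.1 * u.2)) + (v.1 * (u.1 * w.2 - w.1 * u.2) - 0 * v.2)
    ring)

/-- The normed space structure of `𝕜 × 𝕜`. -/
abbrev normedSpace : NormedSpace 𝕜 (AffineLie 𝕜) := inferInstanceAs (NormedSpace 𝕜 (𝕜 × 𝕜))

instance : NormedLieAlgebra 𝕜 (AffineLie 𝕜) where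
  __ := normedSpace 𝕜
  lie_smul c u v := Prod.ext (mul_zero c).symm (by
    change u.1 * (c * v.2) - (c * v.1) * u.2 = c * (u.1 * v.2 - v.1 * u.2)
    ring)

instance : FiniteDimensional 𝕜 (AffineLie 𝕜) := inferInstanceAs (FiniteDimensional 𝕜 (𝕜 × 𝕜))

/-- The basis vector `x`. -/
def x : AffineLie 𝕜 := ((1, 0) : 𝕜 × 𝕜)

/-- The basis vector `f`. -/
def f : AffineLie 𝕜 := ((0, 1) : 𝕜 × 𝕜)

variable {𝕜}

theorem lie_x_f : ⁅x 𝕜, f 𝕜⁆ = (1 : 𝕜) • f 𝕜 :=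
  Prod.ext (mul_zero (1 : 𝕜)).symm (by
    change (1 : 𝕜) * 1 - 0 * 0 = 1 * 1
    ring)

/-- The coefficient of `f`. -/
def coordF : AffineLie 𝕜 →L[𝕜] 𝕜 := ContinuousLinearMap.snd 𝕜 𝕜 𝕜

theorem coordF_f : coordF (f 𝕜) = 1 := rfl

/-- The coefficient of `x`. -/
def coordX : AffineLie 𝕜 →L[𝕜] 𝕜 := ContinuousLinearMap.fst 𝕜 𝕜 𝕜

theorem trace_prod (M : 𝕜 × 𝕜 →ₗ[𝕜] 𝕜 × 𝕜) :
    LinearMap.trace 𝕜 (𝕜 × 𝕜) M = (M (1, 0)).1 + (M (0, 1)).2 := by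
  rw [LinearMap.trace_eq_matrix_trace 𝕜 (Module.Basis.finTwoProd 𝕜), Matrix.trace_fin_two,
    LinearMap.toMatrix_apply, LinearMap.toMatrix_apply]
  simp

theorem trace_eq (M : AffineLie 𝕜 →L[𝕜] AffineLie 𝕜) :
    LinearMap.trace 𝕜 (AffineLie 𝕜) M.toLinearMap = coordX (M (x 𝕜)) + coordF (M (f 𝕜)) :=
  trace_prod M.toLinearMap

theorem coordX_adL (u v : AffineLie 𝕜) : coordX (adL 𝕜 u v) = 0 := rfl

theorem coordF_adL_x (v : AffineLie 𝕜) : coordF (adL 𝕜 (x 𝕜) v) = coordF v := by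
  change (1 : 𝕜) * v.2 - v.1 * 0 = v.2
  ring

end AffineLie

end Affine

/-! ### The trace equation to first order -/

section Trace

open scoped ContDiff
open AffineLie

variable {𝕜 : Type} [RCLike 𝕜]

/-- The mixed second derivative at `(X, 0)` of a function with a first-order expansion. -/
theorem HasFirstOrder.fderiv_fderiv {L : Type*} [NormedLieRing L] [NormedLieAlgebra 𝕜 L]
    [FiniteDimensional 𝕜 L] {F : L × L → L} {d : 𝕜} {h : 𝕜⟦X⟧} (hF : HasFirstOrder F d h)
    (han : AnalyticAt 𝕜 F (0, 0)) (hh : Convergent h) :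
    ∀ᶠ x : L in 𝓝 0, ∀ u : L, fderiv 𝕜 (fderiv 𝕜 F) (x, 0) (0, x) (u, 0) =
      -(opEval (shift h) (adL 𝕜 x) (adL 𝕜 x u)) := by
  have := FiniteDimensional.complete 𝕜 L
  have han' : ∀ᶠ p : L × L in 𝓝 0, AnalyticAt 𝕜 F p := han.eventually_analyticAt
  filter_upwards [tendsto_inl.eventually han',
    (tendsto_inl.eventually han').eventually_nhds, Filter.Eventually.eventually_nhds hF,
    (eventually_adL (hh.hasSum (L := L))).eventually_nhds,
    eventually_adL (hh.hasFDerivAt_opEval_apply (L := L) (E := L))] with x h1 h2 h3 h4 h5 u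
  have hC : ContDiffAt 𝕜 ∞ F (x, 0) := h1.contDiffAt
  rw [(hC.isSymmSndFDerivAt (by
    rw [minSmoothness_of_isRCLikeNormedField]
    exact WithTop.coe_le_coe.2 (le_top (a := (2 : ℕ∞))))).eq]
  have hd : DifferentiableAt 𝕜 (fderiv 𝕜 F) (x, 0) :=
    (hC.fderiv_right (m := ∞) (by simp)).differentiableAt (by simp)
  have h6 : HasFDerivAt (fun z : L => fderiv 𝕜 F (z, 0)) _ x :=
    HasFDerivAt.comp (g := fderiv 𝕜 F) (f := fun z : L => (z, (0 : L))) x hd.hasFDerivAt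
      (hasFDerivAt_prodMk_left (𝕜 := 𝕜) x (0 : L))
  have h7 := (ContinuousLinearMap.apply 𝕜 L ((0, x) : L × L)).hasFDerivAt.comp x h6
  have h8 : (fun z : L => fderiv 𝕜 F (z, 0) (0, x)) =ᶠ[𝓝 x] fun z => opEval h (adL 𝕜 z) x := by
    filter_upwards [h2, h3, h4] with z k1 k2 k3
    obtain ⟨-, T, hT, hFT⟩ := k2
    rw [k3.unique hT]
    exact fderiv_apply_snd k1.differentiableAt hFT x
  have h9 := (h5 (adL 𝕜) (adC 𝕜 L) x x rfl (hasFDerivAt_adL x) (adL_self x)).congr_of_eventuallyEq h8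
  have h10 := congrArg (fun T : L →L[𝕜] L => T u) (h7.unique h9)
  refine h10.trans ?_
  simp only [ContinuousLinearMap.comp_apply, ContinuousLinearMap.flip_apply, adC_apply, adL_apply]
  rw [← lie_skew x u, map_neg, neg_neg]

/-- On the affine Lie algebra the trace equation, to first order along the pairs `(X, ε X)`,
determines `γ` from `β`: namely `γ = β - β(0) + ψ'(0) - ψ'`. -/
theorem IsKVSolution.series_eq {A B : AffineLie 𝕜 × AffineLie 𝕜 → AffineLie 𝕜}
    (hKV : IsKVSolution 𝕜 A B) {d d' : 𝕜} {β γ : 𝕜⟦X⟧} (hA : HasFirstOrder A d β)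
    (hB : HasFirstOrder B d' γ) (cβ : Convergent β) (cγ : Convergent γ) :
    (γ - shift β * PowerSeries.X) * PowerSeries.X =
      PowerSeries.coeff 1 (psi 𝕜) • PowerSeries.X -
        PowerSeries.X * PowerSeries.derivative 𝕜 (psi 𝕜) := by
  have := FiniteDimensional.complete 𝕜 (AffineLie 𝕜)
  have cψ := convergent_psi 𝕜
  have ct := convergent_X (𝕜 := 𝕜)
  have c1 := cβ.shift.mul ct
  have c2 := (cγ.sub c1).mul ct
  have c3 := (ct.smul (PowerSeries.coeff 1 (psi 𝕜))).sub (ct.mul cψ.derivative)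
  have hanA : ∀ᶠ p : AffineLie 𝕜 × AffineLie 𝕜 in 𝓝 0, AnalyticAt 𝕜 A p :=
    hKV.analytic_A.eventually_analyticAt
  have hanB : ∀ᶠ p : AffineLie 𝕜 × AffineLie 𝕜 in 𝓝 0, AnalyticAt 𝕜 B p :=
    hKV.analytic_B.eventually_analyticAt
  have htr := Filter.Eventually.eventually_nhds hKV.trace_eq
  rw [← sub_eq_zero]
  refine powerSeries_eq_zero_of_hasSum (c := 1) one_ne_zero ?_
  have key : ∀ᶠ z : AffineLie 𝕜 in 𝓝 0, ∀ s : 𝕜, z = s • x 𝕜 →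
      coordF (opEval ((γ - shift β * PowerSeries.X) * PowerSeries.X -
        (PowerSeries.coeff 1 (psi 𝕜) • PowerSeries.X -
          PowerSeries.X * PowerSeries.derivative 𝕜 (psi 𝕜))) (adL 𝕜 z) (f 𝕜)) = 0 := by
    filter_upwards [tendsto_inl.eventually hanA.eventually_nhds,
      tendsto_inl.eventually hanB.eventually_nhds, tendsto_inl.eventually htr,
      tendsto_inl.eventually
        (bch_of_lie_eq_zero (𝕜 := 𝕜) (L := AffineLie 𝕜)).eventually_nhds,
      hA.fderiv_fderiv hKV.analytic_A cβ, hB,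
      eventually_adL (cγ.hasSum (L := AffineLie 𝕜)),
      (eventually_adL (cψ.opEval_apply_of_eq_zero (L := AffineLie 𝕜))).eventually_nhds,
      eventually_adL (cψ.hasDerivAt_opEval_smul (L := AffineLie 𝕜)),
      eventually_adL (c2.opEval_sub c3 (L := AffineLie 𝕜)),
      eventually_adL ((cγ.sub c1).opEval_mul ct (L := AffineLie 𝕜)),
      eventually_adL (cγ.opEval_sub c1 (L := AffineLie 𝕜)),
      eventually_adL (cβ.shift.opEval_mul ct (L := AffineLie 𝕜)),
      eventually_adL ((ct.smul (PowerSeries.coeff 1 (psi 𝕜))).opEval_sub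
        (ct.mul cψ.derivative) (L := AffineLie 𝕜))]
      with z h1 h2 h3 h4 h5 h6 h7 h8 h9 k1 k2 k3 k4 k5 s hs
    obtain ⟨-, T, hT, hBT⟩ := h6
    have hzx : adL 𝕜 z (x 𝕜) = 0 := by rw [hs, adL_smul, smul_apply, adL_self, smul_zero]
    have hzf : adL 𝕜 z (f 𝕜) = s • f 𝕜 := by
      rw [hs, adL_smul, smul_apply, adL_apply, lie_x_f, one_smul]
    have hzF (v : AffineLie 𝕜) : coordF (adL 𝕜 z v) = s * coordF v := by
      rw [hs, adL_smul, smul_apply, map_smul, coordF_adL_x, smul_eq_mul]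
    have hline : HasDerivAt (fun ε : 𝕜 => (z, ε • z)) ((0 : AffineLie 𝕜), (1 : 𝕜) • z) 0 :=
      (hasDerivAt_const _ _).prodMk ((hasDerivAt_id (0 : 𝕜)).smul_const z)
    have hline0 : (z, (0 : 𝕜) • z) = (z, (0 : AffineLie 𝕜)) := by rw [zero_smul]
    have htend : Filter.Tendsto (fun ε : 𝕜 => (z, ε • z)) (𝓝 0) (𝓝 (z, 0)) := by
      have := hline.continuousAt
      rwa [ContinuousAt, hline0] at this
    have htend1 : Filter.Tendsto (fun ε : 𝕜 => (1 + ε) • z) (𝓝 0) (𝓝 z) :=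
      ((continuous_const.add continuous_id).smul continuous_const).tendsto' _ _ (by simp)
    have hψ0 := eventually_adL (cψ.opEval_apply_of_eq_zero (L := AffineLie 𝕜))
    have hderiv {F : AffineLie 𝕜 × AffineLie 𝕜 → AffineLie 𝕜}
        (hF : AnalyticAt 𝕜 F (z, 0)) : HasDerivAt (fun ε : 𝕜 => fderiv 𝕜 F (z, ε • z))
          (fderiv 𝕜 (fderiv 𝕜 F) (z, 0) (0, z)) 0 := by
      have i1 : HasFDerivAt (fderiv 𝕜 F) (fderiv 𝕜 (fderiv 𝕜 F) (z, 0)) (z, (0 : 𝕜) • z) := by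
        rw [hline0]
        exact hF.fderiv.differentiableAt.hasFDerivAt
      have i2 := i1.comp_hasDerivAt (0 : 𝕜) hline
      rw [one_smul] at i2
      exact i2
    -- the left-hand side of the trace equation along `ε ↦ (z, ε z)`
    have hL1 : HasDerivAt (fun ε : 𝕜 => coordF (fderiv 𝕜 A (z, ε • z) (f 𝕜, 0)))
        (-coordF (opEval (shift β) (adL 𝕜 z) (adL 𝕜 z (f 𝕜)))) 0 := by
      rw [← map_neg, ← h5]
      exact (coordF.comp (ContinuousLinearMap.apply 𝕜 (AffineLie 𝕜) ((f 𝕜, 0) :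
        AffineLie 𝕜 × AffineLie 𝕜))).hasFDerivAt.comp_hasDerivAt (0 : 𝕜)
          (hderiv h1.self_of_nhds)
    have hL2 : HasDerivAt (fun ε : 𝕜 => ε * coordF (fderiv 𝕜 B (z, ε • z) (0, f 𝕜)))
        (coordF (opEval γ (adL 𝕜 z) (f 𝕜))) 0 := by
      have i1 := (coordF.comp (ContinuousLinearMap.apply 𝕜 (AffineLie 𝕜) ((0, f 𝕜) :
        AffineLie 𝕜 × AffineLie 𝕜))).hasFDerivAt.comp_hasDerivAt (0 : 𝕜)
          (hderiv h2.self_of_nhds)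
      have i2 := (hasDerivAt_id (0 : 𝕜)).mul i1
      refine i2.congr_deriv ?_
      have i3 := fderiv_apply_snd h2.self_of_nhds.differentiableAt hBT (f 𝕜)
      rw [h7.unique hT, ← i3]
      simp
    have hL := (hL1.const_mul s).fun_add (hL2.const_mul s)
    -- the right-hand side along the same line, where `log (exp z exp (ε z)) = (1 + ε) z`
    have hR1 : HasDerivAt (fun ε : 𝕜 => coordF (opEval (psi 𝕜) (adL 𝕜 (ε • z)) (f 𝕜)))
        (PowerSeries.coeff 1 (psi 𝕜) * s) 0 := by
      have i1 : HasFDerivAt (fun y : AffineLie 𝕜 => opEval (psi 𝕜) (adL 𝕜 y) (f 𝕜))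
          (-(PowerSeries.coeff 1 (psi 𝕜) • adL 𝕜 (f 𝕜))) ((0 : 𝕜) • z) := by
        rw [zero_smul]
        exact hasFDerivAt_opEval_adL_zero cψ (f 𝕜)
      have i2 := coordF.hasFDerivAt.comp_hasDerivAt (0 : 𝕜)
        (i1.comp_hasDerivAt (0 : 𝕜) ((hasDerivAt_id (0 : 𝕜)).smul_const z))
      refine i2.congr_deriv ?_
      have i3 : adL 𝕜 (f 𝕜) z = -(s • f 𝕜) := by rw [← hzf, adL_apply, adL_apply, lie_skew]
      simp only [one_smul, neg_apply, smul_apply, i3, smul_neg, neg_neg, map_smul, coordF_f,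
        smul_eq_mul, mul_one]
    have hR2 : HasDerivAt (fun ε : 𝕜 => coordF (opEval (psi 𝕜) (adL 𝕜 ((1 + ε) • z)) (f 𝕜)))
        (coordF (opEval (PowerSeries.X * PowerSeries.derivative 𝕜 (psi 𝕜)) (adL 𝕜 z) (f 𝕜)))
        0 := by
      have i0 : HasDerivAt (fun r : 𝕜 => opEval (psi 𝕜) (r • adL 𝕜 z))
          (opEval (PowerSeries.X * PowerSeries.derivative 𝕜 (psi 𝕜)) (adL 𝕜 z)) (1 + 0) := by
        rw [add_zero]; exact h9
      have i1 := HasDerivAt.comp_const_add (1 : 𝕜) 0 i0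
      have i2 := (coordF.comp (ContinuousLinearMap.apply 𝕜 (AffineLie 𝕜)
        (f 𝕜))).hasFDerivAt.comp_hasDerivAt (0 : 𝕜) i1
      simp only [adL_smul]
      exact i2
    have hR := ((hR1.const_add (coordF (opEval (psi 𝕜) (adL 𝕜 z) (f 𝕜)))).fun_sub hR2).const_add
      (PowerSeries.coeff 0 (psi 𝕜))
    have heq : (fun ε : 𝕜 => s * coordF (fderiv 𝕜 A (z, ε • z) (f 𝕜, 0)) +
        s * (ε * coordF (fderiv 𝕜 B (z, ε • z) (0, f 𝕜)))) =ᶠ[𝓝 0]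
        fun ε => PowerSeries.coeff 0 (psi 𝕜) + (coordF (opEval (psi 𝕜) (adL 𝕜 z) (f 𝕜)) +
          coordF (opEval (psi 𝕜) (adL 𝕜 (ε • z)) (f 𝕜)) -
            coordF (opEval (psi 𝕜) (adL 𝕜 ((1 + ε) • z)) (f 𝕜))) := by
      filter_upwards [htend.eventually h1, htend.eventually h2, htend.eventually h3,
        htend.eventually h4, (tendsto_smul_zero (𝕜 := 𝕜) z).eventually hψ0,
        htend1.eventually h8] with ε l1 l2 l3 l4 l5 l6
      have hb : bch 𝕜 z (ε • z) = (1 + ε) • z := by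
        rw [l4 (by simp), add_smul, one_smul]
      have m0 := h8.self_of_nhds (x 𝕜) hzx
      have m1 := l5 (x 𝕜) (by rw [adL_smul, smul_apply, hzx, smul_zero])
      rw [adL_smul ε z] at m1
      have m2 := l6 (x 𝕜) (by rw [adL_smul, smul_apply, hzx, smul_zero])
      replace l3 := (AffineLie.trace_eq _).symm.trans (l3.trans (AffineLie.trace_eq _))
      simp only [hb] at l3
      have n1 : fderiv 𝕜 (fun y => A (y, ε • z)) z (f 𝕜) = fderiv 𝕜 A (z, ε • z) (f 𝕜, 0) := by
        have i1 := HasFDerivAt.comp (g := A) (f := fun y : AffineLie 𝕜 => (y, ε • z)) z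
          l1.differentiableAt.hasFDerivAt (hasFDerivAt_prodMk_left (𝕜 := 𝕜) z (ε • z))
        exact congrArg (fun T : AffineLie 𝕜 →L[𝕜] AffineLie 𝕜 => T (f 𝕜)) i1.fderiv
      have n2 : fderiv 𝕜 (fun y => B (z, y)) (ε • z) (f 𝕜) = fderiv 𝕜 B (z, ε • z) (0, f 𝕜) := by
        have i1 := HasFDerivAt.comp (g := B) (f := fun y : AffineLie 𝕜 => (z, y)) (ε • z)
          l2.differentiableAt.hasFDerivAt (hasFDerivAt_prodMk_right (𝕜 := 𝕜) z (ε • z))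
        exact congrArg (fun T : AffineLie 𝕜 →L[𝕜] AffineLie 𝕜 => T (f 𝕜)) i1.fderiv
      have hxx : coordX (x 𝕜) = (1 : 𝕜) := rfl
      simp only [add_apply, sub_apply, mul_apply_eq_comp, map_add, map_sub, coordX_adL, m0, m1, m2,
        n1, n2, hzF, adL_smul ε z, smul_apply, map_smul, smul_eq_mul, hxx, mul_one] at l3
      simp only [adL_smul ε z]
      linear_combination l3
    have hfin := (hL.congr_of_eventuallyEq heq.symm).unique hR
    rw [k1, k2, k3, k4, k5]
    simp only [opEval_X, opEval_smul, sub_apply, mul_apply_eq_comp, smul_apply, map_sub, map_smul,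
      smul_eq_mul, hzf, coordF_f] at hfin ⊢
    linear_combination hfin
  filter_upwards [(tendsto_smul_zero (𝕜 := 𝕜) (x 𝕜)).eventually key,
    (tendsto_smul_zero (𝕜 := 𝕜) (x 𝕜)).eventually
      (eventually_adL ((c2.sub c3).hasSum (L := AffineLie 𝕜)))] with s h1 h2
  have h3 := h2.mapL (coordF.comp (ContinuousLinearMap.apply 𝕜 (AffineLie 𝕜) (f 𝕜)))
  have h4 := h1 s rfl
  simp only [ContinuousLinearMap.comp_apply, ContinuousLinearMap.apply_apply] at h3
  rw [h4] at h3
  refine h3.congr_fun fun n => ?_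
  rw [smul_apply, adL_smul_pow_apply lie_x_f, map_smul, map_smul, coordF_f, smul_eq_mul,
    smul_eq_mul, mul_one, mul_one]

end Trace

/-! ### The Lie algebra `sl₂` -/

section SpecialLinear

variable (𝕜 : Type) [RCLike 𝕜]

/-- The Lie algebra `sl₂`, in the coordinates of the basis `H`, `E`, `F` with brackets
`[H, E] = 2 E`, `[H, F] = -2 F` and `[E, F] = H`. -/
def Sl2 : Type := 𝕜 × 𝕜 × 𝕜

namespace Sl2

/-- The normed group structure of `𝕜 × 𝕜 × 𝕜`. -/
abbrev normedAddCommGroup : NormedAddCommGroup (Sl2 𝕜) :=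
  inferInstanceAs (NormedAddCommGroup (𝕜 × 𝕜 × 𝕜))

theorem eq_of_coords {𝕜 : Type} {u v : Sl2 𝕜} (h1 : u.1 = v.1) (h2 : u.2.1 = v.2.1)
    (h3 : u.2.2 = v.2.2) : u = v :=
  Prod.ext h1 (Prod.ext h2 h3)

instance : NormedLieRing (Sl2 𝕜) where
  __ := normedAddCommGroup 𝕜
  bracket u v := ((u.2.1 * v.2.2 - u.2.2 * v.2.1, 2 * (u.1 * v.2.1 - u.2.1 * v.1),
    2 * (u.2.2 * v.1 - u.1 * v.2.2)) : 𝕜 × 𝕜 × 𝕜)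
  add_lie u v w := by
    refine eq_of_coords ?_ ?_ ?_
    · change (u.2.1 + v.2.1) * w.2.2 - (u.2.2 + v.2.2) * w.2.1 =
        (u.2.1 * w.2.2 - u.2.2 * w.2.1) + (v.2.1 * w.2.2 - v.2.2 * w.2.1)
      ring
    · change 2 * ((u.1 + v.1) * w.2.1 - (u.2.1 + v.2.1) * w.1) =
        2 * (u.1 * w.2.1 - u.2.1 * w.1) + 2 * (v.1 * w.2.1 - v.2.1 * w.1)
      ring
    · change 2 * ((u.2.2 + v.2.2) * w.1 - (u.1 + v.1) * w.2.2) =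
        2 * (u.2.2 * w.1 - u.1 * w.2.2) + 2 * (v.2.2 * w.1 - v.1 * w.2.2)
      ring
  lie_add u v w := by
    refine eq_of_coords ?_ ?_ ?_
    · change u.2.1 * (v.2.2 + w.2.2) - u.2.2 * (v.2.1 + w.2.1) =
        (u.2.1 * v.2.2 - u.2.2 * v.2.1) + (u.2.1 * w.2.2 - u.2.2 * w.2.1)
      ring
    · change 2 * (u.1 * (v.2.1 + w.2.1) - u.2.1 * (v.1 + w.1)) =
        2 * (u.1 * v.2.1 - u.2.1 * v.1) + 2 * (u.1 * w.2.1 - u.2.1 * w.1)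
      ring
    · change 2 * (u.2.2 * (v.1 + w.1) - u.1 * (v.2.2 + w.2.2)) =
        2 * (u.2.2 * v.1 - u.1 * v.2.2) + 2 * (u.2.2 * w.1 - u.1 * w.2.2)
      ring
  lie_self u := by
    refine eq_of_coords ?_ ?_ ?_
    · change u.2.1 * u.2.2 - u.2.2 * u.2.1 = 0
      ring
    · change 2 * (u.1 * u.2.1 - u.2.1 * u.1) = 0
      ring
    · change 2 * (u.2.2 * u.1 - u.1 * u.2.2) = 0
      ring
  leibniz_lie u v w := by
    refine eq_of_coords ?_ ?_ ?_
    · change u.2.1 * (2 * (v.2.2 * w.1 - v.1 * w.2.2)) - u.2.2 * (2 * (v.1 * w.2.1 - v.2.1 * w.1)) =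
        (2 * (u.1 * v.2.1 - u.2.1 * v.1) * w.2.2 - 2 * (u.2.2 * v.1 - u.1 * v.2.2) * w.2.1) +
        (v.2.1 * (2 * (u.2.2 * w.1 - u.1 * w.2.2)) - v.2.2 * (2 * (u.1 * w.2.1 - u.2.1 * w.1)))
      ring
    · change 2 * (u.1 * (2 * (v.1 * w.2.1 - v.2.1 * w.1)) -
          u.2.1 * (v.2.1 * w.2.2 - v.2.2 * w.2.1)) =
        2 * ((u.2.1 * v.2.2 - u.2.2 * v.2.1) * w.2.1 - 2 * (u.1 * v.2.1 - u.2.1 * v.1) * w.1) +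
        2 * (v.1 * (2 * (u.1 * w.2.1 - u.2.1 * w.1)) - v.2.1 * (u.2.1 * w.2.2 - u.2.2 * w.2.1))
      ring
    · change 2 * (u.2.2 * (v.2.1 * w.2.2 - v.2.2 * w.2.1) -
          u.1 * (2 * (v.2.2 * w.1 - v.1 * w.2.2))) =
        2 * (2 * (u.2.2 * v.1 - u.1 * v.2.2) * w.1 - (u.2.1 * v.2.2 - u.2.2 * v.2.1) * w.2.2) +
        2 * (v.2.2 * (u.2.1 * w.2.2 - u.2.2 * w.2.1) - v.1 * (2 * (u.2.2 * w.1 - u.1 * w.2.2)))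
      ring

/-- The normed space structure of `𝕜 × 𝕜 × 𝕜`. -/
abbrev normedSpace : NormedSpace 𝕜 (Sl2 𝕜) := inferInstanceAs (NormedSpace 𝕜 (𝕜 × 𝕜 × 𝕜))

instance : NormedLieAlgebra 𝕜 (Sl2 𝕜) where
  __ := normedSpace 𝕜
  lie_smul c u v := by
    refine eq_of_coords ?_ ?_ ?_
    · change u.2.1 * (c * v.2.2) - u.2.2 * (c * v.2.1) = c * (u.2.1 * v.2.2 - u.2.2 * v.2.1)
      ring
    · change 2 * (u.1 * (c * v.2.1) - u.2.1 * (c * v.1)) = c * (2 * (u.1 * v.2.1 - u.2.1 * v.1))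
      ring
    · change 2 * (u.2.2 * (c * v.1) - u.1 * (c * v.2.2)) = c * (2 * (u.2.2 * v.1 - u.1 * v.2.2))
      ring

instance : FiniteDimensional 𝕜 (Sl2 𝕜) := inferInstanceAs (FiniteDimensional 𝕜 (𝕜 × 𝕜 × 𝕜))

/-- The bilinear form `(u, v) = tr (u v)` of `2 × 2` matrices. -/
def traceForm : LinearMap.BilinForm 𝕜 (Sl2 𝕜) :=
  LinearMap.mk₂ 𝕜 (fun u v => 2 * (u.1 * v.1) + (u.2.1 * v.2.2 + u.2.2 * v.2.1))
    (fun u u' v => by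
      change 2 * ((u.1 + u'.1) * v.1) + ((u.2.1 + u'.2.1) * v.2.2 + (u.2.2 + u'.2.2) * v.2.1) =
        _ + _
      ring)
    (fun c u v => by
      change 2 * ((c * u.1) * v.1) + ((c * u.2.1) * v.2.2 + (c * u.2.2) * v.2.1) = c * _
      ring)
    (fun u v v' => by
      change 2 * (u.1 * (v.1 + v'.1)) + (u.2.1 * (v.2.2 + v'.2.2) + u.2.2 * (v.2.1 + v'.2.1)) =
        _ + _
      ring)
    (fun c u v => by
      change 2 * (u.1 * (c * v.1)) + (u.2.1 * (c * v.2.2) + u.2.2 * (c * v.2.1)) = c * _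
      ring)

theorem traceForm_isSymm : (traceForm 𝕜).IsSymm := ⟨fun u v => by
  change 2 * (u.1 * v.1) + (u.2.1 * v.2.2 + u.2.2 * v.2.1) =
    2 * (v.1 * u.1) + (v.2.1 * u.2.2 + v.2.2 * u.2.1)
  ring⟩

theorem traceForm_separatingLeft : (traceForm 𝕜).SeparatingLeft := by
  intro u hu
  have h1 : 2 * (u.1 * 1) + (u.2.1 * 0 + u.2.2 * 0) = 0 := hu ((1, 0, 0) : 𝕜 × 𝕜 × 𝕜)
  have h2 : 2 * (u.1 * 0) + (u.2.1 * 0 + u.2.2 * 1) = 0 := hu ((0, 1, 0) : 𝕜 × 𝕜 × 𝕜)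
  have h3 : 2 * (u.1 * 0) + (u.2.1 * 1 + u.2.2 * 0) = 0 := hu ((0, 0, 1) : 𝕜 × 𝕜 × 𝕜)
  refine eq_of_coords ?_ ?_ ?_
  · change u.1 = 0
    linear_combination h1 / 2
  · change u.2.1 = 0
    linear_combination h3
  · change u.2.2 = 0
    linear_combination h2

/-- The trace form makes `sl₂` a quadratic Lie algebra. -/
def quadratic : QuadraticStructure 𝕜 (Sl2 𝕜) where
  form := traceForm 𝕜
  symm := traceForm_isSymm 𝕜
  nondeg := ⟨traceForm_separatingLeft 𝕜, fun v hv => traceForm_separatingLeft 𝕜 v fun u =>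
    ((traceForm_isSymm 𝕜).eq v u).trans (hv u)⟩
  invariant u v w := by
    change 2 * ((u.2.1 * v.2.2 - u.2.2 * v.2.1) * w.1) + (2 * (u.1 * v.2.1 - u.2.1 * v.1) * w.2.2 +
        2 * (u.2.2 * v.1 - u.1 * v.2.2) * w.2.1) =
      2 * (u.1 * (v.2.1 * w.2.2 - v.2.2 * w.2.1)) + (u.2.1 * (2 * (v.2.2 * w.1 - v.1 * w.2.2)) +
        u.2.2 * (2 * (v.1 * w.2.1 - v.2.1 * w.1)))
    ring

/-- The basis vector `H`. -/
def H : Sl2 𝕜 := ((1, 0, 0) : 𝕜 × 𝕜 × 𝕜)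

/-- The basis vector `E`. -/
def E : Sl2 𝕜 := ((0, 1, 0) : 𝕜 × 𝕜 × 𝕜)

variable {𝕜}

theorem lie_H_E : ⁅H 𝕜, E 𝕜⁆ = (2 : 𝕜) • E 𝕜 := by
  refine eq_of_coords ?_ ?_ ?_
  · change (0 : 𝕜) * 0 - 0 * 1 = 2 * 0
    ring
  · change (2 : 𝕜) * (1 * 1 - 0 * 0) = 2 * 1
    ring
  · change (2 : 𝕜) * (0 * 0 - 1 * 0) = 2 * 0
    ring

/-- The coefficient of `E`. -/
def coordE : Sl2 𝕜 →L[𝕜] 𝕜 :=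
  (ContinuousLinearMap.fst 𝕜 𝕜 𝕜).comp (ContinuousLinearMap.snd 𝕜 𝕜 (𝕜 × 𝕜))

theorem firstOrder_unique {F G : Sl2 𝕜 × Sl2 𝕜 → Sl2 𝕜} {d d' : 𝕜} {f f' : 𝕜⟦X⟧}
    (h : HasFirstOrder F d f) (h' : HasFirstOrder G d' f') (hFG : F =ᶠ[𝓝 (0, 0)] G) : f = f' :=
  (h.congr hFG).unique h' lie_H_E two_ne_zero coordE rfl

end Sl2

end SpecialLinear

/-! ### Comparison with universal solutions and with Vergne's solution -/

section Comparison

variable (𝕜 : Type) [RCLike 𝕜]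

/-- The series `Π`, which comes from the radial primitive. -/
def piZero : 𝕜⟦X⟧ := -avg 1 (mFst 𝕜)

theorem eulerTwo_piZero : eulerTwo (piZero 𝕜) = (1 / 2 : 𝕜) • (phi 𝕜)⁻¹ -
    gSeries 𝕜 * PowerSeries.evalNegHom (phi 𝕜) * (1 - phi 𝕜) := by
  have h := eulerTwo_avg 𝕜 (mFst 𝕜)
  rw [eulerTwo] at h ⊢
  rw [inv_phi, piZero, map_neg]
  rw [mFst] at h ⊢
  linear_combination -h

theorem betaAM_eq_piZero : betaAM 𝕜 = piZero 𝕜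
    - (1 / 4 : 𝕜) • ((gSeries 𝕜 * PowerSeries.evalNegHom (phi 𝕜)
      - (1 / 2 : 𝕜) • (phi 𝕜)⁻¹) * PowerSeries.X)
    - (1 / 2 : 𝕜) • (phi 𝕜)⁻¹ + gSeries 𝕜 * PowerSeries.evalNegHom (phi 𝕜) * (1 - phi 𝕜) := by
  rw [betaAM, piZero, inv_phi, mFst]
  ring

variable {𝕜}

/-- A solution of the conjecture on the affine Lie algebra does not have the coefficients `β_AM`,
`γ_AM`: as `ψ` has no term of degree five, the coefficients of `t⁴` would have to agree. -/
theorem not_isKVSolution_affineLie {A B : AffineLie 𝕜 × AffineLie 𝕜 → AffineLie 𝕜} {d d' : 𝕜}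
    (hA : HasFirstOrder A d (betaAM 𝕜)) (hB : HasFirstOrder B d' (gammaAM 𝕜)) :
    ¬ IsKVSolution 𝕜 A B := by
  intro h
  have h1 := congrArg (PowerSeries.coeff 5)
    (h.series_eq hA hB (convergent_betaAM 𝕜) (convergent_gammaAM 𝕜))
  have hψ : PowerSeries.coeff 5 (psi 𝕜) = 0 := by
    simp [psi, coeff_phi_five, PowerSeries.coeff_one]
  obtain ⟨-, -, -, -, hβ⟩ := jet_betaAM 𝕜
  obtain ⟨-, -, -, -, hγ⟩ := jet_gammaAM 𝕜
  rw [PowerSeries.coeff_succ_mul_X, map_sub, map_sub, PowerSeries.coeff_succ_mul_X,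
    PowerSeries.coeff_succ_X_mul, map_smul, PowerSeries.coeff_X, shift, PowerSeries.coeff_mk,
    PowerSeries.coeff_derivative, hψ, hβ, hγ] at h1
  norm_num at h1

/-- A universal solution is tested on `sl₂`, where it is identified, and on the affine Lie algebra,
where it fails. -/
theorem not_universal_solutionAM_sl2 :
    ¬ ∃ a b : LieSeries 𝕜, IsUniversalSolution a b ∧
      ∀ᶠ p : Sl2 𝕜 × Sl2 𝕜 in 𝓝 (0, 0), solutionAM (Sl2.quadratic 𝕜) p = (a.eval p, b.eval p) := by
  rintro ⟨a, b, hab, h⟩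
  obtain ⟨d, f, hf⟩ := a.exists_hasFirstOrder
  obtain ⟨d', f', hf'⟩ := b.exists_hasFirstOrder
  have key (L : Type) [NormedLieRing L] [NormedLieAlgebra 𝕜 L] [FiniteDimensional 𝕜 L] :
      HasFirstOrder (a.eval (L := L)) d f ∧ HasFirstOrder (b.eval (L := L)) d' f' :=
    have hL := hab L
    ⟨hf L (hL.1.mono fun _ h => h.1) hL.2.analytic_A,
      hf' L (hL.1.mono fun _ h => h.2) hL.2.analytic_B⟩
  have hβ : betaAM 𝕜 = f := Sl2.firstOrder_unique
    (hasFirstOrder_solutionAM_fst (Sl2.quadratic 𝕜)) (key (Sl2 𝕜)).1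
    (h.mono fun p hp => congrArg Prod.fst hp)
  have hγ : gammaAM 𝕜 = f' := Sl2.firstOrder_unique
    (hasFirstOrder_solutionAM_snd (Sl2.quadratic 𝕜)) (key (Sl2 𝕜)).2
    (h.mono fun p hp => congrArg Prod.snd hp)
  obtain ⟨h1, h2⟩ := key (AffineLie 𝕜)
  rw [← hβ] at h1
  rw [← hγ] at h2
  exact not_isKVSolution_affineLie h1 h2 (hab (AffineLie 𝕜)).2

theorem solutionAM_ne_solutionV_sl2 :
    ¬ ∀ᶠ p : Sl2 𝕜 × Sl2 𝕜 in 𝓝 (0, 0),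
      (solutionAM (Sl2.quadratic 𝕜) p).2 = (solutionV (Sl2.quadratic 𝕜) p).2 := by
  intro h
  have h1 : gammaAM 𝕜 = gammaV 𝕜 := Sl2.firstOrder_unique
    (hasFirstOrder_solutionAM_snd (Sl2.quadratic 𝕜))
    (hasFirstOrder_solutionV_snd (Sl2.quadratic 𝕜)) h
  obtain ⟨-, -, -, -, hγ⟩ := jet_gammaAM 𝕜
  obtain ⟨-, -, -, -, hV⟩ := jet_gammaV 𝕜
  rw [h1, hV] at hγ
  norm_num at hγ

end Comparison

end KashiwaraVergne

end

theorem mainTheorem5 (𝕜 : Type) [RCLike 𝕜] :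
    ∃ βAM γAM γV Pi0 : PowerSeries 𝕜,
      -- the expansions to first order in `Y` of the two solutions, on all quadratic Lie algebras
      (∀ (L : Type*) [NormedLieRing L] [NormedLieAlgebra 𝕜 L] [FiniteDimensional 𝕜 L]
        (κ : KashiwaraVergne.QuadraticStructure 𝕜 L),
        KashiwaraVergne.HasFirstOrder
            (fun p => (KashiwaraVergne.solutionAM κ p).1) (0 : 𝕜) βAM ∧
          KashiwaraVergne.HasFirstOrder
            (fun p => (KashiwaraVergne.solutionAM κ p).2) (1 / 4 : 𝕜) γAM ∧
          KashiwaraVergne.HasFirstOrder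
            (fun p => (KashiwaraVergne.solutionV κ p).2) (1 / 4 : 𝕜) γV) ∧
      -- the formulas for the series
      KashiwaraVergne.eulerTwo γV =
        (1 / 8 : 𝕜) • PowerSeries.X
          - (1 / 2 : 𝕜) • (PowerSeries.X * PowerSeries.evalNegHom (KashiwaraVergne.phi 𝕜)
            * KashiwaraVergne.rSeries 𝕜
            * PowerSeries.derivative 𝕜 (KashiwaraVergne.phi 𝕜)) ∧
      KashiwaraVergne.eulerTwo Pi0 =
        (1 / 2 : 𝕜) • (KashiwaraVergne.phi 𝕜)⁻¹
          - KashiwaraVergne.gSeries 𝕜 * PowerSeries.evalNegHom (KashiwaraVergne.phi 𝕜)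
            * (1 - KashiwaraVergne.phi 𝕜) ∧
      βAM = Pi0
        - (1 / 4 : 𝕜) • ((KashiwaraVergne.gSeries 𝕜
              * PowerSeries.evalNegHom (KashiwaraVergne.phi 𝕜)
            - (1 / 2 : 𝕜) • (KashiwaraVergne.phi 𝕜)⁻¹) * PowerSeries.X)
        - (1 / 2 : 𝕜) • (KashiwaraVergne.phi 𝕜)⁻¹
        + KashiwaraVergne.gSeries 𝕜 * PowerSeries.evalNegHom (KashiwaraVergne.phi 𝕜)
            * (1 - KashiwaraVergne.phi 𝕜) ∧
      PowerSeries.evalNegHom γAM + γV =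
        PowerSeries.evalNegHom (KashiwaraVergne.phi 𝕜) * KashiwaraVergne.gSeries 𝕜
            * PowerSeries.X
            * (PowerSeries.evalNegHom βAM - (1 / 4 : 𝕜) • KashiwaraVergne.phi 𝕜
              - PowerSeries.derivative 𝕜 (KashiwaraVergne.phi 𝕜))
          - (1 / 2 : 𝕜) • ((KashiwaraVergne.phi 𝕜)⁻¹ * PowerSeries.X
              * PowerSeries.evalNegHom βAM)
          - (1 / 8 : 𝕜) • PowerSeries.X ∧
      -- the comparison with the universal `β` and with Vergne's `γ`
      βAM = KashiwaraVergne.betaSeries 𝕜 (1 / 4) ∧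
      (∀ n : ℕ, Odd n → PowerSeries.coeff n γAM = PowerSeries.coeff n γV) ∧
      -- `t γAM' + 2 γAM = t / 8 + t² / 12 + t³ / 72 - t⁴ / 720 + o(t⁴)`
      PowerSeries.trunc 5 (KashiwaraVergne.eulerTwo γAM) =
        Polynomial.monomial 1 (1 / 8 : 𝕜) + Polynomial.monomial 2 (1 / 12 : 𝕜)
          + Polynomial.monomial 3 (1 / 72 : 𝕜) - Polynomial.monomial 4 (1 / 720 : 𝕜) ∧
      -- a quadratic Lie algebra on which no universal solution agrees with the solution of
      -- Alekseev and Meinrenken, and on which Vergne's solution is a different one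
      (∃ (L : Type) (_ : NormedLieRing L) (_ : NormedLieAlgebra 𝕜 L)
        (_ : FiniteDimensional 𝕜 L) (κ : KashiwaraVergne.QuadraticStructure 𝕜 L),
        (¬ ∃ a b : KashiwaraVergne.LieSeries 𝕜,
          KashiwaraVergne.IsUniversalSolution a b ∧
            ∀ᶠ p : L × L in nhds (0, 0),
              KashiwaraVergne.solutionAM κ p = (a.eval p, b.eval p)) ∧
        ¬ ∀ᶠ p : L × L in nhds (0, 0),
          (KashiwaraVergne.solutionAM κ p).2 = (KashiwaraVergne.solutionV κ p).2) := by
  refine ⟨KashiwaraVergne.betaAM 𝕜, KashiwaraVergne.gammaAM 𝕜, KashiwaraVergne.gammaV 𝕜,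
    KashiwaraVergne.piZero 𝕜, fun L _ _ _ κ =>
      ⟨KashiwaraVergne.hasFirstOrder_solutionAM_fst κ,
        KashiwaraVergne.hasFirstOrder_solutionAM_snd κ,
        KashiwaraVergne.hasFirstOrder_solutionV_snd κ⟩,
    KashiwaraVergne.eulerTwo_gammaV 𝕜, KashiwaraVergne.eulerTwo_piZero 𝕜,
    KashiwaraVergne.betaAM_eq_piZero 𝕜, ?_, KashiwaraVergne.betaAM_eq 𝕜,
    fun n hn => KashiwaraVergne.coeff_gammaAM_of_odd 𝕜 hn,
    KashiwaraVergne.trunc_eulerTwo_gammaAM 𝕜,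
    KashiwaraVergne.Sl2 𝕜, inferInstance, inferInstance, inferInstance,
    KashiwaraVergne.Sl2.quadratic 𝕜, KashiwaraVergne.not_universal_solutionAM_sl2,
    KashiwaraVergne.solutionAM_ne_solutionV_sl2⟩
  rw [KashiwaraVergne.inv_phi]
  exact KashiwaraVergne.evalNeg_gammaAM_add_gammaV 𝕜
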